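/- **Setting.** Let $\kappa,\lambda,\mu$ be cardinals with $\aleph_0\le\kappa<\lambda\le\mu^+$ and $cf(\kappa)>2^{\aleph_0}$. *Sorts.* For $n\ge 1$ let $IS_n$ be the set of isomorphism types of pairs $(A,\overline g)$, where $A\neq\emptyset$ and $\overline g=(g_1,\dots,g_n)$ is an $n$-tuple of permutations of $A$ (acting on the right) such that $\langle\overline g\rangle$ is transitive on $A$ and, if $\lambda\le\mu$, not every $g_i$ is the identity. Let $Card^-$ be the set of cardinals $\nu<\lambda$ with $\nu=0$ or $\nu\ge\kappa$, and let $F_n$ be the set of functions $h:IS_n\to Card^-$ with $\sum_t h(t)<\lambda$ and, if $\lambda=\mu^+$, $\sum_t h(t)=\mu$. Let $Eq^1\subseteq IS_2$ consist of the types of the $(A,g_1,g_2)$ with $g_1=g_2$, let $Prod^1\subseteq IS_3$ consist of the types of the $(A,g_1,g_2,g_3)$ with $g_1g_2=g_3$, and let $Proj^1_n\subseteq IS_{n+1}\times IS_n$ consist of the pairs of types of $(A_1,g_1,\dots,g_{n+1})$ and $(A_2,g_1|A_2,\dots,g_n|A_2)$ with $A_2\subseteq A_1$. Let $App_n(h,t)=h(t)$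 for $h\in F_n$, $t\in IS_n$. *The structure $\mathcal M^*_{\kappa\lambda\mu}$* is the many-sorted first-order structure $$((IS_n)_{n\ge1},Card^-,(F_n)_{n\ge1};Eq^1,Prod^1,(Proj^1_n)_{n\ge1},<,(App_n)_{n\ge1}).$$ *Ordinals.* Let $\Omega=(2^{\aleph_0})^+$. Write an ordinal $\alpha$ in the form $\alpha=\Omega^\omega\alpha_\omega+\dots+\Omega^n\alpha_{[n]}+\dots+\Omega\alpha_{[1]}+\alpha_{[0]}$ with all $\alpha_{[n]}<\Omega$ and only finitely many of them nonzero, and let $\alpha[n]=\Omega^\omega\alpha_\omega+\dots+\Omega^{n+1}\alpha_{[n+1]}$. Let $\alpha^{[n]}=1+cf(\alpha[n])$ if $cf(\alpha[n])<\Omega$ and $\alpha^{[n]}=0$ otherwise, where $cf(0)=0$ and $cf(\beta+1)=1$. *The structure $\mathcal N^2_{\kappa\lambda\mu}$.* Let $\alpha$ be the order type of $Card^-$. Then $\mathcal N^2_{\kappa\lambda\mu}$ is the many-sorted structure $$((IS_n)_{n\ge1},(\alpha_{[n]})_{n\ge0},(\alpha^{[n]})_{n\ge0};Eq^1,Prod^1,(Proj^1_n)_{n\ge1},(<_n)_{n\ge0},(<^n)_{n\ge0})$$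 (with sorts regarded as pairwise disjoint and $<_n,<^n$ the usual orderings of the ordinals $\alpha_{[n]},\alpha^{[n]}$), viewed in full second-order logic: there are variables for the elements of each sort and, for each finite tuple of sorts, variables for all relations whose $i$th place lies in the $i$th sort of the tuple. *Representations.* For $a\in Card^-\cup\{\lambda\}$ and $S\subseteq Card^-$ let $\gamma(a,S)$ be the order type of the set of those $\beta\in Card^-\cup\{\lambda\}$ with $\beta\le a$ such that $c<\beta$ for every $c\in S$ with $c<a$. For $k\in\mathbb N$ a *$k$-representation* of a tuple $\overline a=(a_0,\dots,a_{n-1})$ of elements of $\mathcal M^*_{\kappa\lambda\mu}$ is a tuple $$(A,<^*,g_0,\dots,g_{k-1},g^0,\dots,g^{k-1},c_0,\dots,c_{n-1})$$ such that $<^*$ is a well-ordering of $IS_2$, $A\subseteq IS_2$, $g_j,g^j:A\cup\{\infty\}\to IS_2$, and for some map $\theta:A\to Card^-$, strictly increasing with respect to $<^*$ on $A$ and extended by $\theta(\infty)=\lambda$: * for all $j<k$ and $a\in A\cup\{\infty\}$, the order types of $\{t\in IS_2:t<^*g_j(a)\}$ and of $\{t\in IS_2:t<^*g^j(a)\}$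 are $\gamma(\theta(a),\theta(A))_{[j]}$ and $\gamma(\theta(a),\theta(A))^{[j]}$ respectively, where $\theta(A)=\{\theta(a):a\in A\}$; * if $a_i\in IS_j$ then $c_i=a_i$; if $a_i\in Card^-$ then $c_i\in A$ and $\theta(c_i)=a_i$; if $a_i\in F_j$ then $c_i$ is a function $IS_j\to A$ with $\theta(c_i(t))=a_i(t)$ for all $t\in IS_j$. All entries are elements of, or relations on, $\mathcal N^2_{\kappa\lambda\mu}$ (functions being coded by their graphs, and the $g_j,g^j$ by the ternary relations $\{(a,a,g(a)):a\in A\}\cup\{(x,y,g(\infty)):x\ne y\}$ on $IS_2$). **Theorem 5.9.** There is an algorithm which, given a first-order formula $\varphi(x_0,\dots,x_{n-1})$ of the language of the structures $\mathcal M^*_{\kappa\lambda\mu}$ (with the sorts of $x_0,\dots,x_{n-1}$), produces an integer $k\ge0$ and a second-order formula $\psi(y_0,\dots,y_{2k+n+1})$ of the language of the structures $\mathcal N^2_{\kappa\lambda\mu}$ such that, for all cardinals $\kappa,\lambda,\mu$ with $\aleph_0\le\kappa<\lambda\le\mu^+$ and $cf(\kappa)>2^{\aleph_0}$, for all $\overline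 a=(a_0,\dots,a_{n-1})$ in $\mathcal M^*_{\kappa\lambda\mu}$ of the correct sorts, and for every $k$-representation $\overline c=(c_0,\dots,c_{2k+n+1})$ of $\overline a$, $$\mathcal M^*_{\kappa\lambda\mu}\models\varphi[\overline a]\iff\mathcal N^2_{\kappa\lambda\mu}\models\psi[\overline c].$$ -/

import Mathlib

universe u

namespace QuotSym

/-! ## Isomorphism types, cardinals and cardinal-valued functions -/

/-- A nonempty set with an `n`-tuple of permutations generating a transitive group; when
`lam ≤ mu`, not every permutation of the tuple is the identity. -/
structure TransPair (lam mu : Cardinal.{u}) (n : ℕ) : Type (u + 1) where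
  carrier : Type u
  nonempty : Nonempty carrier
  perm : Fin n → Equiv.Perm carrier
  transitive : MulAction.IsPretransitive (Subgroup.closure (Set.range perm)) carrier
  nontrivial : lam ≤ mu → ∃ i, perm i ≠ 1

/-- Isomorphism of sets with `n`-tuples of permutations. -/
instance TransPair.setoid (lam mu : Cardinal.{u}) (n : ℕ) : Setoid (TransPair lam mu n) where
  r P Q := ∃ e : P.carrier ≃ Q.carrier, ∀ i x, e (P.perm i x) = Q.perm i (e x)
  iseqv :=
    { refl := fun _ => ⟨Equiv.refl _, fun _ _ => rfl⟩
      symm := by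
        rintro P Q ⟨e, he⟩
        refine ⟨e.symm, fun i x => ?_⟩
        rw [Equiv.symm_apply_eq, he, Equiv.apply_symm_apply]
      trans := by
        rintro P Q R ⟨e, he⟩ ⟨f, hf⟩
        exact ⟨e.trans f, fun i x => by simp [he, hf]⟩ }

/-- `IS_n`: the isomorphism types of transitive `n`-tuples of permutations. -/
abbrev IS (lam mu : Cardinal.{u}) (n : ℕ) : Type (u + 1) :=
  Quotient (TransPair.setoid lam mu n)

section
variable {lam mu : Cardinal.{u}}

/-- `Eq¹`: the types of the pairs `(g₁, g₂)` with `g₁ = g₂`. -/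
def Eq1 (t : IS lam mu 2) : Prop :=
  ∀ P : TransPair lam mu 2, Quotient.mk _ P = t → P.perm 0 = P.perm 1

/-- `Prod¹`: the types of the triples with `g₁ g₂ = g₃`; permutations act on the right, so `g₁` is
applied first. -/
def Prod1 (t : IS lam mu 3) : Prop :=
  ∀ P : TransPair lam mu 3, Quotient.mk _ P = t → ∀ x, P.perm 1 (P.perm 0 x) = P.perm 2 x

/-- `Proj¹_n`: some transitive `(A₂, h₁, …, h_n)` of type `t₂` embeds in some
`(A₁, g₁, …, g_{n+1})` of type `t₁`, each `h_i` being the restriction of `g_i`. -/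
def Proj1 {n : ℕ} (t₁ : IS lam mu (n + 1)) (t₂ : IS lam mu n) : Prop :=
  ∃ (P : TransPair lam mu (n + 1)) (Q : TransPair lam mu n) (e : Q.carrier ↪ P.carrier),
    Quotient.mk _ P = t₁ ∧ Quotient.mk _ Q = t₂ ∧
      ∀ (i : Fin n) y, e (Q.perm i y) = P.perm i.castSucc (e y)

end

/-- The set `Card⁻` of the cardinals `ν < lam` with `ν = 0` or `κ ≤ ν`. -/
def cardMinus (κ lam : Cardinal.{u}) : Set Cardinal.{u} :=
  {ν | ν < lam ∧ (ν = 0 ∨ κ ≤ ν)}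

/-- `F_n`, as a set of functions `IS_n → Card⁻`. (When `cf κ > 2^ℵ₀`, these are the unique
`Card⁻`-valued representatives of the functions `h` from `IS_n` to the cardinals below `lam`, with
`∑ h < lam` and, if `lam = mu⁺`, `∑ h = mu`, modulo differences of total size below `κ`.) -/
def FSet (κ lam mu : Cardinal.{u}) (n : ℕ) : Set (IS lam mu n → cardMinus κ lam) :=
  {h | Cardinal.sum (fun t => (h t : Cardinal.{u})) < Cardinal.lift.{u + 1} lam ∧
    (lam = Order.succ mu →
      Cardinal.sum (fun t => (h t : Cardinal.{u})) = Cardinal.lift.{u + 1} mu)}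

/-! ## Ordinals in base `Ω = (2^ℵ₀)⁺` -/

/-- `Ω = (2^ℵ₀)⁺`. -/
noncomputable def Om : Ordinal.{u} := (Order.succ Cardinal.continuum.{u}).ord

/-- `α_[n]`: the coefficient of `Ω ^ n` in the base `Ω` expansion
`α = Ω ^ ω * α_ω + ⋯ + Ω ^ n * α_[n] + ⋯ + Ω * α_[1] + α_[0]`. -/
noncomputable def coeffLow (α : Ordinal.{u}) (n : ℕ) : Ordinal.{u} := (α / Om ^ n) % Om

/-- `α[n] = Ω ^ ω * α_ω + ⋯ + Ω ^ (n + 1) * α_[n+1]`. -/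
noncomputable def upperPart (α : Ordinal.{u}) (n : ℕ) : Ordinal.{u} :=
  Om ^ (n + 1) * (α / Om ^ (n + 1))

open scoped Classical in
/-- `α^[n]`, which is `1 + cf(α[n])` if `cf(α[n]) < Ω` and `0` otherwise, where `cf 0 = 0` and
the cofinality of a successor is `1`. -/
noncomputable def coeffUp (α : Ordinal.{u}) (n : ℕ) : Ordinal.{u} :=
  if (upperPart α n).cof.ord < Om then 1 + (upperPart α n).cof.ord else 0

/-- The order type of `Card⁻`. -/
noncomputable def alpha (κ lam : Cardinal.{u}) : Ordinal.{u + 1} :=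
  Ordinal.type ((· < ·) : cardMinus κ lam → cardMinus κ lam → Prop)

/-- The set of those `β ≤ a` in `Card⁻ ∪ {lam}` that are strict upper bounds of
`{c ∈ S | c < a}`. -/
def gammaSet (κ lam a : Cardinal.{u}) (S : Set Cardinal.{u}) : Set Cardinal.{u} :=
  {β | (β ∈ cardMinus κ lam ∨ β = lam) ∧ β ≤ a ∧ ∀ c ∈ S, c < a → c < β}

/-- `γ(a, S)`, computed in `Card⁻ ∪ {lam}`; that is, the elements of `Card⁻` are identified with
the ordinals below the order type of `Card⁻`, and `lam` with that order type. -/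
noncomputable def gamma (κ lam a : Cardinal.{u}) (S : Set Cardinal.{u}) : Ordinal.{u + 1} :=
  Ordinal.type ((· < ·) : gammaSet κ lam a S → gammaSet κ lam a S → Prop)

/-! ## The many-sorted first-order structure `M*`

In both languages the variables are `x₀, x₁, x₂, …`; a quantifier names the sort over which its
variable ranges, and the sorts of the free variables are given by a context. -/

/-- The sorts of `M*`. Indices are shifted: `is n` stands for `IS_{n+1}`, `f n` for `F_{n+1}`. -/
inductive MSort : Type
  | is (n : ℕ)
  | card
  | f (n : ℕ)

/-- Terms: variables, and `App_{n+1}(x_i, x_j)` with `x_i` of sort `F_{n+1}` and `x_j` of sort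
`IS_{n+1}`. -/
inductive MTerm : Type
  | var (i : ℕ)
  | app (n i j : ℕ)

/-- First-order formulae of the language of `M*`; `proj1 n` is for `Proj¹_{n+1}`. -/
inductive MFormula : Type
  | eq (s : MSort) (T T' : MTerm)
  | lt (T T' : MTerm)
  | eq1 (i : ℕ)
  | prod1 (i : ℕ)
  | proj1 (n i j : ℕ)
  | neg (φ : MFormula)
  | and (φ φ' : MFormula)
  | ex (i : ℕ) (s : MSort) (φ : MFormula)

/-- The term `T` has sort `s` in the context `Γ`. -/
def MTerm.HasSort (Γ : ℕ → Option MSort) : MTerm → MSort → Prop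
  | .var i, s => Γ i = some s
  | .app n i j, s => Γ i = some (.f n) ∧ Γ j = some (.is n) ∧ s = .card

/-- `φ` is a formula whose free variables are among those in the context `Γ`, with the sorts
given there. -/
def MFormula.WellSorted : MFormula → (ℕ → Option MSort) → Prop
  | .eq s T T', Γ => T.HasSort Γ s ∧ T'.HasSort Γ s
  | .lt T T', Γ => T.HasSort Γ .card ∧ T'.HasSort Γ .card
  | .eq1 i, Γ => Γ i = some (.is 1)
  | .prod1 i, Γ => Γ i = some (.is 2)
  | .proj1 n i j, Γ => Γ i = some (.is (n + 1)) ∧ Γ j = some (.is n)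
  | .neg φ, Γ => φ.WellSorted Γ
  | .and φ φ', Γ => φ.WellSorted Γ ∧ φ'.WellSorted Γ
  | .ex i s φ, Γ => φ.WellSorted (Function.update Γ i (some s))

/-- The sorts of `M*` as sets. -/
def MCarrier (κ lam mu : Cardinal.{u}) : MSort → Type (u + 1)
  | .is n => IS lam mu (n + 1)
  | .card => cardMinus κ lam
  | .f n => FSet κ lam mu (n + 1)

/-- Elements of `M*`, tagged with their sorts. -/
abbrev MElt (κ lam mu : Cardinal.{u}) : Type (u + 1) := Σ s, MCarrier κ lam mu s

section
variable {κ lam mu : Cardinal.{u}}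

/-- An element of `IS_{n+1}` as an element of `M*`. -/
def MElt.ofIS {n : ℕ} (t : IS lam mu (n + 1)) : MElt κ lam mu := ⟨.is n, t⟩

/-- An element of `Card⁻` as an element of `M*`. -/
def MElt.ofCard (β : cardMinus κ lam) : MElt κ lam mu := ⟨.card, β⟩

/-- An element of `F_{n+1}` as an element of `M*`. -/
def MElt.ofF {n : ℕ} (h : FSet κ lam mu (n + 1)) : MElt κ lam mu := ⟨.f n, h⟩

/-- The term `T` has the value `x` under the partial assignment `v`. -/
def MTerm.Denotes (v : ℕ → Option (MElt κ lam mu)) : MTerm → MElt κ lam mu → Prop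
  | .var i, x => v i = some x
  | .app n i j, x => ∃ (h : FSet κ lam mu (n + 1)) (t : IS lam mu (n + 1)),
      v i = some (.ofF h) ∧ v j = some (.ofIS t) ∧ x = .ofCard (h.1 t)

/-- Satisfaction in `M*` under a partial assignment. -/
def MFormula.Sat : MFormula → (ℕ → Option (MElt κ lam mu)) → Prop
  | .eq s T T', v => ∃ x : MCarrier κ lam mu s, T.Denotes v ⟨s, x⟩ ∧ T'.Denotes v ⟨s, x⟩
  | .lt T T', v => ∃ β β' : cardMinus κ lam,
      T.Denotes v (.ofCard β) ∧ T'.Denotes v (.ofCard β') ∧ β < β'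
  | .eq1 i, v => ∃ t : IS lam mu 2, v i = some (.ofIS t) ∧ Eq1 t
  | .prod1 i, v => ∃ t : IS lam mu 3, v i = some (.ofIS t) ∧ Prod1 t
  | .proj1 n i j, v => ∃ (t₁ : IS lam mu (n + 2)) (t₂ : IS lam mu (n + 1)),
      v i = some (.ofIS t₁) ∧ v j = some (.ofIS t₂) ∧ Proj1 t₁ t₂
  | .neg φ, v => ¬ φ.Sat v
  | .and φ φ', v => φ.Sat v ∧ φ'.Sat v
  | .ex i s φ, v => ∃ x : MCarrier κ lam mu s, φ.Sat (Function.update v i (some ⟨s, x⟩))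

/-- `M* ⊨ φ[a₀, …, a_{n-1}]`. -/
def MFormula.Models (φ : MFormula) (a : List (MElt κ lam mu)) : Prop :=
  φ.Sat (fun i => a[i]?)

end

/-! ## The many-sorted second-order structure `N²` -/

/-- The sorts of `N²`: `is n` stands for `IS_{n+1}`, `low n` for `α_[n]`, `up n` for `α^[n]`. -/
inductive NSort : Type
  | is (n : ℕ)
  | low (n : ℕ)
  | up (n : ℕ)

/-- The kinds of variables: over the elements of a sort, and over the relations whose `i`th place
lies in the `i`th sort of a given tuple of sorts. -/
inductive NType : Type
  | elt (σ : NSort)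
  | rel (l : List NSort)

/-- Second-order formulae of the language of `N²`. Here `mem l r [i₁, …, i_m]` says
`(x_{i₁}, …, x_{i_m}) ∈ x_r`, where `x_r` is a variable over relations of type `l`. -/
inductive NFormula : Type
  | eq (σ : NSort) (i j : ℕ)
  | eq1 (i : ℕ)
  | prod1 (i : ℕ)
  | proj1 (n i j : ℕ)
  | ltLow (n i j : ℕ)
  | ltUp (n i j : ℕ)
  | mem (l : List NSort) (r : ℕ) (is : List ℕ)
  | neg (ψ : NFormula)
  | and (ψ ψ' : NFormula)
  | ex (i : ℕ) (τ : NType) (ψ : NFormula)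

/-- `ψ` is a formula whose free variables are among those in the context `Γ`, of the kinds
given there. -/
def NFormula.WellSorted : NFormula → (ℕ → Option NType) → Prop
  | .eq σ i j, Γ => Γ i = some (.elt σ) ∧ Γ j = some (.elt σ)
  | .eq1 i, Γ => Γ i = some (.elt (.is 1))
  | .prod1 i, Γ => Γ i = some (.elt (.is 2))
  | .proj1 n i j, Γ => Γ i = some (.elt (.is (n + 1))) ∧ Γ j = some (.elt (.is n))
  | .ltLow n i j, Γ => Γ i = some (.elt (.low n)) ∧ Γ j = some (.elt (.low n))
  | .ltUp n i j, Γ => Γ i = some (.elt (.up n)) ∧ Γ j = some (.elt (.up n))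
  | .mem l r is, Γ => Γ r = some (.rel l) ∧ is.map Γ = l.map (fun σ => some (.elt σ))
  | .neg ψ, Γ => ψ.WellSorted Γ
  | .and ψ ψ', Γ => ψ.WellSorted Γ ∧ ψ'.WellSorted Γ
  | .ex i τ ψ, Γ => ψ.WellSorted (Function.update Γ i (some τ))

/-- The sorts of `N²` as sets; an ordinal is a sort by way of a set well-ordered in that type. -/
def NBase (κ lam mu : Cardinal.{u}) : NSort → Type (u + 1)
  | .is n => IS lam mu (n + 1)
  | .low n => (coeffLow (alpha κ lam) n).ToType
  | .up n => (coeffUp (alpha κ lam) n).ToType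

/-- The tuples of elements of `N²` with a given tuple of sorts. -/
def NTuple (κ lam mu : Cardinal.{u}) : List NSort → Type (u + 1)
  | [] => PUnit
  | σ :: l => NBase κ lam mu σ × NTuple κ lam mu l

/-- The range of the variables of a given kind. -/
def NCarrier (κ lam mu : Cardinal.{u}) : NType → Type (u + 1)
  | .elt σ => NBase κ lam mu σ
  | .rel l => Set (NTuple κ lam mu l)

/-- Elements of `N²` and relations on `N²`, tagged with their kinds. -/
abbrev NElt (κ lam mu : Cardinal.{u}) : Type (u + 1) := Σ τ, NCarrier κ lam mu τ

section
variable {κ lam mu : Cardinal.{u}}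

/-- An element of `IS_{n+1}` as an element of `N²`. -/
def NElt.ofIS {n : ℕ} (t : IS lam mu (n + 1)) : NElt κ lam mu := ⟨.elt (.is n), t⟩

/-- An element of `α_[n]` as an element of `N²`. -/
def NElt.ofLow {n : ℕ} (x : (coeffLow (alpha κ lam) n).ToType) : NElt κ lam mu := ⟨.elt (.low n), x⟩

/-- An element of `α^[n]` as an element of `N²`. -/
def NElt.ofUp {n : ℕ} (x : (coeffUp (alpha κ lam) n).ToType) : NElt κ lam mu := ⟨.elt (.up n), x⟩

/-- A relation on `N²`. -/
def NElt.ofRel {l : List NSort} (R : Set (NTuple κ lam mu l)) : NElt κ lam mu := ⟨.rel l, R⟩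

/-- The variables with indices `is` have the entries of the tuple as their values. -/
def NTuple.IsValue (v : ℕ → Option (NElt κ lam mu)) :
    (l : List NSort) → List ℕ → NTuple κ lam mu l → Prop
  | [], is, _ => is = []
  | _ :: _, [], _ => False
  | σ :: l, i :: is, p => v i = some ⟨.elt σ, p.1⟩ ∧ NTuple.IsValue v l is p.2

/-- Satisfaction in `N²` under a partial assignment. -/
def NFormula.Sat : NFormula → (ℕ → Option (NElt κ lam mu)) → Prop
  | .eq σ i j, v => ∃ x : NBase κ lam mu σ,
      v i = some ⟨.elt σ, x⟩ ∧ v j = some ⟨.elt σ, x⟩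
  | .eq1 i, v => ∃ t : IS lam mu 2, v i = some (.ofIS t) ∧ Eq1 t
  | .prod1 i, v => ∃ t : IS lam mu 3, v i = some (.ofIS t) ∧ Prod1 t
  | .proj1 n i j, v => ∃ (t₁ : IS lam mu (n + 2)) (t₂ : IS lam mu (n + 1)),
      v i = some (.ofIS t₁) ∧ v j = some (.ofIS t₂) ∧ Proj1 t₁ t₂
  | .ltLow n i j, v => ∃ x y : (coeffLow (alpha κ lam) n).ToType,
      v i = some (.ofLow x) ∧ v j = some (.ofLow y) ∧ x < y
  | .ltUp n i j, v => ∃ x y : (coeffUp (alpha κ lam) n).ToType,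
      v i = some (.ofUp x) ∧ v j = some (.ofUp y) ∧ x < y
  | .mem l r is, v => ∃ (R : Set (NTuple κ lam mu l)) (p : NTuple κ lam mu l),
      v r = some (.ofRel R) ∧ NTuple.IsValue v l is p ∧ p ∈ R
  | .neg ψ, v => ¬ ψ.Sat v
  | .and ψ ψ', v => ψ.Sat v ∧ ψ'.Sat v
  | .ex i τ ψ, v => ∃ x : NCarrier κ lam mu τ, ψ.Sat (Function.update v i (some ⟨τ, x⟩))

/-- `N² ⊨ ψ[d₀, …, d_{m-1}]`. -/
def NFormula.Models (ψ : NFormula) (d : List (NElt κ lam mu)) : Prop :=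
  ψ.Sat (fun i => d[i]?)

end

/-! ## Representations of tuples of `M*` in `N²` -/

/-- The part `(A, <*, g₀, …, g_{k-1}, g⁰, …, g^{k-1})` of a `k`-representation, together with the
map `θ`. Here `none : Option A` is the additional point `∞`, and `θ(∞) = lam`. -/
structure RepBase (κ lam mu : Cardinal.{u}) (k : ℕ) where
  A : Set (IS lam mu 2)
  lt : IS lam mu 2 → IS lam mu 2 → Prop
  isWellOrder : IsWellOrder (IS lam mu 2) lt
  gLow : Fin k → Option A → IS lam mu 2
  gUp : Fin k → Option A → IS lam mu 2
  θ : A → cardMinus κ lam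
  θ_lt : ∀ a b : A, lt a b → θ a < θ b
  /-- `typein lt x` is the order type of `{t | lt t x}`. -/
  gLow_spec : ∀ (j : Fin k) (a : Option A), Ordinal.typein lt (gLow j a) =
    coeffLow (gamma κ lam (a.elim lam fun a => (θ a : Cardinal.{u}))
      (Set.range fun a => (θ a : Cardinal.{u}))) j
  gUp_spec : ∀ (j : Fin k) (a : Option A), Ordinal.typein lt (gUp j a) =
    coeffUp (gamma κ lam (a.elim lam fun a => (θ a : Cardinal.{u}))
      (Set.range fun a => (θ a : Cardinal.{u}))) j

section
variable {κ lam mu : Cardinal.{u}}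

/-- A function `g : A ∪ {∞} → IS_2` as a relation on `N²`: the set of the triples `(a, a, g a)`
with `a ∈ A` and `(x, y, g ∞)` with `x ≠ y`. -/
def optionGraph {A : Set (IS lam mu 2)} (g : Option A → IS lam mu 2) : NElt κ lam mu :=
  .ofRel (l := [.is 1, .is 1, .is 1])
    {p | (∃ ha : p.1 ∈ A, p.2.1 = p.1 ∧ p.2.2.1 = g (some ⟨p.1, ha⟩)) ∨
      (p.1 ≠ p.2.1 ∧ p.2.2.1 = g none)}

/-- The entries `A, <*, g₀, …, g_{k-1}, g⁰, …, g^{k-1}` as relations on `N²`. -/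
def RepBase.head {k : ℕ} (B : RepBase κ lam mu k) : List (NElt κ lam mu) :=
  [.ofRel (l := [.is 1]) {p | p.1 ∈ B.A}, .ofRel (l := [.is 1, .is 1]) {p | B.lt p.1 p.2.1}] ++
    (List.ofFn fun j => optionGraph (B.gLow j)) ++ (List.ofFn fun j => optionGraph (B.gUp j))

/-- The entry `c` represents the entry `a`: an element of `IS_j` represents itself, `b ∈ A`
represents `θ b ∈ Card⁻`, and (the graph of) `H : IS_j → A` represents `θ ∘ H ∈ F_j`. -/
def RepBase.Represents {k : ℕ} (B : RepBase κ lam mu k) : MElt κ lam mu → NElt κ lam mu → Prop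
  | ⟨.is _, t⟩, c => c = .ofIS t
  | ⟨.card, β⟩, c => ∃ b : B.A, B.θ b = β ∧ c = .ofIS b.1
  | ⟨.f n, h⟩, c => ∃ H : IS lam mu (n + 1) → B.A, (∀ t, B.θ (H t) = h.1 t) ∧
      c = .ofRel (l := [.is n, .is 1]) {p | (H p.1 : IS lam mu 2) = p.2.1}

/-- The tuple `c` of `N²` is a `k`-representation of the tuple `a` of `M*`. -/
def IsRepresentation (k : ℕ) (a : List (MElt κ lam mu)) (c : List (NElt κ lam mu)) : Prop :=
  ∃ (B : RepBase κ lam mu k) (d : List (NElt κ lam mu)),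
    c = B.head ++ d ∧ List.Forall₂ B.Represents a d

end

/-- The kind of the entry which represents an element of a given sort of `M*`. -/
def MSort.repType : MSort → NType
  | .is n => .elt (.is n)
  | .card => .elt (.is 1)
  | .f n => .rel [.is n, .is 1]

/-- The kinds of the `2k + n + 2` entries of a `k`-representation of an `n`-tuple. -/
def repContext (k : ℕ) (Γ : List MSort) : List NType :=
  [.rel [.is 1], .rel [.is 1, .is 1]] ++ List.replicate (2 * k) (.rel [.is 1, .is 1, .is 1]) ++
    Γ.map MSort.repType

/-! ## Gödel numbering -/

/-- The Gödel number of a sort of `M*`. -/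
def MSort.code : MSort → ℕ
  | .is n => Nat.pair 0 n
  | .card => Nat.pair 1 0
  | .f n => Nat.pair 2 n

/-- The Gödel number of a term. -/
def MTerm.code : MTerm → ℕ
  | .var i => Nat.pair 0 i
  | .app n i j => Nat.pair 1 (Nat.pair n (Nat.pair i j))

/-- The Gödel number of a first-order formula. -/
def MFormula.code : MFormula → ℕ
  | .eq s T T' => Nat.pair 0 (Nat.pair s.code (Nat.pair T.code T'.code))
  | .lt T T' => Nat.pair 1 (Nat.pair T.code T'.code)
  | .eq1 i => Nat.pair 2 i
  | .prod1 i => Nat.pair 3 i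
  | .proj1 n i j => Nat.pair 4 (Nat.pair n (Nat.pair i j))
  | .neg φ => Nat.pair 5 φ.code
  | .and φ φ' => Nat.pair 6 (Nat.pair φ.code φ'.code)
  | .ex i s φ => Nat.pair 7 (Nat.pair i (Nat.pair s.code φ.code))

/-- The Gödel number of a sort of `N²`. -/
def NSort.code : NSort → ℕ
  | .is n => Nat.pair 0 n
  | .low n => Nat.pair 1 n
  | .up n => Nat.pair 2 n

/-- The Gödel number of a kind of variables. -/
def NType.code : NType → ℕ
  | .elt σ => Nat.pair 0 σ.code
  | .rel l => Nat.pair 1 (Encodable.encode (l.map NSort.code))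

/-- The Gödel number of a second-order formula. -/
def NFormula.code : NFormula → ℕ
  | .eq σ i j => Nat.pair 0 (Nat.pair σ.code (Nat.pair i j))
  | .eq1 i => Nat.pair 1 i
  | .prod1 i => Nat.pair 2 i
  | .proj1 n i j => Nat.pair 3 (Nat.pair n (Nat.pair i j))
  | .ltLow n i j => Nat.pair 4 (Nat.pair n (Nat.pair i j))
  | .ltUp n i j => Nat.pair 5 (Nat.pair n (Nat.pair i j))
  | .mem l r is => Nat.pair 6
      (Nat.pair (Encodable.encode (l.map NSort.code)) (Nat.pair r (Encodable.encode is)))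
  | .neg ψ => Nat.pair 7 ψ.code
  | .and ψ ψ' => Nat.pair 8 (Nat.pair ψ.code ψ'.code)
  | .ex i τ ψ => Nat.pair 9 (Nat.pair i (Nat.pair τ.code ψ.code))

theorem NSort.code_injective : Function.Injective NSort.code := by
  intro σ σ' h
  cases σ <;> cases σ' <;> simp_all [NSort.code, Nat.pair_eq_pair]

theorem NType.code_injective : Function.Injective NType.code := by
  intro τ τ' h
  cases τ <;> cases τ' <;> simp_all [NType.code, Nat.pair_eq_pair]
  · exact NSort.code_injective h
  · exact List.map_injective_iff.2 NSort.code_injective h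

/-- Different second-order formulae have different Gödel numbers. -/
theorem NFormula.code_injective : Function.Injective NFormula.code := by
  intro ψ
  induction ψ with
  | neg ψ ih =>
    intro ψ' h
    cases ψ' <;> simp only [NFormula.code, Nat.pair_eq_pair] at h <;> simp at h
    rw [ih h]
  | and ψ ψ₁ ih ih₁ =>
    intro ψ' h
    cases ψ' <;> simp only [NFormula.code, Nat.pair_eq_pair] at h <;> simp at h
    rw [ih h.1, ih₁ h.2]
  | ex i τ ψ ih =>
    intro ψ' h
    cases ψ' <;> simp only [NFormula.code, Nat.pair_eq_pair] at h <;> simp at h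
    rw [h.1, NType.code_injective h.2.1, ih h.2.2]
  | mem l r is =>
    intro ψ' h
    cases ψ' <;> simp_all [NFormula.code, Nat.pair_eq_pair]
    exact List.map_injective_iff.2 NSort.code_injective h.1
  | eq σ i j =>
    intro ψ' h
    cases ψ' <;> simp_all [NFormula.code, Nat.pair_eq_pair]
    exact NSort.code_injective h.1
  | _ =>
    intro ψ' h
    cases ψ' <;> simp_all [NFormula.code, Nat.pair_eq_pair]

end QuotSym

universe v

namespace QuotSym

open Ordinal Cardinal Set

/-! ## Base `Ω` arithmetic -/

/-! Identify `Card⁻ ∪ {lam}` with an initial segment of the ordinals, by ranks. There are at most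
`𝔠` isomorphism types in each `IS_n`, exactly `𝔠` in `IS_2`, and every nonzero member of `Card⁻`
exceeds `𝔠`. Hence the sum of the values of a function is their supremum: `F_n` consists of the
bounded functions `IS_n → Card⁻` whose only bound, when `lam = mu⁺`, is the greatest element
(`mem_FSet_iff`). The condition `lam = mu⁺` itself is expressible by `Proj¹`
(`eq_succ_iff_forall_exists_proj1`). So a quantifier over `M*` names at most `𝔠` ordinals at a time.

Sets of at most `𝔠` ordinals are compared by the lengths of the gaps that end at their points. Two
gaps agree at level `k` (`GapEq k`) if they have the same residue modulo `Ω ^ (k + 1)` and the parts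
above have the same cofinality, all cofinalities above `𝔠` being identified. If two gaps agree at
level `k + 1`, then any at most `𝔠` points of one can be answered by points of the other so that all
the new gaps agree at level `k` (`GapEq.extendable`, `exists_extension`). Indeed at most `𝔠` points
leave a final segment of a gap of cofinality above `𝔠` untouched, while a limit gap of smaller
cofinality is cut by a cofinal sequence into gaps of the former kind. This is a back-and-forth
system (`PartialIso.forth`, `PartialIso.back`) which loses one level per move.

At level `k` every gap agrees with a canonical one below `Ω ^ (k + 2)`, and the digits of the latter
are given by `g_0, …, g_k` and `g^k`. Replacing all the gaps of `θ(A) ∪ {lam}` by canonical ones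
collapses the structure to an ordinal below `Ω ^ (k + 2)` (`partialIso_collapse`, `collapse_lt`). A
formula keeps its truth value if `k` is at least twice its quantifier rank (`MFormula.sat_tr_iff`),
and its Gödel number is such a `k`.

The collapse is definable by second-order means over `IS_2`. Ordinals below `Ω` are order types of
well-orderings of subsets of `IS_2`. An element of the collapse is given by the label of its block
and its place in the block, that is, by finitely many digits below `Ω`, compared lexicographically
with the label in front; the first elements of `<*` serve as indices of the digits. The formula `ψ`
says that there are such indices, a relation coding the ends of the blocks, and codes of the given
elements, for which the translation of `φ` holds (`Blocks.isBlockTop_iff`, `Blocks.sInc_iff`,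
`MFormula.models_translate_iff`). As `ψ` is built by recursion on `φ`, its Gödel number is a
primitive recursive function of that of `φ` (`primrec_trCode`). -/

theorem isSuccLimit_Om : Order.IsSuccLimit Om.{v} :=
  isSuccLimit_ord (aleph0_le_continuum.trans (Order.le_succ _))

theorem Om_pos : 0 < Om.{v} := isSuccLimit_Om.bot_lt

theorem Om_ne_zero : Om.{v} ≠ 0 := Om_pos.ne'

theorem card_lt_of_lt_Om {o : Ordinal.{v}} (h : o < Om) : o.card ≤ 𝔠 :=
  Order.lt_succ_iff.1 (lt_ord.1 h)

theorem lt_Om_of_card_le {o : Ordinal.{v}} (h : o.card ≤ 𝔠) : o < Om :=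
  lt_ord.2 (Order.lt_succ_iff.2 h)

theorem Om_pow_pos (n : ℕ) : 0 < Om.{v} ^ n := by
  rw [← opow_natCast]; exact opow_pos _ Om_pos

theorem Om_pow_ne_zero (n : ℕ) : Om.{v} ^ n ≠ 0 := (Om_pow_pos n).ne'

theorem isSuccLimit_Om_pow (n : ℕ) : Order.IsSuccLimit (Om.{v} ^ (n + 1)) := by
  rw [pow_succ]; exact isSuccLimit_mul_right (Om_pow_pos n) isSuccLimit_Om

theorem isPrincipal_Om_pow (n : ℕ) : IsPrincipal (· + ·) (Om.{v} ^ n) := by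
  rw [← opow_natCast]
  exact isPrincipal_add_opow_of_isPrincipal_add
    (isPrincipal_add_ord (aleph0_le_continuum.trans (Order.le_succ _))) _

theorem cof_Om : Om.{v}.cof = Order.succ 𝔠 :=
  (isRegular_succ aleph0_le_continuum).cof_ord

theorem cof_Om_pow (n : ℕ) : (Om.{v} ^ (n + 1)).cof = Order.succ 𝔠 := by
  rw [pow_succ, cof_mul (Om_pow_ne_zero n) isSuccLimit_Om.isSuccPrelimit, cof_Om]

theorem cof_ord_lt_Om_iff {o : Ordinal.{v}} : o.cof.ord < Om ↔ o.cof ≤ 𝔠 := by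
  rw [Om, ord_lt_ord, Order.lt_succ_iff]

open scoped Classical in
/-- The invariant `coeffUp` in terms of the upper part. -/
noncomputable def cofTag (o : Ordinal.{v}) : Ordinal.{v} :=
  if o.cof.ord < Om then 1 + o.cof.ord else 0

theorem coeffUp_eq (γ : Ordinal.{v}) (k : ℕ) : coeffUp γ k = cofTag (upperPart γ k) := rfl

theorem cofTag_add (a : Ordinal.{v}) {b : Ordinal.{v}} (hb : b ≠ 0) :
    cofTag (a + b) = cofTag b := by
  unfold cofTag; rw [cof_add a hb]

theorem cofTag_zero : cofTag (0 : Ordinal.{v}) = 1 := by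
  simp [cofTag, Om_pos]

theorem cofTag_eq_zero_iff {o : Ordinal.{v}} : cofTag o = 0 ↔ 𝔠 < o.cof := by
  unfold cofTag
  split_ifs with h
  · rw [cof_ord_lt_Om_iff] at h
    simp [h]
  · rw [cof_ord_lt_Om_iff] at h
    simpa using h

theorem cofTag_eq_one_iff {o : Ordinal.{v}} : cofTag o = 1 ↔ o = 0 := by
  refine ⟨fun h => ?_, fun h => h ▸ cofTag_zero⟩
  unfold cofTag at h
  split_ifs at h with h1
  · have : (1 : Ordinal) + o.cof.ord = 1 + 0 := by rw [h, add_zero]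
    simpa using this
  · simp at h

theorem upperPart_add_mod (γ : Ordinal.{v}) (k : ℕ) :
    upperPart γ k + γ % Om ^ (k + 1) = γ := div_add_mod _ _

theorem cof_mul_succ_Om_pow (k : ℕ) (x : Ordinal.{v}) :
    (Om.{v} ^ (k + 1) * (x + 1)).cof = Order.succ 𝔠 := by
  rw [mul_add_one, cof_add _ (Om_pow_ne_zero _), cof_Om_pow]

/-- Ordinals with the same coefficients below `Ω ^ (k + 1)` and upper parts of the same kind. -/
def GapEq (k : ℕ) (γ γ' : Ordinal.{v}) : Prop :=
  γ % Om ^ (k + 1) = γ' % Om ^ (k + 1) ∧ coeffUp γ k = coeffUp γ' k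

theorem GapEq.refl (k : ℕ) (γ : Ordinal.{v}) : GapEq k γ γ := ⟨rfl, rfl⟩

theorem GapEq.symm {k : ℕ} {γ γ' : Ordinal.{v}} (h : GapEq k γ γ') : GapEq k γ' γ :=
  ⟨h.1.symm, h.2.symm⟩

theorem upperPart_mul (k : ℕ) (w : Ordinal.{v}) :
    upperPart (Om ^ (k + 2) * w) k = Om ^ (k + 2) * w := by
  rw [upperPart, pow_succ Om (k + 1), mul_assoc, mul_div_cancel _ (Om_pow_ne_zero _)]

theorem mul_mod_Om (k : ℕ) (w : Ordinal.{v}) : (Om ^ (k + 2) * w) % Om ^ (k + 1) = 0 := by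
  rw [pow_succ Om (k + 1), mul_assoc, mul_mod]

/-- A nonempty final segment of a multiple of `Ω ^ m` is again a multiple of `Ω ^ m`. -/
theorem exists_mul_eq_sub {m : ℕ} {z q : Ordinal.{v}} (h : q < Om ^ m * z) :
    ∃ w, w ≠ 0 ∧ Om ^ m * z - q = Om ^ m * w ∧ cofTag (Om ^ m * w) = cofTag (Om ^ m * z) := by
  have hb : q / Om ^ m < z := (lt_mul_iff_div_lt (Om_pow_ne_zero m)).1 h
  have hz : q / Om ^ m + (z - q / Om ^ m) = z := Ordinal.add_sub_cancel_of_le hb.le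
  have hw : z - q / Om ^ m ≠ 0 := by
    intro h0
    rw [h0, add_zero] at hz
    exact hb.ne hz
  have key : q + Om ^ m * (z - q / Om ^ m) = Om ^ m * z := by
    conv_lhs => enter [1]; rw [← div_add_mod q (Om ^ m)]
    rw [add_assoc]
    -- A nonzero multiple of `Ω ^ m` absorbs any summand below `Ω ^ m` on its left, because `Ω ^ m`
    -- is closed under addition. So only the quotient of `q` matters.
    have : q % Om ^ m + Om ^ m * (z - q / Om ^ m) = Om ^ m * (z - q / Om ^ m) := by
      refine (isPrincipal_Om_pow m).add_eq_right_of_le (mod_lt _ (Om_pow_ne_zero m)) ?_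
      exact le_mul_left _ (pos_iff_ne_zero.2 hw)
    rw [this, ← mul_add, hz]
  refine ⟨_, hw, sub_eq_of_add_eq key, ?_⟩
  rw [← key, cofTag_add]
  exact (mul_ne_zero (Om_pow_ne_zero m) hw)

/-! ## Gaps -/

/-- The least strict upper bound of the elements of `S` below `a`. -/
noncomputable def gapStart (S : Set Ordinal.{v}) (a : Ordinal.{v}) : Ordinal.{v} :=
  sInf {β | ∀ c ∈ S, c < a → c < β}

/-- The length of the interval from `gapStart S a` to `a`. -/
noncomputable def gap (S : Set Ordinal.{v}) (a : Ordinal.{v}) : Ordinal.{v} := a - gapStart S a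

theorem gapStart_le_iff {S : Set Ordinal.{v}} {a β : Ordinal.{v}} :
    gapStart S a ≤ β ↔ ∀ c ∈ S, c < a → c < β := by
  have hne : {β | ∀ c ∈ S, c < a → c < β}.Nonempty := ⟨a, fun _ _ h => h⟩
  refine ⟨fun h c hc hca => (csInf_mem hne c hc hca).trans_le h, fun h => csInf_le' h⟩

theorem gapStart_le (S : Set Ordinal.{v}) (a : Ordinal.{v}) : gapStart S a ≤ a :=
  gapStart_le_iff.2 fun _ _ h => h

theorem lt_gapStart {S : Set Ordinal.{v}} {a c : Ordinal.{v}} (hc : c ∈ S) (h : c < a) :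
    c < gapStart S a := gapStart_le_iff.1 le_rfl c hc h

theorem gapStart_add_gap (S : Set Ordinal.{v}) (a : Ordinal.{v}) : gapStart S a + gap S a = a :=
  Ordinal.add_sub_cancel_of_le (gapStart_le S a)

theorem gapStart_congr {S S' : Set Ordinal.{v}} {a a' : Ordinal.{v}}
    (h : ∀ β, (∀ c ∈ S, c < a → c < β) ↔ ∀ c ∈ S', c < a' → c < β) :
    gapStart S a = gapStart S' a' :=
  eq_of_forall_ge_iff fun β => by rw [gapStart_le_iff, gapStart_le_iff, h]

/-- At most `𝔠` points below an ordinal of cofinality above `𝔠` are bounded strictly below it. -/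
theorem gapStart_lt {S : Set Ordinal.{v}} {a : Ordinal.{v}} (hS : #S ≤ 𝔠) (ha : 𝔠 < a.cof) :
    gapStart S a < a := by
  have h1 : sSup ((· + 1) '' {c ∈ S | c < a}) < a := by
    apply sSup_add_one_lt_of_lt_cof
    · rw [← Cardinal.lift_continuum.{v+1, v}] at hS
      refine lt_of_le_of_lt ((Cardinal.mk_le_mk_of_subset (sep_subset _ _)).trans hS) ?_
      rw [← lift_cof, Cardinal.lift_lt]
      exact ha
    · intro i hi; exact hi.2
  refine lt_of_le_of_lt (gapStart_le_iff.2 fun c hc hca => ?_) h1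
  have hb : BddAbove ((· + 1) '' {c ∈ S | c < a}) :=
    ⟨a, by rintro _ ⟨c, hc, rfl⟩; exact Order.add_one_le_iff.2 hc.2⟩
  exact lt_of_lt_of_le (lt_add_one c) (le_csSup hb ⟨c, ⟨hc, hca⟩, rfl⟩)

/-- Each gap of `range a` is subdivided by a set `R i` which contains its right end. The points in
earlier gaps lie below the start of the gap of `a i`, and those in later gaps lie above it, so the
new gaps inside it depend on `R i` alone. -/
theorem gapStart_iUnion {ι : Type*} {a : ι → Ordinal.{v}} (ha : Function.Injective a)
    {R : ι → Set Ordinal.{v}} (hR : ∀ i, gap (range a) (a i) ∈ R i)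
    (hR' : ∀ i, ∀ y ∈ R i, y ≤ gap (range a) (a i)) (i : ι) {y : Ordinal.{v}} (hy : y ∈ R i) :
    gapStart {x | ∃ i, ∃ y ∈ R i, x = gapStart (range a) (a i) + y}
      (gapStart (range a) (a i) + y) = gapStart (range a) (a i) + gapStart (R i) y := by
  have hle : ∀ j, ∀ z ∈ R j, gapStart (range a) (a j) + z ≤ a j := fun j z hz => by
    conv_rhs => rw [← gapStart_add_gap (range a) (a j)]
    exact add_le_add_right (hR' j z hz) _
  refine eq_of_forall_ge_iff fun β => ?_
  rw [gapStart_le_iff]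
  constructor
  · intro h
    have h1 : gapStart (range a) (a i) ≤ β := by
      rw [gapStart_le_iff]
      rintro _ ⟨j, rfl⟩ hj
      refine h _ ⟨j, _, hR j, (gapStart_add_gap _ _).symm⟩ ?_
      exact (lt_gapStart (mem_range_self j) hj).trans_le (le_add_right le_rfl)
    obtain ⟨b, rfl⟩ := exists_add_of_le h1
    refine add_le_add_right (gapStart_le_iff.2 fun z hz hzy => ?_) _
    exact lt_of_add_lt_add_left (h _ ⟨i, z, hz, rfl⟩ (add_lt_add_right hzy _))
  · rintro h _ ⟨j, z, hz, rfl⟩ hlt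
    rcases lt_trichotomy (a j) (a i) with hji | hji | hji
    · refine (hle j z hz).trans_lt (lt_of_lt_of_le (lt_gapStart (mem_range_self j) hji) ?_)
      exact (le_add_right le_rfl).trans h
    · obtain rfl := ha hji
      refine lt_of_lt_of_le (add_lt_add_right (lt_gapStart hz ?_) _) h
      exact lt_of_add_lt_add_left hlt
    · exfalso
      refine hlt.not_ge ((hle i y hy).trans ?_)
      exact (lt_gapStart (mem_range_self i) hji).le.trans (le_add_right le_rfl)

/-! ## Partial isomorphisms with equivalent gaps -/

/-- A small order-preserving set of pairs of ordinals, with equivalent gaps. -/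
structure PartialIso (k : ℕ) (P : Set (Ordinal.{v} × Ordinal.{v})) : Prop where
  small : #P ≤ 𝔠
  lt_iff : ∀ p ∈ P, ∀ q ∈ P, p.1 < q.1 ↔ p.2 < q.2
  gapEq : ∀ p ∈ P, GapEq k (gap (Prod.fst '' P) p.1) (gap (Prod.snd '' P) p.2)

theorem PartialIso.swap {k : ℕ} {P : Set (Ordinal.{v} × Ordinal.{v})} (h : PartialIso k P) :
    PartialIso k (Prod.swap '' P) where
  small := mk_image_le.trans h.small
  lt_iff := by
    rintro _ ⟨p, hp, rfl⟩ _ ⟨q, hq, rfl⟩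
    exact (h.lt_iff p hp q hq).symm
  gapEq := by
    rintro _ ⟨p, hp, rfl⟩
    have := (h.gapEq p hp).symm
    simpa [image_image] using this

/-- Every small set of points below `γ` can be carried over to `γ'`. -/
def Extendable (k : ℕ) (γ γ' : Ordinal.{v}) : Prop :=
  ∀ T : Set Ordinal.{v}, #T ≤ 𝔠 → (∀ x ∈ T, x < γ) →
    ∃ P, PartialIso k P ∧ (γ, γ') ∈ P ∧ T ⊆ Prod.fst '' P ∧ ∀ p ∈ P, p.1 ≤ γ

theorem eq_iff_of_lt_iff {P : Set (Ordinal.{v} × Ordinal.{v})}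
    (h : ∀ p ∈ P, ∀ q ∈ P, p.1 < q.1 ↔ p.2 < q.2) {p q} (hp : p ∈ P) (hq : q ∈ P) :
    p.1 = q.1 ↔ p.2 = q.2 := by
  simp only [le_antisymm_iff, ← not_lt, h p hp q hq, h q hq p hp]

theorem le_iff_of_lt_iff {P : Set (Ordinal.{v} × Ordinal.{v})}
    (h : ∀ p ∈ P, ∀ q ∈ P, p.1 < q.1 ↔ p.2 < q.2) {p q} (hp : p ∈ P) (hq : q ∈ P) :
    p.1 ≤ q.1 ↔ p.2 ≤ q.2 := by
  simp only [← not_lt, h q hq p hp]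

/-- Gluing: inside each gap of `P₀` the trace of `T` is answered separately, and the pieces are
translated to the starts of their gaps. The gaps of the union are the gaps of the pieces by
`gapStart_iUnion`, and the union has at most `𝔠 * 𝔠` elements. -/
theorem exists_extension {k : ℕ} {P₀ : Set (Ordinal.{v} × Ordinal.{v})} (hs : #P₀ ≤ 𝔠)
    (hlt : ∀ p ∈ P₀, ∀ q ∈ P₀, p.1 < q.1 ↔ p.2 < q.2)
    (hext : ∀ p ∈ P₀, Extendable k (gap (Prod.fst '' P₀) p.1) (gap (Prod.snd '' P₀) p.2))
    {T : Set Ordinal.{v}} (hT : #T ≤ 𝔠) (hTP : ∀ x ∈ T, ∃ p ∈ P₀, x ≤ p.1) :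
    ∃ P, P₀ ⊆ P ∧ PartialIso k P ∧ T ⊆ Prod.fst '' P ∧ ∀ p ∈ P, ∃ q ∈ P₀, p.1 ≤ q.1 := by
  let a : P₀ → Ordinal.{v} := fun p => p.1.1
  let a' : P₀ → Ordinal.{v} := fun p => p.1.2
  have hra : range a = Prod.fst '' P₀ := by ext; simp [a]
  have hra' : range a' = Prod.snd '' P₀ := by ext; simp [a']
  have ha : Function.Injective a := fun p q h =>
    Subtype.ext (Prod.ext h ((eq_iff_of_lt_iff hlt p.2 q.2).1 h))
  have ha' : Function.Injective a' := fun p q h =>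
    Subtype.ext (Prod.ext ((eq_iff_of_lt_iff hlt p.2 q.2).2 h) h)
  have H : ∀ p : P₀, ∃ Q, PartialIso k Q ∧ (gap (range a) (a p), gap (range a') (a' p)) ∈ Q ∧
      {y | y < gap (range a) (a p) ∧ gapStart (range a) (a p) + y ∈ T} ⊆ Prod.fst '' Q ∧
      ∀ q ∈ Q, q.1 ≤ gap (range a) (a p) := by
    intro p
    have := hext p.1 p.2
    rw [← hra, ← hra'] at this
    refine this _ ?_ fun x hx => hx.1
    refine le_trans ?_ hT
    exact mk_le_of_injective (f := fun y => ⟨_, y.2.2⟩) fun y z h => by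
      simpa [Subtype.ext_iff] using h
  choose Q hQ hQtop hQT hQle using H
  have hQle' : ∀ p, ∀ q ∈ Q p, q.2 ≤ gap (range a') (a' p) := fun p q hq =>
    (le_iff_of_lt_iff (hQ p).lt_iff hq (hQtop p)).1 (hQle p q hq)
  let P : Set (Ordinal.{v} × Ordinal.{v}) := {x | ∃ p, ∃ q ∈ Q p,
    x = (gapStart (range a) (a p) + q.1, gapStart (range a') (a' p) + q.2)}
  have hP₀ : P₀ ⊆ P := fun p hp =>
    ⟨⟨p, hp⟩, _, hQtop _, Prod.ext (gapStart_add_gap _ _).symm (gapStart_add_gap _ _).symm⟩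
  have hle : ∀ p, ∀ q ∈ Q p, gapStart (range a) (a p) + q.1 ≤ a p := fun p q hq => by
    conv_rhs => rw [← gapStart_add_gap (range a) (a p)]
    exact add_le_add_right (hQle p q hq) _
  have hle' : ∀ p, ∀ q ∈ Q p, gapStart (range a') (a' p) + q.2 ≤ a' p := fun p q hq => by
    conv_rhs => rw [← gapStart_add_gap (range a') (a' p)]
    exact add_le_add_right (hQle' p q hq) _
  have hord : ∀ p q, a p < a q → ∀ r ∈ Q p, ∀ s ∈ Q q,
      gapStart (range a) (a p) + r.1 < gapStart (range a) (a q) + s.1 ∧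
      gapStart (range a') (a' p) + r.2 < gapStart (range a') (a' q) + s.2 := by
    intro p q hpq r hr s hs
    refine ⟨(hle p r hr).trans_lt ?_, (hle' p r hr).trans_lt ?_⟩
    · exact (lt_gapStart (mem_range_self p) hpq).trans_le (le_add_right le_rfl)
    · exact (lt_gapStart (mem_range_self p) ((hlt p.1 p.2 q.1 q.2).1 hpq)).trans_le
        (le_add_right le_rfl)
  refine ⟨P, hP₀, ⟨?_, ?_, ?_⟩, ?_, ?_⟩
  · have : P = ⋃ p, (fun q : Ordinal.{v} × Ordinal.{v} =>
        (gapStart (range a) (a p) + q.1, gapStart (range a') (a' p) + q.2)) '' Q p := by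
      ext x; simp only [P, mem_ofPred_eq, mem_iUnion, mem_image]
      exact exists_congr fun p => exists_congr fun q => and_congr_right fun _ => eq_comm
    rw [this]
    refine (mk_iUnion_le _).trans ?_
    refine (mul_le_mul' hs (ciSup_le' fun p => mk_image_le.trans (hQ p).small)).trans ?_
    rw [continuum_mul_self]
  · rintro _ ⟨p, r, hr, rfl⟩ _ ⟨q, s, hs, rfl⟩
    rcases lt_trichotomy (a p) (a q) with h | h | h
    · have := hord p q h r hr s hs
      exact iff_of_true this.1 this.2
    · obtain rfl := ha h
      simpa using (hQ p).lt_iff r hr s hs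
    · have := hord q p h s hs r hr
      exact iff_of_false this.1.not_gt this.2.not_gt
  · have e1 : Prod.fst '' P = {x | ∃ p, ∃ y ∈ Prod.fst '' Q p,
        x = gapStart (range a) (a p) + y} := by
      ext x
      constructor
      · rintro ⟨_, ⟨p, q, hq, rfl⟩, rfl⟩
        exact ⟨p, _, mem_image_of_mem _ hq, rfl⟩
      · rintro ⟨p, _, ⟨q, hq, rfl⟩, rfl⟩
        exact ⟨_, ⟨p, q, hq, rfl⟩, rfl⟩
    have e2 : Prod.snd '' P = {x | ∃ p, ∃ y ∈ Prod.snd '' Q p,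
        x = gapStart (range a') (a' p) + y} := by
      ext x
      constructor
      · rintro ⟨_, ⟨p, q, hq, rfl⟩, rfl⟩
        exact ⟨p, _, mem_image_of_mem _ hq, rfl⟩
      · rintro ⟨p, _, ⟨q, hq, rfl⟩, rfl⟩
        exact ⟨_, ⟨p, q, hq, rfl⟩, rfl⟩
    rintro _ ⟨p, r, hr, rfl⟩
    have := (hQ p).gapEq r hr
    have g1 := gapStart_iUnion ha (R := fun i => Prod.fst '' Q i)
      (fun i => ⟨_, hQtop i, rfl⟩) (by rintro i _ ⟨q, hq, rfl⟩; exact hQle i q hq) p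
      (mem_image_of_mem _ hr)
    have g2 := gapStart_iUnion ha' (R := fun i => Prod.snd '' Q i)
      (fun i => ⟨_, hQtop i, rfl⟩) (by rintro i _ ⟨q, hq, rfl⟩; exact hQle' i q hq) p
      (mem_image_of_mem _ hr)
    rw [gap, gap, e1, e2, g1, g2, Ordinal.add_sub_add_cancel, Ordinal.add_sub_add_cancel]
    exact this
  · intro x hx
    -- The point `x` lies in the gap which ends at the least first coordinate not below `x`.
    have hne : {y | ∃ p : P₀, y = a p ∧ x ≤ y}.Nonempty := by
      obtain ⟨p, hp, hxp⟩ := hTP x hx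
      exact ⟨_, ⟨p, hp⟩, rfl, hxp⟩
    obtain ⟨p, hp, hxp⟩ := csInf_mem hne
    rw [hp] at hxp
    have h1 : gapStart (range a) (a p) ≤ x := by
      rw [gapStart_le_iff]
      rintro _ ⟨q, rfl⟩ hq
      by_contra hc
      exact hq.not_ge (hp ▸ csInf_le' ⟨q, rfl, not_lt.1 hc⟩)
    obtain ⟨y, rfl⟩ := exists_add_of_le h1
    have hy : y ≤ gap (range a) (a p) := (le_sub_of_le (gapStart_le _ _)).2 hxp
    rcases hy.eq_or_lt with rfl | hy
    · exact ⟨_, ⟨p, _, hQtop p, rfl⟩, rfl⟩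
    · obtain ⟨q, hq, rfl⟩ := hQT p ⟨hy, hx⟩
      exact ⟨_, ⟨p, q, hq, rfl⟩, rfl⟩
  · rintro _ ⟨p, q, hq, rfl⟩
    exact ⟨p.1, p.2, hle p q hq⟩

/-! ### Canonical gaps and the collapse -/

open scoped Classical in
/-- A multiplier `x < Ω` for which `Ω ^ (k + 1) * x` has the tag `t`. -/
noncomputable def tagWitness (t : Ordinal.{v}) : Ordinal.{v} :=
  if t = 0 then 1 else if t = 1 then 0 else t

/-- The canonical ordinal below `Ω ^ (k + 2)` which is equivalent to `γ`. -/
noncomputable def canonicalGap (k : ℕ) (γ : Ordinal.{v}) : Ordinal.{v} :=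
  Om ^ (k + 1) * tagWitness (coeffUp γ k) + γ % Om ^ (k + 1)

theorem cofTag_lt_Om (o : Ordinal.{v}) : cofTag o < Om := by
  unfold cofTag
  split_ifs with h
  · have := isPrincipal_Om_pow.{v} 1
    rw [pow_one] at this
    exact this (one_lt_of_isSuccLimit isSuccLimit_Om) h
  · exact Om_pos

theorem tagWitness_lt {t : Ordinal.{v}} (h : t < Om) : tagWitness t < Om := by
  unfold tagWitness
  split_ifs
  · exact one_lt_of_isSuccLimit isSuccLimit_Om
  · exact Om_pos
  · exact h

theorem mul_add_lt_Om_pow {m : ℕ} {x r : Ordinal.{v}} (hx : x < Om) (hr : r < Om ^ m) :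
    Om ^ m * x + r < Om ^ (m + 1) := by
  calc Om ^ m * x + r < Om ^ m * x + Om ^ m := add_lt_add_right hr _
    _ = Om ^ m * (x + 1) := (mul_add_one _ _).symm
    _ ≤ Om ^ m * Om := mul_le_mul_right (Order.add_one_le_iff.2 hx) _
    _ = Om ^ (m + 1) := (pow_succ _ _).symm

theorem upperPart_mul_add (k : ℕ) (x : Ordinal.{v}) {r : Ordinal.{v}} (hr : r < Om ^ (k + 1)) :
    upperPart (Om ^ (k + 1) * x + r) k = Om ^ (k + 1) * x := by
  rw [upperPart, mul_add_div _ (Om_pow_ne_zero _), div_eq_zero_of_lt hr, add_zero]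

theorem canonicalGap_lt (k : ℕ) (γ : Ordinal.{v}) : canonicalGap k γ < Om ^ (k + 2) :=
  mul_add_lt_Om_pow (tagWitness_lt (cofTag_lt_Om _)) (mod_lt _ (Om_pow_ne_zero _))

theorem isSuccLimit_upperPart {γ : Ordinal.{v}} {k : ℕ} (h : upperPart γ k ≠ 0) :
    Order.IsSuccLimit (upperPart γ k) :=
  isSuccLimit_mul_left (isSuccLimit_Om_pow k)
    (pos_iff_ne_zero.2 fun h0 => h (by rw [upperPart, h0, mul_zero]))

/-- The tag `0` means cofinality above `𝔠`, which `Ω ^ (k + 1)` has; the tag `1` means that the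
upper part vanishes. Otherwise the upper part is a limit, so its cofinality is infinite and `1 + cof
= cof`: the tag is a regular initial ordinal, and `Ω ^ (k + 1)` times it has the same cofinality. -/
theorem cofTag_tagWitness (k : ℕ) (γ : Ordinal.{v}) :
    cofTag (Om ^ (k + 1) * tagWitness (coeffUp γ k)) = coeffUp γ k := by
  unfold tagWitness
  split_ifs with h0 h1
  · rw [h0, cofTag_eq_zero_iff, mul_one, cof_Om_pow]
    exact Order.lt_succ _
  · rw [mul_zero, cofTag_zero, h1]
  · have hne : upperPart γ k ≠ 0 := fun h => h1 (by rw [coeffUp_eq, h, cofTag_zero])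
    have hle : (upperPart γ k).cof ≤ 𝔠 := by
      by_contra hc
      exact h0 (cofTag_eq_zero_iff.2 (not_le.1 hc))
    have hlim := aleph0_le_cof_iff.2 (one_lt_cof_iff.2 (isSuccLimit_upperPart hne))
    have e : coeffUp γ k = (upperPart γ k).cof.ord := by
      rw [coeffUp_eq, cofTag, if_pos (cof_ord_lt_Om_iff.2 hle), one_add_of_omega0_le]
      rwa [← ord_aleph0, ord_le_ord]
    have e2 : (Om.{v} ^ (k + 1) * coeffUp γ k).cof = (upperPart γ k).cof := by
      rw [e, cof_mul (Om_pow_ne_zero _) (isSuccLimit_ord hlim).isSuccPrelimit, cof_ord_cof]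
    rw [cofTag, e2]; rfl

theorem gapEq_canonicalGap (k : ℕ) (γ : Ordinal.{v}) : GapEq k γ (canonicalGap k γ) := by
  constructor
  · rw [canonicalGap, mul_add_mod_self, mod_mod]
  · rw [coeffUp_eq (canonicalGap k γ), canonicalGap,
      upperPart_mul_add _ _ (mod_lt _ (Om_pow_ne_zero _)), cofTag_tagWitness]

/-- The collapse of `S` in which every gap is replaced by the canonical one. -/
noncomputable def collapse (k : ℕ) (S : Set Ordinal.{v}) (x : Ordinal.{v}) : Ordinal.{v} :=
  sInf {β | ∀ y ∈ S, (h : y < x) → collapse k S y < β} + canonicalGap k (gap S x)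
termination_by x

/-- The start of the interval which ends at `collapse k S x`. -/
noncomputable def collapseStart (k : ℕ) (S : Set Ordinal.{v}) (x : Ordinal.{v}) : Ordinal.{v} :=
  sInf {β | ∀ y ∈ S, y < x → collapse k S y < β}

variable {k : ℕ} {S : Set Ordinal.{v}}

theorem collapse_eq (x : Ordinal.{v}) :
    collapse k S x = collapseStart k S x + canonicalGap k (gap S x) := by
  rw [collapse]; rfl

theorem collapseStart_le_iff {x β : Ordinal.{v}} :
    collapseStart k S x ≤ β ↔ ∀ y ∈ S, y < x → collapse k S y < β := by
  have hne : {β | ∀ y ∈ S, y < x → collapse k S y < β}.Nonempty := by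
    refine ⟨sSup ((fun y => collapse k S y + 1) '' Iio x), fun y _ hy => ?_⟩
    exact lt_of_lt_of_le (lt_add_one _) (le_csSup bddAbove_of_small ⟨y, hy, rfl⟩)
  exact ⟨fun h y hy hyx => (csInf_mem hne y hy hyx).trans_le h, fun h => csInf_le' h⟩

theorem collapse_lt_collapse {x y : Ordinal.{v}} (hx : x ∈ S) (h : x < y) :
    collapse k S x < collapse k S y := by
  rw [collapse_eq y]
  exact (collapseStart_le_iff.1 le_rfl x hx h).trans_le (le_add_right le_rfl)

theorem collapse_lt_iff {x y : Ordinal.{v}} (hx : x ∈ S) (hy : y ∈ S) :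
    collapse k S x < collapse k S y ↔ x < y := by
  refine ⟨fun h => ?_, collapse_lt_collapse hx⟩
  by_contra hc
  rcases (not_lt.1 hc).eq_or_lt with rfl | h'
  · exact h.false
  · exact h.not_gt (collapse_lt_collapse hy h')

/-- The collapse preserves the order on `S`, so its images below that of `x` are the images of the
points below `x`. -/
theorem gapStart_collapse {x : Ordinal.{v}} (hx : x ∈ S) :
    gapStart (collapse k S '' S) (collapse k S x) = collapseStart k S x := by
  refine eq_of_forall_ge_iff fun β => ?_
  rw [gapStart_le_iff, collapseStart_le_iff, forall_mem_image]
  refine forall₂_congr fun y hy => ?_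
  rw [collapse_lt_iff hy hx]

theorem gap_collapse {x : Ordinal.{v}} (hx : x ∈ S) :
    gap (collapse k S '' S) (collapse k S x) = canonicalGap k (gap S x) := by
  rw [gap, gapStart_collapse hx, collapse_eq x, Ordinal.add_sub_cancel]

theorem partialIso_collapse (k : ℕ) (hS : #S ≤ 𝔠) :
    PartialIso k ((fun x => (x, collapse k S x)) '' S) where
  small := mk_image_le.trans hS
  lt_iff := by
    rintro _ ⟨x, hx, rfl⟩ _ ⟨y, hy, rfl⟩
    exact (collapse_lt_iff hx hy).symm
  gapEq := by
    rintro _ ⟨x, hx, rfl⟩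
    simp only [image_image, image_id']
    rw [gap_collapse hx]
    exact gapEq_canonicalGap _ _

/-- By induction. There are at most `𝔠` earlier values, and `Ω ^ (k + 2)` has cofinality `𝔠⁺`, so
their supremum stays below it; adding one more canonical gap does no harm, since `Ω ^ (k + 2)` is
closed under addition. -/
theorem collapse_lt (hS : #S ≤ 𝔠) (x : Ordinal.{v}) : collapse k S x < Om ^ (k + 2) := by
  induction x using WellFoundedLT.induction with
  | ind x ih =>
    rw [collapse_eq]
    refine isPrincipal_Om_pow _ ?_ (canonicalGap_lt _ _)
    have hb : BddAbove ((· + 1) '' (collapse k S '' {y ∈ S | y < x})) := by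
      refine ⟨Om ^ (k + 2), ?_⟩
      rintro _ ⟨_, ⟨y, hy, rfl⟩, rfl⟩
      exact Order.add_one_le_iff.2 (ih y hy.2)
    refine lt_of_le_of_lt (b := sSup ((· + 1) '' (collapse k S '' {y ∈ S | y < x}))) ?_ ?_
    · refine collapseStart_le_iff.2 fun y hy hyx => ?_
      exact lt_of_lt_of_le (lt_add_one _) (le_csSup hb ⟨_, ⟨y, ⟨hy, hyx⟩, rfl⟩, rfl⟩)
    · apply sSup_add_one_lt_of_lt_cof
      · rw [← lift_cof, cof_Om_pow]
        refine lt_of_le_of_lt (b := 𝔠) ?_ ?_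
        · exact mk_image_le.trans ((mk_le_mk_of_subset (sep_subset _ _)).trans hS)
        · rw [← lift_continuum.{v + 1, v}, Cardinal.lift_lt]
          exact Order.lt_succ _
      · rintro _ ⟨y, hy, rfl⟩
        exact ih y hy.2

/-! ### Extending partial isomorphisms into equivalent gaps -/

theorem gapStart_insert_of_le {x γ : Ordinal.{v}} (h : x ≤ γ) :
    gapStart (insert γ S) x = gapStart S x :=
  gapStart_congr fun β => by simp [h.not_gt]

theorem mk_insert_le_continuum {α : Type*} {s : Set α} (hs : #s ≤ 𝔠) (a : α) :
    #(insert a s : Set α) ≤ 𝔠 :=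
  mk_insert_le.trans (add_le_of_le aleph0_le_continuum hs
    (one_le_aleph0.trans aleph0_le_continuum))

theorem extendable_refl (k : ℕ) (γ : Ordinal.{v}) : Extendable k γ γ := by
  intro T hT hTγ
  refine ⟨(fun x => (x, x)) '' insert γ T, ⟨?_, ?_, ?_⟩, ⟨γ, by simp⟩, ?_, ?_⟩
  · exact mk_image_le.trans (mk_insert_le_continuum hT _)
  · rintro _ ⟨x, -, rfl⟩ _ ⟨y, -, rfl⟩; rfl
  · rintro _ ⟨x, -, rfl⟩
    simp only [image_image]
    exact GapEq.refl _ _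
  · simp [image_image]
  · rintro _ ⟨x, hx, rfl⟩
    rcases hx with rfl | hx
    exacts [le_rfl, (hTγ x hx).le]

theorem gapEq_mul {w w' : Ordinal.{v}}
    (h : cofTag (Om ^ (k + 2) * w) = cofTag (Om ^ (k + 2) * w')) :
    GapEq k (Om ^ (k + 2) * w) (Om ^ (k + 2) * w') := by
  constructor
  · rw [mul_mod_Om, mul_mod_Om]
  · rw [coeffUp_eq, coeffUp_eq, upperPart_mul, upperPart_mul, h]

/-- The set `T` is collapsed into `Ω ^ (k + 2)`, which fits below the nonzero multiple `Ω ^ (k + 2)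
* w'`. On both sides a final segment remains above the chosen points, because the cofinalities
exceed `𝔠`. -/
theorem extendable_mul_of_cof {w w' : Ordinal.{v}} (h : cofTag (Om ^ (k + 2) * w) = 0)
    (h' : cofTag (Om ^ (k + 2) * w') = 0) :
    Extendable k (Om ^ (k + 2) * w) (Om ^ (k + 2) * w') := by
  intro T hT hTγ
  set γ := Om ^ (k + 2) * w
  set γ' := Om ^ (k + 2) * w'
  have hw' : w' ≠ 0 := by
    rintro rfl
    simp [γ', cofTag_zero] at h'
  have hc : ∀ x, collapse k T x < γ' := fun x =>
    (collapse_lt hT x).trans_le (le_mul_left _ (pos_iff_ne_zero.2 hw'))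
  have e1 : Prod.fst '' insert (γ, γ') ((fun x => (x, collapse k T x)) '' T) = insert γ T := by
    simp [image_insert_eq, image_image]
  have e2 : Prod.snd '' insert (γ, γ') ((fun x => (x, collapse k T x)) '' T) =
      insert γ' (collapse k T '' T) := by
    simp [image_insert_eq, image_image]
  refine ⟨insert (γ, γ') ((fun x => (x, collapse k T x)) '' T), ⟨?_, ?_, ?_⟩,
    mem_insert _ _, ?_, ?_⟩
  · exact mk_insert_le_continuum (mk_image_le.trans hT) _
  · rintro _ (rfl | ⟨x, hx, rfl⟩) _ (rfl | ⟨y, hy, rfl⟩)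
    · simp
    · exact iff_of_false (hTγ y hy).not_gt (hc y).not_gt
    · exact iff_of_true (hTγ x hx) (hc x)
    · exact (collapse_lt_iff hx hy).symm
  · rw [e1, e2]
    rintro _ (rfl | ⟨x, hx, rfl⟩)
    · have hc1 : 𝔠 < γ.cof := cofTag_eq_zero_iff.1 h
      have hc2 : 𝔠 < γ'.cof := cofTag_eq_zero_iff.1 h'
      -- The two top gaps are nonempty final segments, hence again multiples of `Ω ^ (k + 2)` with
      -- the tag `0`; they agree at level `k`.
      obtain ⟨z, -, hz, hz'⟩ := exists_mul_eq_sub (gapStart_lt (mk_insert_le_continuum hT γ) hc1)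
      obtain ⟨z', -, hw, hw'⟩ := exists_mul_eq_sub
        (gapStart_lt (mk_insert_le_continuum (mk_image_le.trans hT) γ') hc2)
      simp only [gap]
      rw [hz, hw]
      exact gapEq_mul (by rw [hz', hw']; exact h.trans h'.symm)
    · simp only [gap]
      rw [gapStart_insert_of_le (hTγ x hx).le, gapStart_insert_of_le (hc x).le]
      have := (partialIso_collapse k hT).gapEq _ ⟨x, hx, rfl⟩
      simpa [image_image, gap] using this
  · rw [e1]; exact subset_insert _ _
  · rintro _ (rfl | ⟨x, hx, rfl⟩)
    exacts [le_rfl, (hTγ x hx).le]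


theorem gap_eq_zero {S : Set Ordinal.{v}} {a : Ordinal.{v}} (h : ∀ β < a, ∃ c ∈ S, β ≤ c ∧ c < a) :
    gap S a = 0 := by
  have : gapStart S a = a := by
    refine le_antisymm (gapStart_le _ _) (le_of_forall_lt fun β hβ => ?_)
    obtain ⟨c, hc, hβc, hca⟩ := h β hβ
    exact hβc.trans_lt (lt_gapStart hc hca)
  rw [gap, this, Ordinal.sub_self]

/-- Apart from the cases of cofinality above `𝔠` and of zero, both multipliers are limits of the
same cofinality, which is at most `𝔠`. Cofinal sequences of equal length then cut both sides into
gaps of cofinality above `𝔠`, and `extendable_mul_of_cof` applies to each of them. -/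
theorem extendable_mul {w w' : Ordinal.{v}}
    (h : cofTag (Om ^ (k + 2) * w) = cofTag (Om ^ (k + 2) * w')) :
    Extendable k (Om ^ (k + 2) * w) (Om ^ (k + 2) * w') := by
  by_cases h0 : cofTag (Om ^ (k + 2) * w) = 0
  · exact extendable_mul_of_cof h0 (h ▸ h0)
  by_cases h1 : cofTag (Om ^ (k + 2) * w) = 1
  · have e := cofTag_eq_one_iff.1 h1
    have e' := cofTag_eq_one_iff.1 (h.symm.trans h1)
    rw [e, e']
    exact extendable_refl _ _
  -- A successor multiplier gives cofinality `𝔠⁺`, hence the tag `0`, and the multiplier zero gives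
  -- the tag `1`. Only limits are left, and multiplication by a power of `Ω` on the left keeps their
  -- cofinality.
  have key : ∀ z, cofTag (Om.{v} ^ (k + 2) * z) = cofTag (Om ^ (k + 2) * w) →
      Order.IsSuccLimit z ∧ 1 + z.cof.ord = cofTag (Om ^ (k + 2) * w) ∧ z.cof ≤ 𝔠 := by
    intro z hz
    have hlim : Order.IsSuccLimit z := by
      rcases zero_or_succ_or_isSuccLimit z with rfl | ⟨x, rfl⟩ | hl
      · simp [cofTag_zero] at hz
        exact absurd hz.symm h1
      · refine absurd (hz.symm.trans (cofTag_eq_zero_iff.2 ?_)) h0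
        rw [Order.succ_eq_add_one, cof_mul_succ_Om_pow]
        exact Order.lt_succ _
      · exact hl
    have e := cof_mul (Om_pow_ne_zero.{v} (k + 2)) hlim.isSuccPrelimit
    have hle : z.cof ≤ 𝔠 := by
      rw [← e]
      exact not_lt.1 fun hc => h0 (hz ▸ cofTag_eq_zero_iff.2 hc)
    refine ⟨hlim, ?_, hle⟩
    rw [← hz, cofTag, e, if_pos (cof_ord_lt_Om_iff.2 hle)]
  obtain ⟨hl, he, hc⟩ := key w rfl
  obtain ⟨hl', he', -⟩ := key w' h.symm
  have hcof : w'.cof.ord = w.cof.ord := by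
    have := he'.trans he.symm
    simpa using this
  obtain ⟨f, hf⟩ := exists_isFundamentalSeq (o := w) rfl
  obtain ⟨f', hf'⟩ := exists_isFundamentalSeq hcof
  set m := k + 2
  -- The `+ 1` makes every cutting point an ordinal of cofinality `𝔠⁺`, also at limit indices.
  let g : Iio w.cof.ord → Ordinal.{v} × Ordinal.{v} := fun i =>
    (Om ^ m * ((f i : Ordinal.{v}) + 1), Om ^ m * ((f' i : Ordinal.{v}) + 1))
  have mono : ∀ {z : Ordinal.{v}} {f : Iio w.cof.ord → Iio z}, StrictMono f → ∀ i j,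
      Om ^ m * ((f i : Ordinal.{v}) + 1) < Om ^ m * ((f j : Ordinal.{v}) + 1) ↔ i < j := by
    intro z f hf i j
    rw [mul_lt_mul_iff_right₀ (Om_pow_pos m), ← Order.succ_eq_add_one, ← Order.succ_eq_add_one,
        Order.succ_lt_succ_iff, Subtype.coe_lt_coe,
      hf.lt_iff_lt]
  have lttop : ∀ {z : Ordinal.{v}} (f : Iio w.cof.ord → Iio z), Order.IsSuccLimit z → ∀ i,
      Om ^ m * ((f i : Ordinal.{v}) + 1) < Om ^ m * z := by
    intro z f hz i
    rw [mul_lt_mul_iff_right₀ (Om_pow_pos m)]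
    exact hz.add_one_lt (f i).2
  have hsmall : #(insert (Om ^ m * w, Om ^ m * w') (range g) : Set _) ≤ 𝔠 := by
    refine mk_insert_le_continuum ?_ _
    have h1 : lift.{v + 1} #(range g) ≤ lift.{v + 1} #(Iio w.cof.ord) := mk_range_le_lift
    rw [Cardinal.lift_le] at h1
    refine h1.trans ?_
    rw [Cardinal.mk_Iio_ordinal, card_ord, ← lift_continuum.{v + 1, v}, Cardinal.lift_le]
    exact hc
  have gapw : ∀ {z : Ordinal.{v}} {f : Iio w.cof.ord → Iio z}, IsFundamentalSeq f →
      Order.IsSuccLimit z → ∀ {S : Set Ordinal.{v}},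
      (∀ i, Om ^ m * ((f i : Ordinal.{v}) + 1) ∈ S) → gap S (Om ^ m * z) = 0 := by
    intro z f hf hz S hS
    refine gap_eq_zero fun β hβ => ?_
    obtain ⟨_, ⟨i, rfl⟩, hi⟩ := hf.isCofinal_range ⟨_, (lt_mul_iff_div_lt (Om_pow_ne_zero m)).1 hβ⟩
    refine ⟨_, hS i, ?_, lttop f hz i⟩
    refine ((lt_mul_iff_div_lt (Om_pow_ne_zero m)).2 ?_).le
    exact lt_of_le_of_lt hi (lt_add_one _)
  have gapi : ∀ {S : Set Ordinal.{v}}, #S ≤ 𝔠 → ∀ x, ∃ y, gap S (Om ^ m * (x + 1)) = Om ^ m * y ∧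
      cofTag (Om ^ m * y) = 0 := by
    intro S hS x
    have hx : 𝔠 < (Om ^ m * (x + 1)).cof := by
      rw [cof_mul_succ_Om_pow]; exact Order.lt_succ _
    obtain ⟨y, -, hy, hy'⟩ := exists_mul_eq_sub (gapStart_lt hS hx)
    exact ⟨y, hy, hy'.trans (cofTag_eq_zero_iff.2 hx)⟩
  intro T hT hTγ
  have hlt : ∀ p ∈ insert (Om ^ m * w, Om ^ m * w') (range g),
      ∀ q ∈ insert (Om ^ m * w, Om ^ m * w') (range g), p.1 < q.1 ↔ p.2 < q.2 := by
    rintro _ (rfl | ⟨i, rfl⟩) _ (rfl | ⟨j, rfl⟩)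
    · simp
    · exact iff_of_false (lttop f hl j).not_gt (lttop f' hl' j).not_gt
    · exact iff_of_true (lttop f hl i) (lttop f' hl' i)
    · exact (mono hf.strictMono i j).trans (mono hf'.strictMono i j).symm
  have hext : ∀ p ∈ insert (Om ^ m * w, Om ^ m * w') (range g), Extendable k
      (gap (Prod.fst '' insert (Om ^ m * w, Om ^ m * w') (range g)) p.1)
      (gap (Prod.snd '' insert (Om ^ m * w, Om ^ m * w') (range g)) p.2) := by
    rintro _ (rfl | ⟨i, rfl⟩)
    · dsimp only
      -- The cutting points are cofinal, so nothing remains between them and the top: both top gaps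
      -- are `0`.
      rw [gapw hf hl (S := Prod.fst '' _) fun i => ⟨g i, Or.inr ⟨i, rfl⟩, rfl⟩,
        gapw hf' hl' (S := Prod.snd '' _) fun i => ⟨g i, Or.inr ⟨i, rfl⟩, rfl⟩]
      exact extendable_refl _ _
    · obtain ⟨y, hy, hy0⟩ := gapi (mk_image_le.trans hsmall) (S := Prod.fst '' _) (f i)
      obtain ⟨y', hy', hy0'⟩ := gapi (mk_image_le.trans hsmall) (S := Prod.snd '' _) (f' i)
      dsimp only [g]
      rw [hy, hy']
      exact extendable_mul_of_cof hy0 hy0'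
  obtain ⟨P, hP₀, hP, hTP, hle⟩ := exists_extension hsmall hlt hext hT
    (fun x hx => ⟨(Om ^ m * w, Om ^ m * w'), mem_insert _ _, (hTγ x hx).le⟩)
  refine ⟨P, hP, hP₀ (mem_insert _ _), hTP, fun p hp => ?_⟩
  obtain ⟨q, hq, hpq⟩ := hle p hp
  refine hpq.trans ?_
  rcases hq with rfl | ⟨i, rfl⟩
  exacts [le_rfl, (lttop f hl i).le]

/-- Both gaps are split at their parts divisible by `Ω ^ (k + 2)`. These have equal tags, so
`extendable_mul` applies to them, and the tails `r` are the same ordinal. One level is lost because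
the residue modulo `Ω ^ (k + 2)` is used up. -/
theorem GapEq.extendable {γ γ' : Ordinal.{v}} (h : GapEq (k + 1) γ γ') : Extendable k γ γ' := by
  obtain ⟨h1, h2⟩ := h
  rw [coeffUp_eq, coeffUp_eq] at h2
  have hγ := upperPart_add_mod γ (k + 1)
  have hγ' := upperPart_add_mod γ' (k + 1)
  rw [← h1] at hγ'
  set u := upperPart γ (k + 1) with hu
  set u' := upperPart γ' (k + 1) with hu'
  have ext : Extendable k u u' := extendable_mul h2
  set r := γ % Om ^ (k + 1 + 1)
  rcases eq_or_ne r 0 with hr | hr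
  · rw [hr, add_zero] at hγ hγ'
    rwa [← hγ, ← hγ']
  have hltr : ∀ z : Ordinal.{v}, z < z + r := fun z => by
    conv_lhs => rw [← add_zero z]
    exact add_lt_add_right (pos_iff_ne_zero.2 hr) _
  have g1 : ∀ z : Ordinal.{v}, gap {z, z + r} z = z := fun z => by
    have : gapStart {z, z + r} z = 0 := by
      rw [← nonpos_iff_eq_zero, gapStart_le_iff]
      rintro c (rfl | rfl) hc
      · exact absurd hc (lt_irrefl _)
      · exact absurd hc (hltr z).not_gt
    rw [gap, this, Ordinal.sub_zero]
  -- The second gap begins just after the point `z`, so one element is removed from the front of the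
  -- tail `r`.
  have g2 : ∀ z : Ordinal.{v}, gap {z, z + r} (z + r) = r - 1 := fun z => by
    have : gapStart {z, z + r} (z + r) = z + 1 := by
      refine le_antisymm (gapStart_le_iff.2 ?_)
        (Order.add_one_le_iff.2 (lt_gapStart (by simp) (hltr z)))
      rintro c (rfl | rfl) hc
      · exact lt_add_one _
      · exact absurd hc (lt_irrefl _)
    rw [gap, this, Ordinal.add_sub_add_cancel]
  intro T hT hTγ
  rw [← hγ] at hTγ ⊢
  rw [← hγ']
  have e1 : Prod.fst '' ({(u, u'), (u + r, u' + r)} : Set (Ordinal.{v} × Ordinal.{v})) =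
      {u, u + r} := by simp [image_pair]
  have e2 : Prod.snd '' ({(u, u'), (u + r, u' + r)} : Set (Ordinal.{v} × Ordinal.{v})) =
      {u', u' + r} := by simp [image_pair]
  have hs : #({(u, u'), (u + r, u' + r)} : Set (Ordinal.{v} × Ordinal.{v})) ≤ 𝔠 := by
    exact (mk_le_aleph0_iff.2 (to_countable _)).trans aleph0_le_continuum
  have hlt : ∀ p ∈ ({(u, u'), (u + r, u' + r)} : Set (Ordinal.{v} × Ordinal.{v})),
      ∀ q ∈ ({(u, u'), (u + r, u' + r)} : Set (Ordinal.{v} × Ordinal.{v})), p.1 < q.1 ↔ p.2 <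
          q.2 := by
    rintro _ (rfl | rfl) _ (rfl | rfl)
    · simp
    · exact iff_of_true (hltr _) (hltr _)
    · exact iff_of_false (hltr _).not_gt (hltr _).not_gt
    · simp
  have hext : ∀ p ∈ ({(u, u'), (u + r, u' + r)} : Set (Ordinal.{v} × Ordinal.{v})), Extendable k
      (gap (Prod.fst '' ({(u, u'), (u + r, u' + r)} : Set (Ordinal.{v} × Ordinal.{v}))) p.1)
      (gap (Prod.snd '' ({(u, u'), (u + r, u' + r)} : Set (Ordinal.{v} × Ordinal.{v}))) p.2) := by
    rw [e1, e2]
    rintro _ (rfl | rfl)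
    · rw [g1, g1]; exact ext
    · rw [g2, g2]; exact extendable_refl _ _
  obtain ⟨P, hP₀, hP, hTP, hle⟩ := exists_extension hs hlt hext hT
    (fun x hx => ⟨(u + r, u' + r), mem_insert_of_mem _ rfl, (hTγ x hx).le⟩)
  refine ⟨P, hP, hP₀ (mem_insert_of_mem _ rfl), hTP, fun p hp => ?_⟩
  obtain ⟨q, rfl | rfl, hpq⟩ := hle p hp
  exacts [hpq.trans (hltr u).le, hpq]

/-- The forth property of partial isomorphisms. -/
theorem PartialIso.forth {P : Set (Ordinal.{v} × Ordinal.{v})} (h : PartialIso (k + 1) P)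
    {T : Set Ordinal.{v}} (hT : #T ≤ 𝔠) (hTP : ∀ x ∈ T, ∃ p ∈ P, x ≤ p.1) :
    ∃ P', P ⊆ P' ∧ PartialIso k P' ∧ T ⊆ Prod.fst '' P' ∧ ∀ p ∈ P', ∃ q ∈ P, p.1 ≤ q.1 :=
  exists_extension h.small h.lt_iff (fun p hp => (h.gapEq p hp).extendable) hT hTP

/-- The back property of partial isomorphisms. -/
theorem PartialIso.back {P : Set (Ordinal.{v} × Ordinal.{v})} (h : PartialIso (k + 1) P)
    {T : Set Ordinal.{v}} (hT : #T ≤ 𝔠) (hTP : ∀ x ∈ T, ∃ p ∈ P, x ≤ p.2) :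
    ∃ P', P ⊆ P' ∧ PartialIso k P' ∧ T ⊆ Prod.snd '' P' ∧ ∀ p ∈ P', ∃ q ∈ P, p.1 ≤ q.1 := by
  obtain ⟨Q, h1, h2, h3, h4⟩ := h.swap.forth hT (fun x hx => by
    obtain ⟨p, hp, hx⟩ := hTP x hx
    exact ⟨_, ⟨p, hp, rfl⟩, hx⟩)
  refine ⟨Prod.swap '' Q, ?_, h2.swap, ?_, ?_⟩
  · intro p hp
    exact ⟨p.swap, h1 ⟨p, hp, rfl⟩, Prod.swap_swap p⟩
  · simpa [image_image] using h3
  · rintro _ ⟨p, hp, rfl⟩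
    obtain ⟨_, ⟨q, hq, rfl⟩, hpq⟩ := h4 p hp
    exact ⟨q, hq, (le_iff_of_lt_iff h2.lt_iff hp (h1 ⟨q, hq, rfl⟩)).1 hpq⟩

/-! ## The number of isomorphism types -/

section
variable {lam mu : Cardinal.{u}} {n : ℕ}

/-- The action of the free group on the carrier. -/
def TransPair.act (P : TransPair lam mu n) : FreeGroup (Fin n) →* Equiv.Perm P.carrier :=
  FreeGroup.lift P.perm

theorem TransPair.exists_act (P : TransPair lam mu n) (x y : P.carrier) :
    ∃ w, P.act w x = y := by
  obtain ⟨⟨g, hg⟩, hgx⟩ := P.transitive.exists_smul_eq x y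
  rw [← FreeGroup.range_lift_eq_closure] at hg
  obtain ⟨w, rfl⟩ := hg
  exact ⟨w, hgx⟩

/-- By transitivity each carrier is a single orbit of the free group, hence the set of cosets of the
stabilizer of a point. Equal stabilizers make `P.act w x ↦ Q.act w y` a well-defined equivariant
bijection. -/
theorem TransPair.equiv_of_stabilizer (P Q : TransPair lam mu n) (x : P.carrier) (y : Q.carrier)
    (h : ∀ w, P.act w x = x ↔ Q.act w y = y) : P ≈ Q := by
  have key : ∀ v w, P.act v x = P.act w x ↔ Q.act v y = Q.act w y := by
    intro v w
    have := h (w⁻¹ * v)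
    rwa [map_mul, map_mul, map_inv, map_inv, Equiv.Perm.mul_apply, Equiv.Perm.mul_apply,
      Equiv.Perm.inv_eq_iff_eq, Equiv.Perm.inv_eq_iff_eq] at this
  choose p hp using P.exists_act x
  choose q hq using Q.exists_act y
  let e : P.carrier ≃ Q.carrier :=
    { toFun := fun z => Q.act (p z) y
      invFun := fun z => P.act (q z) x
      left_inv := fun z => by
        have := (key (q (Q.act (p z) y)) (p z)).2 (hq _)
        exact this.trans (hp z)
      right_inv := fun z => by
        have := (key (p (P.act (q z) x)) (q z)).1 (hp _)
        exact this.trans (hq z) }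
  refine ⟨e, fun i z => ?_⟩
  have h1 : P.perm i z = P.act (FreeGroup.of i * p z) x := by
    rw [map_mul, Equiv.Perm.mul_apply, hp]
    simp [TransPair.act]
  have h2 : Q.act (p (P.perm i z)) y = Q.act (FreeGroup.of i * p z) y :=
    (key _ _).1 ((hp _).trans h1)
  change Q.act (p (P.perm i z)) y = Q.perm i (Q.act (p z) y)
  rw [h2, map_mul, Equiv.Perm.mul_apply]
  simp [TransPair.act]

/-- A type is determined by the stabilizer of a point, which is a subset of a countable group. -/
theorem mk_IS_le (lam mu : Cardinal.{u}) (n : ℕ) : #(IS lam mu n) ≤ 𝔠 := by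
  let pt : ∀ t : IS lam mu n, t.out.carrier := fun t => t.out.nonempty.some
  let f : IS lam mu n → ULift.{u + 1} (Set (FreeGroup (Fin n))) :=
    fun t => ⟨{w | t.out.act w (pt t) = pt t}⟩
  have hf : Function.Injective f := by
    intro t t' h
    have h' : ∀ w, t.out.act w (pt t) = pt t ↔ t'.out.act w (pt t') = pt t' := fun w =>
      Set.ext_iff.1 (congrArg ULift.down h) w
    rw [← Quotient.out_eq t, ← Quotient.out_eq t']
    exact Quotient.sound (TransPair.equiv_of_stabilizer _ _ _ _ h')
  refine (mk_le_of_injective hf).trans ?_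
  rw [mk_uLift, mk_set, ← lift_continuum.{u + 1, 0}, Cardinal.lift_le, ← two_power_aleph0]
  exact power_le_power_left two_ne_zero (mk_le_aleph0_iff.2 inferInstance)

/-- The shift of `ℤ × Bool`. -/
def lineShift : Equiv.Perm (ULift.{u} (ℤ × Bool)) where
  toFun x := ⟨(x.down.1 + 1, x.down.2)⟩
  invFun x := ⟨(x.down.1 - 1, x.down.2)⟩
  left_inv x := by simp
  right_inv x := by simp

open scoped Classical in
/-- The permutation of `ℤ × Bool` which flips the second coordinate over the points of `T`. -/
noncomputable def lineFlip (T : Set ℤ) : Equiv.Perm (ULift.{u} (ℤ × Bool)) where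
  toFun x := ⟨(x.down.1, xor x.down.2 (decide (x.down.1 ∈ T)))⟩
  invFun x := ⟨(x.down.1, xor x.down.2 (decide (x.down.1 ∈ T)))⟩
  left_inv x := by simp
  right_inv x := by simp

theorem lineShift_mk (z : ℤ) (b : Bool) : lineShift.{u} ⟨(z, b)⟩ = ⟨(z + 1, b)⟩ := rfl

theorem lineFlip_eq_self_iff (T : Set ℤ) (x : ULift.{u} (ℤ × Bool)) :
    lineFlip T x = x ↔ x.down.1 ∉ T := by
  obtain ⟨⟨z, b⟩⟩ := x
  by_cases hz : z ∈ T <;> cases b <;> simp [lineFlip, hz]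

/-- The marked line: `ℤ × Bool` with the shift, and with a flip over the points of `T`. -/
noncomputable def markedLine (lam mu : Cardinal.{u}) (T : Set ℤ) (h0 : 0 ∈ T) : TransPair lam mu
    2 := by
  refine ⟨ULift (ℤ × Bool), ⟨⟨(0, true)⟩⟩, ![lineShift, lineFlip T], ⟨?_⟩, fun _ => ⟨0, ?_⟩⟩
  · set s := lineShift.{u} with hsdef
    set r := lineFlip.{u} T with hrdef
    have hs : s ∈ Subgroup.closure (Set.range ![s, r]) := Subgroup.subset_closure ⟨0, rfl⟩
    have hr : r ∈ Subgroup.closure (Set.range ![s, r]) := Subgroup.subset_closure ⟨1, rfl⟩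
    have hpow : ∀ (m : ℕ) z b, (s ^ m) ⟨(z, b)⟩ = ⟨(z + m, b)⟩ := by
      intro m
      induction m with
      | zero => intro z b; simp
      | succ m ih =>
        intro z b
        rw [pow_succ', Equiv.Perm.mul_apply, ih]
        rw [hsdef, lineShift_mk]; simp [add_assoc]
    have hz : ∀ (m : ℤ) z b, (s ^ m) ⟨(z, b)⟩ = ⟨(z + m, b)⟩ := by
      intro m z b
      obtain ⟨k, rfl | rfl⟩ := m.eq_nat_or_neg
      · rw [zpow_natCast, hpow]
      · rw [zpow_neg, zpow_natCast, Equiv.Perm.inv_eq_iff_eq, hpow]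
        simp
    have hmain : ∀ z b z' b', ∃ g ∈ Subgroup.closure (Set.range ![s, r]),
        g (⟨(z, b)⟩ : ULift (ℤ × Bool)) = ⟨(z', b')⟩ := by
      intro z b z' b'
      by_cases hb : b = b'
      · refine ⟨s ^ (z' - z), zpow_mem hs _, ?_⟩
        rw [hz, hb]; simp
      -- Move to the place `0`, which is marked, change the sheet there, and move on to `z'`; the
      -- rightmost factor acts first.
      · refine ⟨s ^ z' * r * s ^ (-z), mul_mem (mul_mem (zpow_mem hs _) hr) (zpow_mem hs _), ?_⟩
        rw [Equiv.Perm.mul_apply, Equiv.Perm.mul_apply, hz (-z)]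
        have : r ⟨(z + -z, b)⟩ = ⟨(0, b')⟩ := by
          cases b <;> cases b' <;> simp_all [lineFlip]
        rw [this, hz]
        simp
    rintro ⟨z, b⟩ ⟨z', b'⟩
    obtain ⟨g, hg, hgx⟩ := hmain z b z' b'
    exact ⟨⟨g, hg⟩, hgx⟩
  · intro h
    have := Equiv.ext_iff.1 h ⟨(0, true)⟩
    simp [lineShift] at this

/-- An isomorphism commutes with the shift, so on the sheet `true` it translates the first
coordinate by a constant `c`. The marks are the places whose points are moved by the second
permutation, hence they are translated by `c`. Both sets of marks have the least element `0`, so `c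
= 0`. -/
theorem markedLine_injective {T T' : Set ℤ} (h0 : 0 ∈ T) (h0' : 0 ∈ T') (hT : ∀ z ∈ T, 0 ≤ z)
    (hT' : ∀ z ∈ T', 0 ≤ z) (h : markedLine lam mu T h0 ≈ markedLine lam mu T' h0') : T = T' := by
  obtain ⟨e, he⟩ := h
  have hs : ∀ x : ULift (ℤ × Bool), e ⟨(x.down.1 + 1, x.down.2)⟩ =
      (⟨((e x).down.1 + 1, (e x).down.2)⟩ : ULift (ℤ × Bool)) := fun x => he 0 x
  have hr : ∀ x : ULift (ℤ × Bool), x.down.1 ∈ T ↔ (e x : ULift (ℤ × Bool)).down.1 ∈ T' := by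
    intro x
    have h1 := he 1 x
    have h2 : (markedLine lam mu T h0).perm 1 x = x ↔ x.down.1 ∉ T := lineFlip_eq_self_iff T x
    have h3 : (markedLine lam mu T' h0').perm 1 (e x) = e x ↔
      (e x : ULift (ℤ × Bool)).down.1 ∉ T' := lineFlip_eq_self_iff T' (e x)
    rw [← not_iff_not, ← h2, ← h3, ← h1]
    exact e.injective.eq_iff.symm
  obtain ⟨c, hc⟩ : ∃ c, c = (e (⟨(0, true)⟩ : ULift (ℤ × Bool)) : ULift (ℤ × Bool)).down.1 :=
    ⟨_, rfl⟩
  have key : ∀ z : ℤ, (e (⟨(z, true)⟩ : ULift (ℤ × Bool)) : ULift (ℤ × Bool)).down.1 = z + c := by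
    intro z
    induction z using Int.induction_on with
    | zero => rw [← hc, zero_add]
    | succ i ih =>
      have := hs ⟨(i, true)⟩
      dsimp only at this
      rw [this]
      dsimp only
      rw [ih]; ring
    | pred i ih =>
      have := congrArg (fun x : ULift (ℤ × Bool) => x.down.1) (hs ⟨(-i - 1, true)⟩)
      dsimp only at this
      rw [show (-(i : ℤ) - 1 + 1) = -i by ring, ih] at this
      linarith
  have hmem : ∀ z, z ∈ T ↔ z + c ∈ T' := fun z => by
    rw [← key z]; exact hr ⟨(z, true)⟩
  have h1 : 0 ≤ c := by
    have := hT' _ ((hmem 0).1 h0); simpa using this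
  have h2 : c ≤ 0 := by
    have : (-c) ∈ T := (hmem (-c)).2 (by simpa using h0')
    linarith [hT _ this]
  obtain rfl := le_antisymm h2 h1
  ext z
  simpa using hmem z

theorem continuum_le_mk_IS (lam mu : Cardinal.{u}) : 𝔠 ≤ #(IS lam mu 2) := by
  -- The subset is moved up by one to keep the place `0` for the mark that fixes the origin.
  let T : Set ℕ → Set ℤ := fun S => {z | z = 0 ∨ ∃ n ∈ S, z = n + 1}
  have hT0 : ∀ S, (0 : ℤ) ∈ T S := fun S => Or.inl rfl
  have hT : ∀ S, ∀ z ∈ T S, 0 ≤ z := by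
    rintro S z (rfl | ⟨n, -, rfl⟩) <;> omega
  have hTi : Function.Injective T := by
    intro S S' h
    ext n
    have := Set.ext_iff.1 h ((n : ℤ) + 1)
    have e : ∀ m : ℕ, (n : ℤ) + 1 = m + 1 ↔ n = m := fun m => by omega
    have e0 : ¬ ((n : ℤ) + 1 = 0) := by omega
    simpa [T, e, e0] using this
  let f : ULift.{u + 1} (Set ℕ) → IS lam mu 2 := fun S =>
    Quotient.mk _ (markedLine lam mu (T S.down) (hT0 _))
  have hf : Function.Injective f := by
    intro S S' h
    exact ULift.ext _ _ (hTi (markedLine_injective _ _ (hT _) (hT _) (Quotient.exact h)))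
  have := mk_le_of_injective hf
  rwa [mk_uLift, mk_set, mk_nat, two_power_aleph0, lift_continuum] at this

theorem mk_IS_two (lam mu : Cardinal.{u}) : #(IS lam mu 2) = 𝔠 :=
  (mk_IS_le _ _ _).antisymm (continuum_le_mk_IS _ _)

instance (lam mu : Cardinal.{u}) (n : ℕ) : Nonempty (IS lam mu (n + 1)) := by
  refine ⟨Quotient.mk _ ⟨ULift Bool, ⟨⟨true⟩⟩, fun _ => Equiv.ulift.symm.permCongr
    (Equiv.swap true false), ⟨?_⟩, fun _ => ⟨0, ?_⟩⟩⟩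
  · rintro ⟨b⟩ ⟨b'⟩
    by_cases hb : b = b'
    · exact ⟨1, by rw [hb, one_smul]⟩
    · refine ⟨⟨_, Subgroup.subset_closure ⟨0, rfl⟩⟩, ?_⟩
      change Equiv.ulift.symm.permCongr (Equiv.swap true false) (ULift.up b) = ULift.up b'
      cases b <;> cases b' <;> simp_all [Equiv.permCongr_apply]
  · intro h
    have := Equiv.ext_iff.1 h ⟨true⟩
    simp [Equiv.permCongr_apply] at this

/-- If `lam = mu⁺`, trivial actions are allowed, and an orbit of `g₁` is a projection of any pair.
If `lam ≤ mu`, the pair consisting of the identity and a transposition has no projection, since the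
restriction of its first permutation would be trivial. -/
theorem eq_succ_iff_forall_exists_proj1 (h : lam ≤ Order.succ mu) :
    lam = Order.succ mu ↔ ∀ t : IS lam mu 2, ∃ s : IS lam mu 1, Proj1 t s := by
  constructor
  · rintro rfl t
    induction t using Quotient.inductionOn with | _ P
    obtain ⟨x⟩ := P.nonempty
    let p := P.perm 0
    let C := {y // ∃ z : ℤ, (p ^ z) x = y}
    have hC : ∀ y, (∃ z : ℤ, (p ^ z) x = p y) ↔ ∃ z : ℤ, (p ^ z) x = y := by
      intro y
      constructor
      · rintro ⟨z, hz⟩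
        refine ⟨-1 + z, ?_⟩
        rw [zpow_add, Equiv.Perm.mul_apply, hz, zpow_neg_one, Equiv.Perm.inv_eq_iff_eq]
      · rintro ⟨z, rfl⟩
        exact ⟨1 + z, by rw [zpow_add, Equiv.Perm.mul_apply, zpow_one]⟩
    let q : Equiv.Perm C := p.subtypePerm hC
    let Q : TransPair (Order.succ mu) mu 1 := ⟨C, ⟨⟨x, 0, rfl⟩⟩, fun _ => q, ⟨?_⟩,
      fun h => absurd h (Order.lt_succ mu).not_ge⟩
    · refine ⟨Quotient.mk _ Q, P, Q, ⟨Subtype.val, Subtype.val_injective⟩, rfl, rfl, ?_⟩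
      intro i y
      obtain rfl : i = 0 := Subsingleton.elim _ _
      rfl
    · rintro ⟨_, z, rfl⟩ ⟨_, z', rfl⟩
      have hq : q ∈ Subgroup.closure (Set.range fun _ : Fin 1 => q) :=
        Subgroup.subset_closure ⟨0, rfl⟩
      refine ⟨⟨q ^ (z' - z), zpow_mem hq _⟩, Subtype.ext ?_⟩
      change ((q ^ (z' - z)) ⟨_, _⟩ : C).1 = _
      rw [Equiv.Perm.subtypePerm_zpow]
      change (p ^ (z' - z)) ((p ^ z) x) = (p ^ z') x
      rw [← Equiv.Perm.mul_apply, ← zpow_add, sub_add_cancel]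
  · intro H
    by_contra hne
    have hle : lam ≤ mu := Order.lt_succ_iff.1 (lt_of_le_of_ne h hne)
    let g : Equiv.Perm (ULift.{u} Bool) := Equiv.ulift.symm.permCongr (Equiv.swap true false)
    have hg : g ∈ Subgroup.closure (Set.range ![1, g]) := Subgroup.subset_closure ⟨1, rfl⟩
    let R : TransPair lam mu 2 := ⟨ULift Bool, ⟨⟨true⟩⟩, ![1, g], ⟨?_⟩, fun _ => ⟨1, ?_⟩⟩
    · obtain ⟨s, P, Q, e, hP, hQ, he⟩ := H (Quotient.mk _ R)
      obtain ⟨f, hf⟩ := Quotient.exact hP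
      obtain ⟨i, hi⟩ := Q.nontrivial hle
      refine hi (Equiv.ext fun y => e.injective ?_)
      rw [he]
      obtain rfl : i = 0 := Subsingleton.elim _ _
      apply f.injective
      have := hf 0 (e y)
      exact this
    · rintro ⟨b⟩ ⟨b'⟩
      by_cases hb : b = b'
      · exact ⟨1, by rw [hb, one_smul]⟩
      · refine ⟨⟨_, hg⟩, ?_⟩
        change g (ULift.up b) = ULift.up b'
        cases b <;> cases b' <;> simp_all [g, Equiv.permCongr_apply]
    · intro h
      have := Equiv.ext_iff.1 h ⟨true⟩
      simp [g, Equiv.permCongr_apply] at this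
end

/-! ## `Card⁻` as a set of ordinals -/

section
variable {κ lam mu : Cardinal.{u}}

/-- A sum of at most `𝔠` members of `Card⁻` bounded by `β` is at most `𝔠 * β = β`, because `β` is
zero or at least `κ > 𝔠`. So the sum, when it is below `lam`, belongs to `Card⁻` and is the least
bound. This turns membership in `F_n` into a property of the ordering alone. -/
theorem mem_FSet_iff (hκ : 𝔠 < κ) (hκlam : κ < lam) {n : ℕ} {h : IS lam mu n → cardMinus κ lam} :
    h ∈ FSet κ lam mu n ↔ (∃ β, ∀ t, h t ≤ β) ∧
      (lam = Order.succ mu → ∀ β, (∀ t, h t ≤ β) → ∀ β', ¬ β < β') := by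
  have hle : ∀ t, Cardinal.lift.{u + 1} (h t : Cardinal.{u}) ≤
      Cardinal.sum fun t => (h t : Cardinal.{u}) := fun t =>
    lift_le_sum (fun t => (h t : Cardinal.{u})) t
  have hsum : ∀ β : cardMinus κ lam, (∀ t, h t ≤ β) →
      (Cardinal.sum fun t => (h t : Cardinal.{u})) ≤ Cardinal.lift.{u + 1} (β : Cardinal.{u}) := by
    intro β hβ
    refine (sum_le_sum _ _ hβ).trans ?_
    rw [sum_const, Cardinal.lift_id'.{u, u + 1}]
    rcases β.2.2 with h0 | h0
    · simp [h0]
    · have h1 : 𝔠 ≤ Cardinal.lift.{u + 1} (β : Cardinal.{u}) := by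
        rw [← lift_continuum.{u + 1, u}, Cardinal.lift_le]
        exact hκ.le.trans h0
      exact mul_le_of_le (aleph0_le_continuum.trans h1) ((mk_IS_le _ _ _).trans h1) le_rfl
  have hbd : (Cardinal.sum fun t => (h t : Cardinal.{u})) < Cardinal.lift.{u + 1} lam →
      ∃ β : cardMinus κ lam, (∀ t, h t ≤ β) ∧
        (Cardinal.sum fun t => (h t : Cardinal.{u})) = Cardinal.lift.{u + 1} (β : Cardinal.{u})
            := by
    intro hlt
    obtain ⟨σ, hσ, hσ'⟩ := lt_lift_iff.1 hlt
    have hb : ∀ t, (h t : Cardinal.{u}) ≤ σ := fun t => by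
      rw [← Cardinal.lift_le.{u + 1}, hσ']; exact hle t
    -- The sum vanishes with all its terms, and otherwise it dominates a term which is at least `κ`.
    have hmem : σ ∈ cardMinus κ lam := by
      refine ⟨hσ, ?_⟩
      by_cases h0 : ∀ t, (h t : Cardinal.{u}) = 0
      · left
        have : Cardinal.lift.{u + 1} σ ≤ 0 := by
          rw [hσ']
          exact (hsum ⟨0, pos_of_gt hκlam, Or.inl rfl⟩ fun t => (h0 t).le).trans (by simp)
        simpa using this
      · push Not at h0
        obtain ⟨t, ht⟩ := h0
        exact Or.inr (((h t).2.2.resolve_left ht).trans (hb t))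
    exact ⟨⟨σ, hmem⟩, hb, hσ'.symm⟩
  constructor
  · rintro ⟨h1, h2⟩
    obtain ⟨β, hβ, -⟩ := hbd h1
    refine ⟨⟨β, hβ⟩, fun hmu β hβ β' hlt => ?_⟩
    have h3 := hsum β hβ
    rw [h2 hmu, Cardinal.lift_le] at h3
    have h4 : (β' : Cardinal.{u}) ≤ mu := Order.lt_succ_iff.1 (β'.2.1.trans_eq hmu)
    exact (h4.trans h3).not_gt hlt
  · rintro ⟨⟨β, hβ⟩, h2⟩
    have hlt : (Cardinal.sum fun t => (h t : Cardinal.{u})) < Cardinal.lift.{u + 1} lam :=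
      (hsum β hβ).trans_lt (Cardinal.lift_lt.2 β.2.1)
    refine ⟨hlt, fun hmu => ?_⟩
    obtain ⟨σ, hσ, hσ'⟩ := hbd hlt
    have h3 : (σ : Cardinal.{u}) ≤ mu := Order.lt_succ_iff.1 (σ.2.1.trans_eq hmu)
    have hm : mu ∈ cardMinus κ lam :=
      ⟨hmu ▸ Order.lt_succ mu, Or.inr (Order.lt_succ_iff.1 (hmu ▸ hκlam))⟩
    rw [hσ', Cardinal.lift_inj]
    exact h3.antisymm (not_lt.1 (h2 hmu σ hσ ⟨mu, hm⟩))

/-- The position of an element of `Card⁻ ∪ {lam}`. -/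
noncomputable def cardRank (κ lam : Cardinal.{u}) (y : ↥(insert lam (cardMinus κ lam))) :
    Ordinal.{u + 1} :=
  typein ((· < ·) : ↥(insert lam (cardMinus κ lam)) → _ → Prop) y

theorem cardRank_lt_cardRank {y z : ↥(insert lam (cardMinus κ lam))} :
    cardRank κ lam y < cardRank κ lam z ↔ y < z := typein_lt_typein _

theorem cardRank_le_cardRank {y z : ↥(insert lam (cardMinus κ lam))} :
    cardRank κ lam y ≤ cardRank κ lam z ↔ y ≤ z := by
  simp only [← not_lt, cardRank_lt_cardRank]

theorem exists_cardRank_eq {z : ↥(insert lam (cardMinus κ lam))} {η : Ordinal.{u + 1}}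
    (h : η ≤ cardRank κ lam z) : ∃ y, cardRank κ lam y = η :=
  typein_surj _ (h.trans_lt (typein_lt_type _ z))

/-- The set measured by `gamma` is the closed interval from the start of the gap to `a`, whence the
`+ 1`. Agreement of `S'` with `S` is demanded only below `a`, so that `S'` may also contain the
point `lam`. -/
theorem gamma_eq {S : Set Cardinal.{u}} {S' : Set ↥(insert lam (cardMinus κ lam))}
    (a : ↥(insert lam (cardMinus κ lam))) (hS : S ⊆ cardMinus κ lam)
    (h : ∀ y, y < a → (y ∈ S' ↔ (y : Cardinal.{u}) ∈ S)) :
    gamma κ lam a S = gap (cardRank κ lam '' S') (cardRank κ lam a) + 1 := by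
  set g₀ := gapStart (cardRank κ lam '' S') (cardRank κ lam a) with hg₀
  have hg : g₀ ≤ cardRank κ lam a := gapStart_le _ _
  have hmem : ∀ y : ↥(insert lam (cardMinus κ lam)), (y : Cardinal.{u}) ∈ gammaSet κ lam a S ↔
      g₀ ≤ cardRank κ lam y ∧ y ≤ a := by
    intro y
    rw [hg₀, gapStart_le_iff]
    constructor
    · rintro ⟨-, h2, h3⟩
      refine ⟨?_, h2⟩
      rintro _ ⟨c, hc, rfl⟩ hca
      rw [cardRank_lt_cardRank] at hca ⊢
      exact h3 c ((h c hca).1 hc) hca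
    · rintro ⟨h2, h3⟩
      refine ⟨y.2.symm, h3, fun c hc hca => ?_⟩
      have := h2 _ ⟨⟨c, Or.inr (hS hc)⟩, (h _ hca).2 hc, rfl⟩ (cardRank_lt_cardRank.2 hca)
      exact cardRank_lt_cardRank.1 this
  let Y : gammaSet κ lam a S → ↥(insert lam (cardMinus κ lam)) := fun β => ⟨β.1, β.2.1.symm⟩
  have hY : ∀ β, g₀ ≤ cardRank κ lam (Y β) ∧ Y β ≤ a := fun β => (hmem (Y β)).1 β.2
  have hsub : ∀ β, g₀ + (cardRank κ lam (Y β) - g₀) = cardRank κ lam (Y β) := fun β =>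
    Ordinal.add_sub_cancel_of_le (hY β).1
  let f : gammaSet κ lam a S → Iio (gap (cardRank κ lam '' S') (cardRank κ lam a) + 1) := fun β =>
    ⟨cardRank κ lam (Y β) - g₀, by
      rw [mem_Iio, Order.lt_add_one_iff, gap, ← hg₀, Ordinal.sub_le,
        Ordinal.add_sub_cancel_of_le hg, cardRank_le_cardRank]
      exact (hY β).2⟩
  have hf : StrictMono f := by
    intro β β' hlt
    change cardRank κ lam (Y β) - g₀ < cardRank κ lam (Y β') - g₀
    rw [lt_sub, hsub, cardRank_lt_cardRank]
    exact hlt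
  have hf' : Function.Surjective f := by
    rintro ⟨η, hη⟩
    have h1 : g₀ + η ≤ cardRank κ lam a := by
      rw [mem_Iio, Order.lt_add_one_iff, gap, ← hg₀] at hη
      rw [← Ordinal.add_sub_cancel_of_le hg]
      exact add_le_add_right hη _
    obtain ⟨y, hy⟩ := exists_cardRank_eq h1
    have hy' : (y : Cardinal.{u}) ∈ gammaSet κ lam a S := (hmem y).2
      ⟨hy ▸ le_add_right le_rfl, cardRank_le_cardRank.1 (hy ▸ h1)⟩
    refine ⟨⟨y, hy'⟩, Subtype.ext ?_⟩
    change cardRank κ lam y - g₀ = η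
    rw [hy, Ordinal.add_sub_cancel]
  let e := (hf.orderIsoOfSurjective f hf').trans (ToType.mk)
  rw [gamma, ← type_toType (gap (cardRank κ lam '' S') (cardRank κ lam a) + 1)]
  exact type_eq.2 ⟨e.toRelIsoLT⟩

end

/-! ## Digits in base `Ω` -/

theorem coeffLow_lt (ρ : Ordinal.{v}) (n : ℕ) : coeffLow ρ n < Om := mod_lt _ Om_ne_zero

theorem coeffLow_mul_add {N n : ℕ} (h : n < N) (q r : Ordinal.{v}) :
    coeffLow (Om ^ N * q + r) n = coeffLow r n := by
  obtain ⟨m, rfl⟩ := Nat.exists_eq_add_of_lt h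
  rw [coeffLow, coeffLow, show n + m + 1 = n + (m + 1) by ring, pow_add, mul_assoc,
    mul_add_div _ (Om_pow_ne_zero n), pow_succ', mul_assoc, mul_add_mod_self]

theorem coeffLow_mod {N n : ℕ} (h : n < N) (ρ : Ordinal.{v}) :
    coeffLow (ρ % Om ^ N) n = coeffLow ρ n := by
  conv_rhs => rw [← div_add_mod ρ (Om ^ N)]
  rw [coeffLow_mul_add h]

theorem coeffLow_mul_add_self {N : ℕ} {q r : Ordinal.{v}} (hq : q < Om) (hr : r < Om ^ N) :
    coeffLow (Om ^ N * q + r) N = q := by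
  rw [coeffLow, mul_add_div _ (Om_pow_ne_zero N), div_eq_zero_of_lt hr, add_zero, mod_eq_of_lt hq]

theorem coeffLow_eq_zero {N n : ℕ} (h : N ≤ n) {ρ : Ordinal.{v}} (hρ : ρ < Om ^ N) :
    coeffLow ρ n = 0 := by
  have : ρ < Om ^ n := hρ.trans_le (pow_le_pow_right₀ (Order.one_le_iff_pos.2 Om_pos) h)
  rw [coeffLow, div_eq_zero_of_lt this, zero_mod]

theorem mul_add_lt_mul_add_iff {N : ℕ} {q r q' r' : Ordinal.{v}} (hr : r < Om ^ N)
    (hr' : r' < Om ^ N) : Om ^ N * q + r < Om ^ N * q' + r' ↔ q < q' ∨ q = q' ∧ r < r' := by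
  have key : ∀ {q r q' r' : Ordinal.{v}}, r < Om ^ N → q < q' →
      Om ^ N * q + r < Om ^ N * q' + r' := fun {q r q' r'} hr h =>
    calc Om ^ N * q + r < Om ^ N * q + Om ^ N := add_lt_add_right hr _
      _ = Om ^ N * (q + 1) := (mul_add_one _ _).symm
      _ ≤ Om ^ N * q' := mul_le_mul_right (Order.add_one_le_iff.2 h) _
      _ ≤ Om ^ N * q' + r' := le_add_right le_rfl
  rcases lt_trichotomy q q' with h | rfl | h
  · exact iff_of_true (key hr h) (Or.inl h)
  · simp
  · refine iff_of_false (key hr' h).not_gt ?_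
    rintro (h' | ⟨rfl, -⟩)
    exacts [h.not_gt h', h.false]

/-- Induction on the number of digits, splitting off the leading one. This lexicographic form is
what a second-order formula can express. -/
theorem lt_iff_exists_coeffLow {N : ℕ} {ρ ρ' : Ordinal.{v}} (h : ρ < Om ^ N) (h' : ρ' < Om ^ N) :
    ρ < ρ' ↔ ∃ n < N, coeffLow ρ n < coeffLow ρ' n ∧
      ∀ m, n < m → m < N → coeffLow ρ m = coeffLow ρ' m := by
  induction N generalizing ρ ρ' with
  | zero =>
    rw [pow_zero, Order.lt_one_iff] at h h'
    simp [h, h']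
  | succ N ih =>
    have hN := Om_pow_ne_zero.{v} N
    have hr := mod_lt ρ hN
    have hr' := mod_lt ρ' hN
    have hc : ∀ {ρ : Ordinal.{v}}, ρ < Om ^ (N + 1) → coeffLow ρ N = ρ / Om ^ N := fun {ρ} h => by
      rw [coeffLow, mod_eq_of_lt]
      rwa [← lt_mul_iff_div_lt hN, ← pow_succ]
    conv_lhs => rw [← div_add_mod ρ (Om ^ N), ← div_add_mod ρ' (Om ^ N)]
    rw [mul_add_lt_mul_add_iff hr hr', ih hr hr', ← hc h, ← hc h']
    constructor
    · rintro (h1 | ⟨h1, n, hn, h2, h3⟩)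
      · exact ⟨N, Nat.lt_succ_self N, h1, fun m hm hm' => by omega⟩
      · rw [coeffLow_mod hn, coeffLow_mod hn] at h2
        refine ⟨n, by omega, h2, fun m hm hm' => ?_⟩
        rcases Nat.lt_succ_iff_lt_or_eq.1 hm' with hm' | rfl
        · have := h3 m hm hm'
          rwa [coeffLow_mod hm', coeffLow_mod hm'] at this
        · exact h1
    · rintro ⟨n, hn, h2, h3⟩
      rcases Nat.lt_succ_iff_lt_or_eq.1 hn with hn | rfl
      · refine Or.inr ⟨h3 N hn (Nat.lt_succ_self N), n, hn, ?_, fun m hm hm' => ?_⟩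
        · rwa [coeffLow_mod hn, coeffLow_mod hn]
        · rw [coeffLow_mod hm', coeffLow_mod hm']
          exact h3 m hm (by omega)
      · exact Or.inl h2

theorem exists_coeffLow_eq (c : ℕ → Ordinal.{v}) (hc : ∀ n, c n < Om) (N : ℕ) :
    ∃ ρ < Om ^ N, ∀ n < N, coeffLow ρ n = c n := by
  induction N with
  | zero => exact ⟨0, by simp, fun n hn => absurd hn (Nat.not_lt_zero n)⟩
  | succ N ih =>
    obtain ⟨ρ, hρ, h⟩ := ih
    refine ⟨Om ^ N * c N + ρ, mul_add_lt_Om_pow (hc N) hρ, fun n hn => ?_⟩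
    rcases Nat.lt_succ_iff_lt_or_eq.1 hn with hn | rfl
    · rw [coeffLow_mul_add hn, h n hn]
    · exact coeffLow_mul_add_self (hc n) hρ

/-- Adding `1` produces no carry, since `Ω ^ (k + 1)` is a limit. This bridges the difference
between a gap and the value of `gamma`, which is larger by one. -/
theorem Om_pow_add_one_mod (k : ℕ) (γ : Ordinal.{v}) :
    (γ + 1) % Om ^ (k + 1) = γ % Om ^ (k + 1) + 1 ∧ upperPart (γ + 1) k = upperPart γ k := by
  have h : γ % Om ^ (k + 1) + 1 < Om ^ (k + 1) :=
    (isSuccLimit_Om_pow k).add_one_lt (mod_lt _ (Om_pow_ne_zero _))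
  have e : γ + 1 = Om ^ (k + 1) * (γ / Om ^ (k + 1)) + (γ % Om ^ (k + 1) + 1) := by
    rw [← add_assoc, div_add_mod]
  constructor
  · conv_lhs => rw [e]
    rw [mul_add_mod_self, mod_eq_of_lt h]
  · conv_lhs => rw [e]
    rw [upperPart_mul_add _ _ h]; rfl

/-! ## Ordinals below `Ω` as reflexive well-orderings of subsets -/

section
variable {W : Type v}

/-- `R` is a reflexive well-ordering of the set of all `s` with `R s s`. -/
def IsWO (R : W → W → Prop) : Prop :=
  (∀ s t, R s t → R s s ∧ R t t) ∧
    ∀ S : W → Prop, (∃ s, S s ∧ R s s) →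
      ∃ m, (S m ∧ R m m) ∧ ∀ s, S s ∧ R s s → R m s ∧ (R s m → s = m)

/-- There is a strictly increasing relation from the field of `R` to that of `R'`. -/
def RLE (R R' : W → W → Prop) : Prop :=
  ∃ f : W → W → Prop, (∀ s, R s s → ∃ t, R' t t ∧ f s t) ∧
    ∀ s s' t t', (f s t ∧ f s' t') ∧ R s s' ∧ ¬ s = s' → R' t t' ∧ ¬ t = t'

/-- The strict ordering on the field of `R`. -/
def strictRel (R : W → W → Prop) (s t : {s // R s s}) : Prop := R s t ∧ s ≠ t

/-- Totality comes from the least elements of sets with at most two members, and well-foundedness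
from those of arbitrary sets. -/
theorem IsWO.isWellOrder {R : W → W → Prop} (h : IsWO R) : IsWellOrder _ (strictRel R) := by
  obtain ⟨h1, h2⟩ := h
  have anti : ∀ s t, R s t → R t s → s = t := by
    intro s t hst hts
    obtain ⟨m, ⟨hm, -⟩, h⟩ := h2 (fun x => x = s ∨ x = t) ⟨s, Or.inl rfl, (h1 _ _ hst).1⟩
    rcases hm with rfl | rfl
    · exact ((h t ⟨Or.inr rfl, (h1 _ _ hst).2⟩).2 hts).symm
    · exact (h s ⟨Or.inl rfl, (h1 _ _ hst).1⟩).2 hst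
  have tot : ∀ s t, R s s → R t t → R s t ∨ R t s := by
    intro s t hs ht
    obtain ⟨m, ⟨hm, -⟩, h⟩ := h2 (fun x => x = s ∨ x = t) ⟨s, Or.inl rfl, hs⟩
    rcases hm with rfl | rfl
    · exact Or.inl (h t ⟨Or.inr rfl, ht⟩).1
    · exact Or.inr (h s ⟨Or.inl rfl, hs⟩).1
  have tri : ∀ a b, ¬ strictRel R a b → ¬ strictRel R b a → a = b := by
    rintro ⟨s, hs⟩ ⟨t, ht⟩ hst hts
    by_contra hne
    rcases tot s t hs ht with h | h
    · exact hst ⟨h, hne⟩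
    · exact hts ⟨h, Ne.symm hne⟩
  have wf : WellFounded (strictRel R) := by
    refine WellFounded.wellFounded_iff_has_min.2 fun S hS => ?_
    obtain ⟨⟨s, hs⟩, hsS⟩ := hS
    obtain ⟨m, ⟨⟨hm, hmS⟩, -⟩, h⟩ := h2 (fun x => ∃ hx : R x x, (⟨x, hx⟩ : {s // R s s}) ∈ S)
      ⟨s, ⟨hs, hsS⟩, hs⟩
    refine ⟨⟨m, hm⟩, hmS, ?_⟩
    rintro ⟨x, hx⟩ hxS ⟨hxm, hne⟩
    exact hne (Subtype.ext ((h x ⟨⟨hx, hxS⟩, hx⟩).2 hxm))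
  exact { wf := wf, trichotomous := tri }

open scoped Classical in
/-- The order type of `R`. -/
noncomputable def otp (R : W → W → Prop) : Ordinal.{v} :=
  if h : IsWO R then @type _ (strictRel R) h.isWellOrder else 0

/-- Well-orderings are compared by strictly increasing maps, whose range need not be an initial
segment. A strictly increasing relation does as well: choosing values from it gives such a map. -/
theorem otp_le_iff {R R' : W → W → Prop} (h : IsWO R) (h' : IsWO R') :
    otp R ≤ otp R' ↔ RLE R R' := by
  have := h.isWellOrder
  have := h'.isWellOrder
  rw [otp, otp, dif_pos h, dif_pos h', type_le_iff']
  constructor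
  · rintro ⟨e⟩
    refine ⟨fun s t => ∃ hs ht, e ⟨s, hs⟩ = ⟨t, ht⟩, fun s hs => ⟨_, (e ⟨s, hs⟩).2, hs, _, rfl⟩, ?_⟩
    rintro s s' t t' ⟨⟨⟨hs, ht, e1⟩, hs', ht', e2⟩, hR, hne⟩
    have : strictRel R' (e ⟨s, hs⟩) (e ⟨s', hs'⟩) :=
      e.map_rel_iff.2 ⟨hR, fun h => hne (congrArg Subtype.val h)⟩
    rw [e1, e2] at this
    exact ⟨this.1, fun h => this.2 (Subtype.ext h)⟩
  · rintro ⟨f, h1, h2⟩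
    choose g hg hfg using h1
    refine ⟨RelEmbedding.ofMonotone (fun s => ⟨g s.1 s.2, hg s.1 s.2⟩) ?_⟩
    rintro ⟨s, hs⟩ ⟨t, ht⟩ ⟨hst, hne⟩
    have := h2 s t _ _ ⟨⟨hfg s hs, hfg t ht⟩, hst, fun h => hne (Subtype.ext h)⟩
    exact ⟨this.1, fun h => this.2 (congrArg Subtype.val h)⟩

theorem otp_eq_iff {R R' : W → W → Prop} (h : IsWO R) (h' : IsWO R') :
    otp R = otp R' ↔ RLE R R' ∧ RLE R' R := by
  rw [le_antisymm_iff, otp_le_iff h h', otp_le_iff h' h]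

theorem otp_lt_Om (hW : #W ≤ 𝔠) (R : W → W → Prop) : otp R < Om := by
  unfold otp
  split_ifs with h
  · refine lt_Om_of_card_le ?_
    have := h.isWellOrder
    rw [card_type]
    exact (mk_subtype_le _).trans hW
  · exact Om_pos

/-- Any well-ordering is copied along an injection into `W`, with the range as the field. The form
`¬ r b a` makes the copy reflexive, so the field can be recovered from the relation. -/
theorem isWO_of_embedding {α : Type v} (r : α → α → Prop) [IsWellOrder α r] (f : α → W)
    (hf : Function.Injective f) :
    IsWO (fun s t => ∃ a b, f a = s ∧ f b = t ∧ ¬ r b a) ∧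
      otp (fun s t => ∃ a b, f a = s ∧ f b = t ∧ ¬ r b a) = type r := by
  set R : W → W → Prop := fun s t => ∃ a b, f a = s ∧ f b = t ∧ ¬ r b a with hR
  have hRf : ∀ a b, R (f a) (f b) ↔ ¬ r b a := by
    intro a b
    constructor
    · rintro ⟨a', b', ha, hb, h⟩
      rwa [← hf ha, ← hf hb]
    · exact fun h => ⟨a, b, rfl, rfl, h⟩
  have hwo : IsWO R := by
    constructor
    · rintro _ _ ⟨a, b, rfl, rfl, h⟩
      rw [hRf, hRf]
      exact ⟨irrefl a, irrefl b⟩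
    · rintro S ⟨_, hs, a, -, rfl, -⟩
      obtain ⟨m, hm, hmin⟩ := (IsWellFounded.wf (r := r)).has_min {x | S (f x)} ⟨a, hs⟩
      refine ⟨f m, ⟨hm, (hRf _ _).2 (irrefl m)⟩, ?_⟩
      rintro _ ⟨hs', b, -, rfl, -⟩
      refine ⟨(hRf _ _).2 (hmin b hs'), fun h => ?_⟩
      rw [hRf] at h
      rcases trichotomous_of r b m with h' | rfl | h'
      · exact absurd h' (hmin b hs')
      · rfl
      · exact absurd h' h
  refine ⟨hwo, ?_⟩
  rw [otp, dif_pos hwo]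
  have := hwo.isWellOrder
  refine (type_eq.2 ⟨RelIso.mk (Equiv.ofBijective
    (fun a => (⟨f a, (hRf _ _).2 (irrefl a)⟩ : {s // R s s})) ⟨?_, ?_⟩) ?_⟩).symm
  · intro a b h
    exact hf (congrArg Subtype.val h)
  · rintro ⟨_, a, -, rfl, -⟩
    exact ⟨a, rfl⟩
  · intro a b
    change R (f a) (f b) ∧ _ ↔ r a b
    rw [hRf]
    constructor
    · rintro ⟨h1, h2⟩
      rcases trichotomous_of r a b with h' | rfl | h'
      · exact h'
      · exact absurd rfl h2
      · exact absurd h' h1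
    · intro h
      refine ⟨asymm h, fun he => ?_⟩
      obtain rfl : a = b := hf (congrArg Subtype.val he)
      exact irrefl a h

/-- An ordinal below `Ω` has at most `𝔠` elements, so it injects into `W`. -/
theorem exists_otp_eq (hW : 𝔠 ≤ #W) {o : Ordinal.{v}} (ho : o < Om) :
    ∃ R : W → W → Prop, IsWO R ∧ otp R = o := by
  have : #o.ToType ≤ #W := by
    rw [mk_toType]; exact (card_lt_of_lt_Om ho).trans hW
  obtain ⟨f⟩ := this
  obtain ⟨h1, h2⟩ := isWO_of_embedding ((· < ·) : o.ToType → o.ToType → Prop) f f.injective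
  exact ⟨_, h1, h2.trans (type_toType o)⟩

variable (lt : W → W → Prop)

/-- The reflexive form of `lt` below the label `(x, x')`, which stands for `x` if `x = x'`, and
for an additional greatest point otherwise. -/
def segRel (x x' : W) (s t : W) : Prop := ¬ lt t s ∧ (x = x' → lt t x)

variable [IsWellOrder W lt]

theorem isWO_segRel_self (x : W) : IsWO (segRel lt x x) ∧ otp (segRel lt x x) = typein lt x := by
  have := isWO_of_embedding (Subrel lt (· ∈ {y | lt y x})) Subtype.val Subtype.val_injective
  have e : segRel lt x x = fun s t => ∃ a b : {y | lt y x}, a.1 = s ∧ b.1 = t ∧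
      ¬ Subrel lt (· ∈ {y | lt y x}) b a := by
    ext s t
    constructor
    · rintro ⟨h1, h2⟩
      refine ⟨⟨s, ?_⟩, ⟨t, h2 rfl⟩, rfl, rfl, h1⟩
      rcases trichotomous_of lt s t with h | rfl | h
      · exact _root_.trans h (h2 rfl)
      · exact h2 rfl
      · exact absurd h h1
    · rintro ⟨⟨a, ha⟩, ⟨b, hb⟩, rfl, rfl, h⟩
      exact ⟨h, fun _ => hb⟩
  rw [e]
  exact this

theorem isWO_segRel_of_ne {x x' : W} (h : x ≠ x') :
    IsWO (segRel lt x x') ∧ otp (segRel lt x x') = type lt := by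
  have := isWO_of_embedding lt id Function.injective_id
  have e : segRel lt x x' = fun s t => ∃ a b : W, id a = s ∧ id b = t ∧ ¬ lt b a := by
    ext s t
    simp [segRel, h]
  rw [e]
  exact this

end

/-! ## Ordinals as sequences of digits -/

section
variable {W : Type v} (lt : W → W → Prop) [IsWellOrder W lt]

/-- `X i` has the order type given by the digit of `ρ` at the place `i`. -/
def Codes (X : W → W → W → Prop) (ρ : Ordinal.{v}) : Prop :=
  ∀ i, IsWO (X i) ∧ (∀ n : ℕ, typein lt i = n → otp (X i) = coeffLow ρ n) ∧
    (ω ≤ typein lt i → otp (X i) = 0)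

/-- The lexicographic comparison, from the greatest place. -/
def SLess (X Y : W → W → W → Prop) : Prop :=
  ∃ i, ¬ RLE (Y i) (X i) ∧ ∀ i', lt i i' → RLE (X i') (Y i') ∧ RLE (Y i') (X i')

variable {lt}

theorem nat_lt_type (hW : 𝔠 ≤ #W) (n : ℕ) : ∃ i, typein lt i = n := by
  refine typein_surj lt ((natCast_lt_omega0 n).trans_le ?_)
  rw [← ord_aleph0, ord_le, card_type]
  exact aleph0_le_continuum.trans hW

/-- The digits at infinite places and at places from `N` on vanish for both ordinals, so the
comparison over all places of `W` reduces to the finitely many in `lt_iff_exists_coeffLow`. -/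
theorem Codes.sLess_iff (hW : 𝔠 ≤ #W) {X Y : W → W → W → Prop} {ρ ρ' : Ordinal.{v}} {N : ℕ}
    (hX : Codes lt X ρ) (hY : Codes lt Y ρ') (h : ρ < Om ^ N) (h' : ρ' < Om ^ N) :
    SLess lt X Y ↔ ρ < ρ' := by
  rw [lt_iff_exists_coeffLow h h']
  have hlt : ∀ i, ¬ RLE (Y i) (X i) ↔ otp (X i) < otp (Y i) := fun i => by
    rw [← otp_le_iff (hY i).1 (hX i).1, not_le]
  have heq : ∀ i, RLE (X i) (Y i) ∧ RLE (Y i) (X i) ↔ otp (X i) = otp (Y i) := fun i => by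
    rw [otp_eq_iff (hX i).1 (hY i).1]
  simp only [SLess, hlt, heq]
  have hcase : ∀ i, (∃ n : ℕ, typein lt i = n) ∨ ω ≤ typein lt i := fun i => by
    rcases lt_or_ge (typein lt i) ω with hi | hi
    · exact Or.inl (lt_omega0.1 hi)
    · exact Or.inr hi
  constructor
  · rintro ⟨i, hi, hi'⟩
    rcases hcase i with ⟨n, hn⟩ | hn
    · rw [(hX i).2.1 n hn, (hY i).2.1 n hn] at hi
      have hnN : n < N := by
        by_contra hc
        rw [coeffLow_eq_zero (not_lt.1 hc) h, coeffLow_eq_zero (not_lt.1 hc) h'] at hi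
        exact hi.false
      refine ⟨n, hnN, hi, fun m hm hmN => ?_⟩
      obtain ⟨j, hj⟩ := nat_lt_type (lt := lt) hW m
      have := hi' j (by rw [← typein_lt_typein lt, hn, hj]; exact_mod_cast hm)
      rwa [(hX j).2.1 m hj, (hY j).2.1 m hj] at this
    · rw [(hX i).2.2 hn, (hY i).2.2 hn] at hi
      exact absurd hi (lt_irrefl _)
  · rintro ⟨n, hn, h1, h2⟩
    obtain ⟨i, hi⟩ := nat_lt_type (lt := lt) hW n
    refine ⟨i, by rwa [(hX i).2.1 n hi, (hY i).2.1 n hi], fun j hj => ?_⟩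
    rcases hcase j with ⟨m, hm⟩ | hm
    · rw [(hX j).2.1 m hm, (hY j).2.1 m hm]
      rcases lt_or_ge m N with hmN | hmN
      · refine h2 m ?_ hmN
        rw [← typein_lt_typein lt, hi, hm] at hj
        exact_mod_cast hj
      · rw [coeffLow_eq_zero hmN h, coeffLow_eq_zero hmN h']
    · rw [(hX j).2.2 hm, (hY j).2.2 hm]

theorem exists_codes (hW : 𝔠 ≤ #W) (ρ : Ordinal.{v}) : ∃ X, Codes lt X ρ := by
  have : ∀ i, ∃ R : W → W → Prop, IsWO R ∧ (∀ n : ℕ, typein lt i = n → otp R = coeffLow ρ n) ∧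
      (ω ≤ typein lt i → otp R = 0) := by
    intro i
    rcases lt_or_ge (typein lt i) ω with hi | hi
    · obtain ⟨n, hn⟩ := lt_omega0.1 hi
      obtain ⟨R, h1, h2⟩ := exists_otp_eq hW (coeffLow_lt ρ n)
      refine ⟨R, h1, fun m hm => ?_, fun h => absurd hi h.not_gt⟩
      rw [hn] at hm
      rw [h2, Nat.cast_injective hm]
    · obtain ⟨R, h1, h2⟩ := exists_otp_eq hW Om_pos
      refine ⟨R, h1, fun m hm => ?_, fun _ => h2⟩
      rw [hm] at hi
      exact absurd (natCast_lt_omega0 m) hi.not_gt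
  choose X hX using this
  exact ⟨X, hX⟩

theorem otp_eq_zero_iff {R : W → W → Prop} (h : IsWO R) : otp R = 0 ↔ ∀ s, ¬ R s s := by
  have := h.isWellOrder
  rw [otp, dif_pos h, type_eq_zero_iff_isEmpty, isEmpty_subtype]

variable (lt) in
/-- The digits are well-orderings, and they vanish beyond the place `p`. -/
def SCode (p : W) (X : W → W → W → Prop) : Prop :=
  ∀ i, IsWO (X i) ∧ (lt p i → ∀ s, ¬ X i s s)

/-- Every sequence of `N + 1` order types below `Ω` is the expansion of an ordinal, so a code may be
recognized without mention of the ordinal coded. -/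
theorem sCode_iff (hW : #W = 𝔠) {p : W} {N : ℕ} (hp : typein lt p = N) {X : W → W → W → Prop} :
    SCode lt p X ↔ ∃ ρ < Om ^ (N + 1), Codes lt X ρ := by
  constructor
  · intro h
    choose e he using nat_lt_type (lt := lt) hW.ge
    obtain ⟨ρ, hρ, hc⟩ := exists_coeffLow_eq (fun n => otp (X (e n)))
      (fun n => otp_lt_Om hW.le _) (N + 1)
    refine ⟨ρ, hρ, fun i => ⟨(h i).1, fun n hn => ?_, fun hi => ?_⟩⟩
    · obtain rfl : e n = i := typein_injective lt ((he n).trans hn.symm)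
      rcases lt_or_ge n (N + 1) with hnN | hnN
      · exact (hc n hnN).symm
      · rw [coeffLow_eq_zero hnN hρ, otp_eq_zero_iff (h _).1]
        refine (h _).2 ?_
        rw [← typein_lt_typein lt, hp, he]
        exact_mod_cast hnN
    · rw [otp_eq_zero_iff (h _).1]
      refine (h _).2 ?_
      rw [← typein_lt_typein lt, hp]
      exact (natCast_lt_omega0 N).trans_le hi
  · rintro ⟨ρ, hρ, hX⟩ i
    refine ⟨(hX i).1, fun hi => ?_⟩
    rw [← typein_lt_typein lt, hp] at hi
    rw [← otp_eq_zero_iff (hX i).1]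
    rcases lt_or_ge (typein lt i) ω with hi' | hi'
    · obtain ⟨n, hn⟩ := lt_omega0.1 hi'
      rw [(hX i).2.1 n hn]
      refine coeffLow_eq_zero ?_ hρ
      rw [hn] at hi
      exact_mod_cast hi
    · exact (hX i).2.2 hi'
end

/-! ## Codes of the ordinals in the collapsed structure -/

section
variable {W : Type v} (lt : W → W → Prop)

/-- `X` is the code of an ordinal in one of the blocks, the block tops being coded by `g`. -/
def SInc (A : Set W) (p : W) (g : W → W → W → W → W → Prop) (X : W → W → W → Prop) : Prop :=
  SCode lt p X ∧ ∃ x x', (x = x' → x ∈ A) ∧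
    (RLE (X p) (g x x' p) ∧ RLE (g x x' p) (X p)) ∧ SLess lt X (g x x')

/-- `X` is the code of an ordinal which is not the greatest one. -/
def SCard (A : Set W) (p : W) (g : W → W → W → W → W → Prop) (X : W → W → W → Prop) : Prop :=
  SInc lt A p g X ∧ ∃ Y, SInc lt A p g Y ∧ SLess lt X Y

/-- `X` is the code of the greatest ordinal in the block of `a`. -/
def SLast (A : Set W) (p : W) (g : W → W → W → W → W → Prop) (a : W) (X : W → W → W → Prop) :
    Prop :=
  SInc lt A p g X ∧ SLess lt X (g a a) ∧
    ∀ Y, SInc lt A p g Y → SLess lt Y (g a a) → ¬ SLess lt X Y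

/-- `Y` codes a function bounded by a coded ordinal and, if `flag`, only by the greatest one. -/
def SFun {T : Type v} (A : Set W) (p : W) (g : W → W → W → W → W → Prop) (flag : Prop)
    (Y : T → W → W → W → Prop) : Prop :=
  (∀ t, SCard lt A p g (Y t)) ∧ (∃ X, SCard lt A p g X ∧ ∀ t, ¬ SLess lt X (Y t)) ∧
    (flag → ∀ X X', SCard lt A p g X → SCard lt A p g X' → (∀ t, ¬ SLess lt X (Y t)) →
      ¬ SLess lt X X')

/-- The pair `(x, x')` stands for the element `x` of `A` if `x = x'`, and for `∞` otherwise. -/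
def IsLabel {A : Set W} (x x' : W) : Option A → Prop
  | some a => x = a ∧ x' = a
  | none => x ≠ x'

theorem exists_isLabel {A : Set W} {x x' : W} (h : x = x' → x ∈ A) :
    ∃ l : Option A, IsLabel x x' l := by
  by_cases hx : x = x'
  · exact ⟨some ⟨x, h hx⟩, rfl, hx.symm⟩
  · exact ⟨none, hx⟩

theorem IsLabel.mem {A : Set W} {x x' : W} {l : Option A} (h : IsLabel x x' l) (hx : x = x') :
    x ∈ A := by
  cases l with
  | none => exact absurd hx h
  | some a => rw [h.1]; exact a.2

theorem IsLabel.unique {A : Set W} {x x' : W} {l l' : Option A} (h : IsLabel x x' l)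
    (h' : IsLabel x x' l') : l = l' := by
  cases l with
  | none =>
    cases l' with
    | none => rfl
    | some a => exact absurd (h'.1.trans h'.2.symm) h
  | some a =>
    cases l' with
    | none => exact absurd (h.1.trans h.2.symm) h'
    | some b => exact congrArg some (Subtype.ext (h.1.symm.trans h'.1))

theorem IsLabel.exists_pair [Nontrivial W] {A : Set W} (l : Option A) : ∃ x x', IsLabel x x' l := by
  cases l with
  | none => exact exists_pair_ne W
  | some a => exact ⟨a, a, rfl, rfl⟩

/-! ### Blocks of the collapse and their numbers -/

variable [IsWellOrder W lt]

/-- The order type of the part of `lt` below a label. -/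
noncomputable def labelPos {A : Set W} (l : Option A) : Ordinal.{v} :=
  l.elim (type lt) fun a => typein lt a.1

/-- The number of the element of the block of `l` which is at the place `y`. -/
noncomputable def blockNum (k : ℕ) {A : Set W} (l : Option A) (y : Ordinal.{v}) : Ordinal.{v} :=
  Om ^ (k + 2) * labelPos lt l + y

/-- The length of the block of `l`. -/
noncomputable def blockLen (k : ℕ) {A : Set W} (O : Option A → Ordinal.{v}) (l : Option A) :
    Ordinal.{v} :=
  canonicalGap k (gap (range O) (O l))

/-- `X` is a code of the ordinal `η` of the collapsed structure. -/
def Cod (k : ℕ) {A : Set W} (O : Option A → Ordinal.{v}) (X : W → W → W → Prop)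
    (η : Ordinal.{v}) : Prop :=
  ∃ l, ∃ y ≤ blockLen k O l, η = collapseStart k (range O) (O l) + y ∧
    Codes lt X (blockNum lt k l y)

/-- The collapsed structure, its blocks being labelled by `A ∪ {∞}`. -/
structure Blocks (k : ℕ) {A : Set W} (O : Option A → Ordinal.{v}) : Prop where
  mk_eq : #W = 𝔠
  lt_iff : ∀ l l', O l < O l' ↔ labelPos lt l < labelPos lt l'

variable {lt} {k : ℕ} {A : Set W} {O : Option A → Ordinal.{v}}

theorem isLabel_segRel {x x' : W} {l : Option A} (h : IsLabel x x' l) :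
    IsWO (segRel lt x x') ∧ otp (segRel lt x x') = labelPos lt l := by
  cases l with
  | none => exact isWO_segRel_of_ne lt h
  | some a =>
    obtain ⟨rfl, rfl⟩ := h
    exact isWO_segRel_self lt _

namespace Blocks
variable (H : Blocks lt k O)
include H

theorem labelPos_lt (l : Option A) : labelPos lt l < Om := by
  refine (show labelPos lt l ≤ type lt from ?_).trans_lt (lt_Om_of_card_le ?_)
  · cases l with
    | none => exact le_rfl
    | some a => exact (typein_lt_type lt _).le
  · rw [card_type, H.mk_eq]

omit [IsWellOrder W lt] H in
theorem blockLen_lt (l : Option A) : blockLen k O l < Om ^ (k + 2) := canonicalGap_lt _ _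

omit H in
theorem collapse_label (l : Option A) : collapse k (range O) (O l) =
    collapseStart k (range O) (O l) + blockLen k O l := collapse_eq _

theorem eq_iff (l l' : Option A) : labelPos lt l = labelPos lt l' ↔ O l = O l' := by
  rw [le_antisymm_iff, le_antisymm_iff, ← not_lt, ← not_lt, ← not_lt, ← not_lt, H.lt_iff, H.lt_iff]

theorem le_top (l : Option A) : O l ≤ O none := by
  rw [← not_lt, H.lt_iff, not_lt]
  cases l with
  | none => exact le_rfl
  | some a => exact (typein_lt_type lt _).le

/-- Different blocks are ordered by their labels in both numberings, since a block ends before a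
later one starts; inside one block both numberings add the place to a constant. Putting the label in
front as a digit avoids the transfinite sum of the preceding block lengths. -/
theorem blockNum_lt_iff {l l' : Option A} {y y' : Ordinal.{v}} (hy : y ≤ blockLen k O l)
    (hy' : y' ≤ blockLen k O l') : blockNum lt k l y < blockNum lt k l' y' ↔
      collapseStart k (range O) (O l) + y < collapseStart k (range O) (O l') + y' := by
  have key : ∀ {l l' : Option A} {y y' : Ordinal.{v}}, y ≤ blockLen k O l →
      labelPos lt l < labelPos lt l' →
      collapseStart k (range O) (O l) + y < collapseStart k (range O) (O l') + y' := by
    intro l l' y y' hy h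
    refine ((add_le_add_right hy _).trans_lt ?_).trans_le (le_add_right le_rfl)
    rw [← collapse_label]
    exact collapseStart_le_iff.1 le_rfl _ (mem_range_self _) ((H.lt_iff _ _).2 h)
  rw [blockNum, blockNum, mul_add_lt_mul_add_iff (hy.trans_lt (blockLen_lt (k := k) (O := O) l))
    (hy'.trans_lt (blockLen_lt (k := k) (O := O) l'))]
  rcases lt_trichotomy (labelPos lt l) (labelPos lt l') with h | h | h
  · exact iff_of_true (Or.inl h) (key hy h)
  · rw [(H.eq_iff l l').1 h]
    simp [h]
  · refine iff_of_false ?_ (key hy' h).not_gt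
    rintro (h' | ⟨h', -⟩)
    exacts [h.not_gt h', h.ne' h']

omit [IsWellOrder W lt] H in
-- The block is that of the first point whose image is not below `η`.
theorem exists_block {η : Ordinal.{v}} (h : η ≤ collapse k (range O) (O none)) :
    ∃ l, ∃ y ≤ blockLen k O l, η = collapseStart k (range O) (O l) + y := by
  obtain ⟨l, hl, hmin⟩ := (InvImage.wf O (wellFounded_lt (α := Ordinal.{v}))).has_min
    {l | η ≤ collapse k (range O) (O l)} ⟨none, h⟩
  have hs : collapseStart k (range O) (O l) ≤ η := by
    rw [collapseStart_le_iff]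
    rintro _ ⟨l', rfl⟩ hl'
    by_contra hc
    exact hmin l' (not_lt.1 hc) hl'
  refine ⟨l, η - collapseStart k (range O) (O l), ?_, (Ordinal.add_sub_cancel_of_le hs).symm⟩
  rw [Ordinal.sub_le, ← collapse_label]
  exact hl

theorem blockNum_lt (l : Option A) {y : Ordinal.{v}} (hy : y < Om ^ (k + 2)) :
    blockNum lt k l y < Om ^ (k + 3) :=
  mul_add_lt_Om_pow (H.labelPos_lt l) hy

theorem sLess_iff {X Y : W → W → W → Prop} {η η' : Ordinal.{v}} (hX : Cod lt k O X η)
    (hY : Cod lt k O Y η') : SLess lt X Y ↔ η < η' := by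
  obtain ⟨l, y, hy, rfl, hX⟩ := hX
  obtain ⟨l', y', hy', rfl, hY⟩ := hY
  rw [hX.sLess_iff H.mk_eq.ge hY (H.blockNum_lt l (hy.trans_lt (blockLen_lt (k := k) (O := O) l)))
    (H.blockNum_lt l' (hy'.trans_lt (blockLen_lt (k := k) (O := O) l'))), H.blockNum_lt_iff hy hy']

theorem exists_cod {η : Ordinal.{v}} (h : η ≤ collapse k (range O) (O none)) :
    ∃ X, Cod lt k O X η := by
  obtain ⟨l, y, hy, rfl⟩ := exists_block (k := k) h
  obtain ⟨X, hX⟩ := exists_codes (lt := lt) H.mk_eq.ge (blockNum lt k l y)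
  exact ⟨X, l, y, hy, rfl, hX⟩

/-- The block top is coded by the number after that of the last element, so being less than it means
being at most the last element. -/
theorem sLess_top_iff {X Z : W → W → W → Prop} {η : Ordinal.{v}} {l : Option A}
    (hX : Cod lt k O X η) (hZ : Codes lt Z (blockNum lt k l (blockLen k O l + 1))) :
    SLess lt X Z ↔ η ≤ collapse k (range O) (O l) := by
  obtain ⟨l', y, hy, rfl, hX⟩ := hX
  rw [hX.sLess_iff H.mk_eq.ge hZ (H.blockNum_lt l' (hy.trans_lt (blockLen_lt (k := k) (O := O) l')))
    (H.blockNum_lt l ((isSuccLimit_Om_pow _).add_one_lt (blockLen_lt (k := k) (O := O) l))), ← not_lt (b := _ + y),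
    collapse_label, ← H.blockNum_lt_iff le_rfl hy, not_lt, blockNum, blockNum, blockNum,
    ← add_assoc, Order.lt_add_one_iff]

theorem cod_le {X : W → W → W → Prop} {η : Ordinal.{v}} (hX : Cod lt k O X η) :
    η ≤ collapse k (range O) (O none) := by
  obtain ⟨l, y, hy, rfl, -⟩ := hX
  refine (add_le_add_right hy _).trans ?_
  rw [← collapse_label]
  rcases (H.le_top l).lt_or_eq with h | h
  · exact (collapse_lt_collapse (mem_range_self _) h).le
  · rw [h]

variable {p : W} {g : W → W → W → W → W → Prop} (hp : typein lt p = (k + 2 : ℕ))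
  (hg : ∀ x x' (l : Option A), IsLabel x x' l →
    Codes lt (g x x') (blockNum lt k l (blockLen k O l + 1)))
include hp hg

/-- The digit at the place `k + 2` is the label, so agreement with the block top there selects the
block. Comparison with the block top then bounds the remaining digits by the length of the block. -/
theorem sInc_iff {X : W → W → W → Prop} : SInc lt A p g X ↔ ∃ η, Cod lt k O X η := by
  have hnt : Nontrivial W := by
    rw [← Cardinal.one_lt_iff_nontrivial, H.mk_eq]
    exact one_lt_aleph0.trans_le aleph0_le_continuum
  have hlen := fun l => (isSuccLimit_Om_pow _).add_one_lt (blockLen_lt (k := k) (O := O) l)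
  constructor
  · rintro ⟨h1, x, x', hxx, h2, h3⟩
    obtain ⟨l, hl⟩ := exists_isLabel hxx
    obtain ⟨ρ, hρ, hX⟩ := (sCode_iff H.mk_eq hp).1 h1
    have hgl := hg x x' l hl
    rw [← otp_eq_iff (hX p).1 (hgl p).1, (hX p).2.1 _ hp, (hgl p).2.1 _ hp, blockNum,
      coeffLow_mul_add_self (H.labelPos_lt l) (hlen l)] at h2
    -- As `ρ < Ω ^ (k + 3)`, its digit at the place `k + 2` is the whole quotient by `Ω ^ (k + 2)`.
    have e : Om ^ (k + 2) * labelPos lt l + ρ % Om ^ (k + 2) = ρ := by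
      rw [← h2, coeffLow, mod_eq_of_lt, div_add_mod]
      rwa [← lt_mul_iff_div_lt (Om_pow_ne_zero _), ← pow_succ]
    rw [hX.sLess_iff H.mk_eq.ge hgl hρ (H.blockNum_lt l (hlen l)), blockNum, ← e,
      add_lt_add_iff_left, Order.lt_add_one_iff] at h3
    refine ⟨_, l, _, h3, rfl, ?_⟩
    rw [blockNum, e]
    exact hX
  · rintro ⟨η, l, y, hy, rfl, hX⟩
    obtain ⟨x, x', hl⟩ := IsLabel.exists_pair l
    have hgl := hg x x' l hl
    have hy' := hy.trans_lt (blockLen_lt (k := k) (O := O) l)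
    refine ⟨(sCode_iff H.mk_eq hp).2 ⟨_, H.blockNum_lt l hy', hX⟩, x, x', hl.mem, ?_, ?_⟩
    · rw [← otp_eq_iff (hX p).1 (hgl p).1, (hX p).2.1 _ hp, (hgl p).2.1 _ hp, blockNum, blockNum,
        coeffLow_mul_add_self (H.labelPos_lt l) (hlen l),
        coeffLow_mul_add_self (H.labelPos_lt l) hy']
    · rw [hX.sLess_iff H.mk_eq.ge hgl (H.blockNum_lt l hy') (H.blockNum_lt l (hlen l)), blockNum,
        blockNum, add_lt_add_iff_left, Order.lt_add_one_iff]
      exact hy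

/-- The greatest element of the collapse is the image of `lam`; the elements below it play the part
of `Card⁻`. -/
theorem sCard_iff {X : W → W → W → Prop} :
    SCard lt A p g X ↔ ∃ η < collapse k (range O) (O none), Cod lt k O X η := by
  rw [SCard, H.sInc_iff hp hg]
  constructor
  · rintro ⟨⟨η, hη⟩, Y, hY, h⟩
    obtain ⟨η', hη'⟩ := (H.sInc_iff hp hg).1 hY
    exact ⟨η, ((H.sLess_iff hη hη').1 h).trans_le (H.cod_le hη'), hη⟩
  · rintro ⟨η, h, hη⟩
    obtain ⟨Y, hY⟩ := H.exists_cod (le_refl (collapse k (range O) (O none)))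
    exact ⟨⟨η, hη⟩, Y, (H.sInc_iff hp hg).2 ⟨_, hY⟩, (H.sLess_iff hη hY).2 h⟩

theorem sLast_iff {X : W → W → W → Prop} (a : A) :
    SLast lt A p g a X ↔ Cod lt k O X (collapse k (range O) (O (some a))) := by
  have hga := hg a a (some a) ⟨rfl, rfl⟩
  have hle : collapse k (range O) (O (some a)) ≤ collapse k (range O) (O none) := by
    rcases (H.le_top (some a)).lt_or_eq with h | h
    · exact (collapse_lt_collapse (mem_range_self _) h).le
    · rw [h]
  rw [SLast, H.sInc_iff hp hg]
  constructor
  · rintro ⟨⟨η, hη⟩, h1, h2⟩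
    obtain ⟨Y, hY⟩ := H.exists_cod hle
    have := h2 Y ((H.sInc_iff hp hg).2 ⟨_, hY⟩) ((H.sLess_top_iff hY hga).2 le_rfl)
    rw [H.sLess_iff hη hY, not_lt] at this
    rwa [← ((H.sLess_top_iff hη hga).1 h1).antisymm this]
  · intro hX
    refine ⟨⟨_, hX⟩, (H.sLess_top_iff hX hga).2 le_rfl, fun Y hY h => ?_⟩
    obtain ⟨η, hη⟩ := (H.sInc_iff hp hg).1 hY
    rw [H.sLess_iff hX hη, not_lt]
    exact (H.sLess_top_iff hη hga).1 h

/-- `ξ` is bounded below `b` and, if `flag`, every bound of `ξ` below `b` is the greatest ordinal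
below `b`. -/
def _root_.QuotSym.IsBoundedFamily {T : Type v} (flag : Prop) (b : Ordinal.{v})
    (ξ : T → Ordinal.{v}) : Prop :=
  (∃ β < b, ∀ t, ξ t ≤ β) ∧ (flag → ∀ β < b, (∀ t, ξ t ≤ β) → ∀ β' < b, ¬ β < β')

theorem sFun_iff {T : Type v} {flag : Prop} {Y : T → W → W → W → Prop} {η : T → Ordinal.{v}}
    (hY : ∀ t, Cod lt k O (Y t) (η t)) (hη : ∀ t, η t < collapse k (range O) (O none)) :
    SFun lt A p g flag Y ↔ IsBoundedFamily flag (collapse k (range O) (O none)) η := by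
  have hle : ∀ {X β}, Cod lt k O X β → ((∀ t, ¬ SLess lt X (Y t)) ↔ ∀ t, η t ≤ β) := by
    intro X β hX
    exact forall_congr' fun t => by rw [H.sLess_iff hX (hY t), not_lt]
  constructor
  · rintro ⟨-, ⟨X, hX, h1⟩, h2⟩
    obtain ⟨β, hβ, hX⟩ := (H.sCard_iff hp hg).1 hX
    refine ⟨⟨β, hβ, (hle hX).1 h1⟩, fun hf β hβ hb β' hβ' => ?_⟩
    obtain ⟨X, hX⟩ := H.exists_cod hβ.le
    obtain ⟨X', hX'⟩ := H.exists_cod hβ'.le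
    rw [← H.sLess_iff hX hX']
    exact h2 hf X X' ((H.sCard_iff hp hg).2 ⟨_, hβ, hX⟩) ((H.sCard_iff hp hg).2 ⟨_, hβ', hX'⟩)
      ((hle hX).2 hb)
  · rintro ⟨⟨β, hβ, h1⟩, h2⟩
    refine ⟨fun t => (H.sCard_iff hp hg).2 ⟨_, hη t, hY t⟩, ?_, ?_⟩
    · obtain ⟨X, hX⟩ := H.exists_cod hβ.le
      exact ⟨X, (H.sCard_iff hp hg).2 ⟨_, hβ, hX⟩, (hle hX).2 h1⟩
    · intro hf X X' hX hX' hb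
      obtain ⟨β, hβ, hX⟩ := (H.sCard_iff hp hg).1 hX
      obtain ⟨β', hβ', hX'⟩ := (H.sCard_iff hp hg).1 hX'
      rw [H.sLess_iff hX hX']
      exact h2 hf β hβ ((hle hX).1 hb) β' hβ'

end Blocks

/-- A bound is carried over by one move forth, and a pair of ordinals refuting maximality is pulled
back by one move back. So boundedness, which quantifies over ordinals, costs one level. -/
theorem PartialIso.isBoundedFamily {r : ℕ} {P : Set (Ordinal.{v} × Ordinal.{v})}
    (h : PartialIso (r + 1) P)
    {b b' : Ordinal.{v}} (hb : (b, b') ∈ P) {T : Type v} {ξ η : T → Ordinal.{v}}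
    (hξ : ∀ t, (ξ t, η t) ∈ P) {flag : Prop} (hF : IsBoundedFamily flag b ξ) :
    IsBoundedFamily flag b' η := by
  obtain ⟨⟨β, hβ, h1⟩, h2⟩ := hF
  have pair_le : ∀ x y : Ordinal.{v}, #({x, y} : Set Ordinal.{v}) ≤ 𝔠 := fun x y =>
    mk_insert_le_continuum ((mk_singleton y).le.trans
      (one_le_aleph0.trans aleph0_le_continuum)) x
  constructor
  · obtain ⟨P', hP, hiso, hT, -⟩ := h.forth (T := {β, β}) (pair_le _ _) (by
      intro x hx
      simp only [mem_insert_iff, mem_singleton_iff, or_self] at hx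
      exact ⟨_, hb, hx ▸ hβ.le⟩)
    obtain ⟨⟨β₁, β₂⟩, hq, rfl⟩ := hT (mem_insert _ _)
    exact ⟨β₂, (hiso.lt_iff _ hq _ (hP hb)).1 hβ,
      fun t => (le_iff_of_lt_iff hiso.lt_iff (hP (hξ t)) hq).1 (h1 t)⟩
  · intro hf β hβ hle β' hβ'
    obtain ⟨P', hP, hiso, hT, -⟩ := h.back (T := {β, β'}) (pair_le _ _) (by
      rintro x (rfl | rfl)
      exacts [⟨_, hb, hβ.le⟩, ⟨_, hb, hβ'.le⟩])
    obtain ⟨⟨β₁, β₂⟩, hq, rfl⟩ := hT (mem_insert _ _)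
    obtain ⟨⟨β₁', β₂'⟩, hq', rfl⟩ := hT (mem_insert_of_mem _ rfl)
    rw [← hiso.lt_iff _ hq _ hq']
    exact h2 hf β₁ ((hiso.lt_iff _ hq _ (hP hb)).2 hβ)
      (fun t => (le_iff_of_lt_iff hiso.lt_iff (hP (hξ t)) hq).2 (hle t)) β₁'
      ((hiso.lt_iff _ hq' _ (hP hb)).2 hβ')

theorem PartialIso.isBoundedFamily_iff {r : ℕ} {P : Set (Ordinal.{v} × Ordinal.{v})}
    (h : PartialIso (r + 1) P)
    {b b' : Ordinal.{v}} (hb : (b, b') ∈ P) {T : Type v} {ξ η : T → Ordinal.{v}}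
    (hξ : ∀ t, (ξ t, η t) ∈ P) {flag : Prop} :
    IsBoundedFamily flag b ξ ↔ IsBoundedFamily flag b' η :=
  ⟨h.isBoundedFamily hb hξ, h.swap.isBoundedFamily (mem_image_of_mem _ hb)
    fun t => mem_image_of_mem _ (hξ t)⟩

end

/-! ## Second-order formulae with their meanings -/

section
variable {κ lam mu : Cardinal.{u}}

/-- An element of `IS_2`. -/
def eE (x : IS lam mu 2) : NElt κ lam mu := .ofIS (n := 1) x

/-- A set of elements of `IS_2`. -/
def eR1 (R : IS lam mu 2 → Prop) : NElt κ lam mu := .ofRel (l := [.is 1]) {p | R p.1}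

/-- A binary relation on `IS_2`. -/
def eR2 (R : IS lam mu 2 → IS lam mu 2 → Prop) : NElt κ lam mu :=
  .ofRel (l := [.is 1, .is 1]) {p | R p.1 p.2.1}

/-- A ternary relation on `IS_2`. -/
def eR3 (R : IS lam mu 2 → IS lam mu 2 → IS lam mu 2 → Prop) : NElt κ lam mu :=
  .ofRel (l := [.is 1, .is 1, .is 1]) {p | R p.1 p.2.1 p.2.2.1}

/-- A quinary relation on `IS_2`. -/
def eR5 (R : IS lam mu 2 → IS lam mu 2 → IS lam mu 2 → IS lam mu 2 → IS lam mu 2 → Prop) :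
    NElt κ lam mu :=
  .ofRel (l := [.is 1, .is 1, .is 1, .is 1, .is 1])
    {p | R p.1 p.2.1 p.2.2.1 p.2.2.2.1 p.2.2.2.2.1}

/-- A family of ternary relations on `IS_2` indexed by `IS_{n+1}`. -/
def eF (n : ℕ) (R : IS lam mu (n + 1) → IS lam mu 2 → IS lam mu 2 → IS lam mu 2 → Prop) :
    NElt κ lam mu :=
  .ofRel (l := [.is n, .is 1, .is 1, .is 1]) {p | R p.1 p.2.1 p.2.2.1 p.2.2.2.1}

/-- A relation between `IS_{n+1}` and `IS_2`. -/
def eRep (n : ℕ) (R : IS lam mu (n + 1) → IS lam mu 2 → Prop) : NElt κ lam mu :=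
  .ofRel (l := [.is n, .is 1]) {p | R p.1 p.2.1}

abbrev tE : NType := .elt (.is 1)
abbrev tR1 : NType := .rel [.is 1]
abbrev tR2 : NType := .rel [.is 1, .is 1]
abbrev tR3 : NType := .rel [.is 1, .is 1, .is 1]
abbrev tR5 : NType := .rel [.is 1, .is 1, .is 1, .is 1, .is 1]
abbrev tF (n : ℕ) : NType := .rel [.is n, .is 1, .is 1, .is 1]
abbrev tRep (n : ℕ) : NType := .rel [.is n, .is 1]

/-- The kinds of the values of a partial assignment. -/
def typesOf {ι : Type*} {C : ι → Type*} (w : ℕ → Option (Sigma C)) (i : ℕ) : Option ι :=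
  (w i).map Sigma.fst

theorem typesOf_update {ι : Type*} {C : ι → Type*} (w : ℕ → Option (Sigma C)) (i : ℕ)
    (x : Sigma C) :
    typesOf (Function.update w i (some x)) = Function.update (typesOf w) i (some x.1) := by
  funext j
  by_cases h : j = i
  · subst h; simp [typesOf]
  · simp [typesOf, h]

/-- The variable `i`, which is below `b`, has the value `x`. -/
class Has (w : ℕ → Option (NElt κ lam mu)) (b i : ℕ) (x : outParam (NElt κ lam mu)) : Prop where
  lt : i < b
  eq : w i = some x

/-- The newest variable is tried first. Older ones survive an update because their indices are below
the fresh index `b`. -/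
instance (priority := high) Has.new (w : ℕ → Option (NElt κ lam mu)) (b : ℕ) (x : NElt κ lam mu) :
    Has (Function.update w b (some x)) (b + 1) b x :=
  ⟨Nat.lt_succ_self b, Function.update_self _ _ _⟩

instance Has.update (w : ℕ → Option (NElt κ lam mu)) (b i : ℕ) (x y : NElt κ lam mu)
    [h : Has w b i x] : Has (Function.update w b (some y)) (b + 1) i x :=
  ⟨h.lt.trans (Nat.lt_succ_self b), by rw [Function.update_of_ne h.lt.ne, h.eq]⟩

theorem Has.type_eq {w : ℕ → Option (NElt κ lam mu)} {b i : ℕ} {x : NElt κ lam mu}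
    (h : Has w b i x) : typesOf w i = some x.1 := by simp [typesOf, h.eq]

/-- The formula `ψ` is well-sorted under the assignment `w`, and it means `P`. -/
class Means (w : ℕ → Option (NElt κ lam mu)) (b : ℕ) (ψ : NFormula) (P : outParam Prop) : Prop where
  wellSorted : ψ.WellSorted (typesOf w)
  sat_iff : ψ.Sat w ↔ P

variable {w : ℕ → Option (NElt κ lam mu)} {b : ℕ}

instance Means.neg (ψ : NFormula) (P : Prop) [h : Means w b ψ P] : Means w b ψ.neg (¬ P) :=
  ⟨h.1, not_congr h.2⟩

instance Means.and (ψ ψ' : NFormula) (P P' : Prop) [h : Means w b ψ P] [h' : Means w b ψ' P'] :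
    Means w b (ψ.and ψ') (P ∧ P') :=
  ⟨⟨h.1, h'.1⟩, and_congr h.2 h'.2⟩

def NFormula.imp (ψ ψ' : NFormula) : NFormula := (ψ.and ψ'.neg).neg
def NFormula.iff (ψ ψ' : NFormula) : NFormula := (ψ.imp ψ').and (ψ'.imp ψ)

instance Means.imp (ψ ψ' : NFormula) (P P' : Prop) [Means w b ψ P] [Means w b ψ' P'] :
    Means w b (ψ.imp ψ') (P → P') := by
  have : Means w b (ψ.imp ψ') (¬ (P ∧ ¬ P')) := by unfold NFormula.imp; infer_instance
  exact ⟨this.1, this.2.trans (by tauto)⟩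

instance Means.iff (ψ ψ' : NFormula) (P P' : Prop) [Means w b ψ P] [Means w b ψ' P'] :
    Means w b (ψ.iff ψ') (P ↔ P') := by
  have : Means w b (ψ.iff ψ') ((P → P') ∧ (P' → P)) := by unfold NFormula.iff; infer_instance
  exact ⟨this.1, this.2.trans (by tauto)⟩

/-- The quantifier `∃`, with a fresh variable. -/
def exN (τ : NType) (b : ℕ) (f : ℕ → ℕ → NFormula) : NFormula := .ex b τ (f b (b + 1))

/-- The quantifier `∀`, with a fresh variable. -/
def allN (τ : NType) (b : ℕ) (f : ℕ → ℕ → NFormula) : NFormula :=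
  .neg (.ex b τ (.neg (f b (b + 1))))

/-- The map `c` parametrizes the range of the variable by curried predicates. Nonemptiness of `ι`
supplies an assignment from which the well-sortedness of the body is read off. -/
theorem Means.ex {τ : NType} {ι : Type*} [Nonempty ι] (c : ι → NCarrier κ lam mu τ)
    (hc : Function.Surjective c) {i b' : ℕ} {ψ : NFormula} {P : ι → Prop}
    (h : ∀ x, Means (Function.update w i (some ⟨τ, c x⟩)) b' ψ (P x)) :
    Means w b (.ex i τ ψ) (∃ x, P x) := by
  constructor
  · obtain ⟨x⟩ := ‹Nonempty ι›
    have := (h x).1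
    rwa [typesOf_update] at this
  · change (∃ y, ψ.Sat _) ↔ _
    constructor
    · rintro ⟨y, hy⟩
      obtain ⟨x, rfl⟩ := hc y
      exact ⟨x, (h x).2.1 hy⟩
    · rintro ⟨x, hx⟩
      exact ⟨c x, (h x).2.2 hx⟩

theorem Means.all {τ : NType} {ι : Type*} [Nonempty ι] (c : ι → NCarrier κ lam mu τ)
    (hc : Function.Surjective c) {f : ℕ → ℕ → NFormula} {P : ι → Prop}
    (h : ∀ x, Means (Function.update w b (some ⟨τ, c x⟩)) (b + 1) (f b (b + 1)) (P x)) :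
    Means w b (allN τ b f) (∀ x, P x) := by
  have h' := fun x => Means.neg _ _ (h := h x)
  have := Means.neg (b := b) _ _ (h := Means.ex c hc h')
  exact ⟨this.1, this.2.trans (by push Not; rfl)⟩

def eI (n : ℕ) (x : IS lam mu (n + 1)) : NElt κ lam mu := .ofIS x

theorem surj_R1 : Function.Surjective
    fun R : IS lam mu 2 → Prop =>
      ({p | R p.1} : Set (NTuple κ lam mu [.is 1])) :=
  fun S => ⟨fun x => (x, PUnit.unit) ∈ S, rfl⟩

theorem surj_R2 : Function.Surjective
    fun R : IS lam mu 2 → IS lam mu 2 → Prop =>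
      ({p | R p.1 p.2.1} : Set (NTuple κ lam mu [.is 1, .is 1])) :=
  fun S => ⟨fun x y => (x, y, PUnit.unit) ∈ S, rfl⟩

theorem surj_R3 : Function.Surjective
    fun R : IS lam mu 2 → IS lam mu 2 → IS lam mu 2 → Prop =>
      ({p | R p.1 p.2.1 p.2.2.1} : Set (NTuple κ lam mu [.is 1, .is 1, .is 1])) :=
  fun S => ⟨fun x y z => (x, y, z, PUnit.unit) ∈ S, rfl⟩

theorem surj_R5 : Function.Surjective
    fun R : IS lam mu 2 → IS lam mu 2 → IS lam mu 2 → IS lam mu 2 → IS lam mu 2 → Prop =>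
      ({p | R p.1 p.2.1 p.2.2.1 p.2.2.2.1 p.2.2.2.2.1} : Set (NTuple κ lam mu [.is 1, .is 1, .is
          1, .is 1, .is 1])) :=
  fun S => ⟨fun x y z s t => (x, y, z, s, t, PUnit.unit) ∈ S, rfl⟩

theorem surj_F (n : ℕ) : Function.Surjective
    fun R : IS lam mu (n + 1) → IS lam mu 2 → IS lam mu 2 → IS lam mu 2 → Prop =>
      ({p | R p.1 p.2.1 p.2.2.1 p.2.2.2.1} : Set (NTuple κ lam mu [.is n, .is 1, .is 1, .is 1])) :=
  fun S => ⟨fun x y z s => (x, y, z, s, PUnit.unit) ∈ S, rfl⟩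

section
variable {f : ℕ → ℕ → NFormula}

instance Means.exE (P : IS lam mu 2 → Prop)
    [h : ∀ x, Means (Function.update w b (some (eE x))) (b + 1) (f b (b + 1)) (P x)] :
    Means w b (exN tE b f) (∃ x, P x) :=
  Means.ex (τ := tE) (fun x : IS lam mu 2 => x) Function.surjective_id h

instance Means.allE (P : IS lam mu 2 → Prop)
    [h : ∀ x, Means (Function.update w b (some (eE x))) (b + 1) (f b (b + 1)) (P x)] :
    Means w b (allN tE b f) (∀ x, P x) :=
  Means.all (τ := tE) (fun x : IS lam mu 2 => x) Function.surjective_id h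

/-- For `n = 1` this overlaps with `Means.exE`, which is to be preferred, so that elements of `IS_2`
are recorded in the form `eE`. -/
instance (priority := low) Means.exI (n : ℕ) (P : IS lam mu (n + 1) → Prop)
    [h : ∀ x, Means (Function.update w b (some (eI n x))) (b + 1) (f b (b + 1)) (P x)] :
    Means w b (exN (.elt (.is n)) b f) (∃ x, P x) :=
  Means.ex (τ := .elt (.is n)) (fun x : IS lam mu (n + 1) => x) Function.surjective_id h

instance (priority := low) Means.allI (n : ℕ) (P : IS lam mu (n + 1) → Prop)
    [h : ∀ x, Means (Function.update w b (some (eI n x))) (b + 1) (f b (b + 1)) (P x)] :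
    Means w b (allN (.elt (.is n)) b f) (∀ x, P x) :=
  Means.all (τ := .elt (.is n)) (fun x : IS lam mu (n + 1) => x) Function.surjective_id h

instance Means.allR1 (P : (IS lam mu 2 → Prop) → Prop)
    [h : ∀ x, Means (Function.update w b (some (eR1 x))) (b + 1) (f b (b + 1)) (P x)] :
    Means w b (allN tR1 b f) (∀ x, P x) :=
  Means.all (τ := tR1) _ surj_R1 h

instance Means.exR2 (P : (IS lam mu 2 → IS lam mu 2 → Prop) → Prop)
    [h : ∀ x, Means (Function.update w b (some (eR2 x))) (b + 1) (f b (b + 1)) (P x)] :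
    Means w b (exN tR2 b f) (∃ x, P x) :=
  Means.ex (τ := tR2) _ surj_R2 h

instance Means.exR3 (P : (IS lam mu 2 → IS lam mu 2 → IS lam mu 2 → Prop) → Prop)
    [h : ∀ x, Means (Function.update w b (some (eR3 x))) (b + 1) (f b (b + 1)) (P x)] :
    Means w b (exN tR3 b f) (∃ x, P x) :=
  Means.ex (τ := tR3) _ surj_R3 h

instance Means.allR3 (P : (IS lam mu 2 → IS lam mu 2 → IS lam mu 2 → Prop) → Prop)
    [h : ∀ x, Means (Function.update w b (some (eR3 x))) (b + 1) (f b (b + 1)) (P x)] :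
    Means w b (allN tR3 b f) (∀ x, P x) :=
  Means.all (τ := tR3) _ surj_R3 h

end

def mem1 (r x : ℕ) : NFormula := .mem [.is 1] r [x]
def mem2 (r x y : ℕ) : NFormula := .mem [.is 1, .is 1] r [x, y]
def mem3 (r x y z : ℕ) : NFormula := .mem [.is 1, .is 1, .is 1] r [x, y, z]
def mem5 (r x y z s t : ℕ) : NFormula :=
  .mem [.is 1, .is 1, .is 1, .is 1, .is 1] r [x, y, z, s, t]
def memF (n r x y z s : ℕ) : NFormula := .mem [.is n, .is 1, .is 1, .is 1] r [x, y, z, s]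
def memRep (n r x y : ℕ) : NFormula := .mem [.is n, .is 1] r [x, y]

theorem isValue_nil_iff (p : NTuple κ lam mu []) : NTuple.IsValue w [] [] p ↔ True := by
  simp [NTuple.IsValue]

theorem isValue_cons_iff {σ : NSort} {l : List NSort} {i : ℕ} {is : List ℕ}
    {x : NBase κ lam mu σ} (h : w i = some ⟨.elt σ, x⟩) (p : NTuple κ lam mu (σ :: l)) :
    NTuple.IsValue w (σ :: l) (i :: is) p ↔ p.1 = x ∧ NTuple.IsValue w l is p.2 := by
  rw [NTuple.IsValue, h]
  refine and_congr_left' ⟨fun h => ?_, fun h => by rw [h]⟩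
  exact (eq_of_heq (Sigma.mk.inj (Option.some.inj h)).2).symm

theorem Means.mem {l : List NSort} {r : ℕ} {is : List ℕ} {R : Set (NTuple κ lam mu l)}
    (hr : w r = some (.ofRel R)) {p : NTuple κ lam mu l}
    (ht : is.map (typesOf w) = l.map (fun σ => some (.elt σ)))
    (hp : ∀ p', NTuple.IsValue w l is p' ↔ p' = p) : Means w b (.mem l r is) (p ∈ R) := by
  refine ⟨⟨by simp [typesOf, hr, NElt.ofRel], ht⟩, ?_⟩
  constructor
  · rintro ⟨R', p', h1, h2, h3⟩
    rw [hr] at h1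
    rw [hp] at h2
    rw [eq_of_heq (Sigma.mk.inj (Option.some.inj h1)).2, ← h2]
    exact h3
  · exact fun h => ⟨R, p, hr, (hp p).2 rfl, h⟩

instance Means.mem1 (r x : ℕ) (R : IS lam mu 2 → Prop)
    (X : IS lam mu 2) [hr : Has w b r (eR1 R)]
    [hx : Has w b x (eE X)] : Means w b (mem1 r x) (R X) := by
  refine Means.mem (p := ((X, PUnit.unit) : NTuple κ lam mu [.is 1])) hr.eq ?_
    fun p => ?_
  · simp [hx.type_eq, eE, NElt.ofIS]
  · rw [isValue_cons_iff hx.eq, isValue_nil_iff]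
    refine ⟨fun ⟨h1, _⟩ => ?_, fun h => ?_⟩
    · exact Prod.ext h1 rfl
    · subst h
      exact ⟨rfl, trivial⟩

instance Means.mem2 (r x y : ℕ) (R : IS lam mu 2 → IS lam mu 2 → Prop)
    (X : IS lam mu 2) (Y : IS lam mu 2) [hr : Has w b r (eR2 R)]
    [hx : Has w b x (eE X)]
    [hy : Has w b y (eE Y)] : Means w b (mem2 r x y) (R X Y) := by
  refine Means.mem (p := ((X, Y, PUnit.unit) : NTuple κ lam mu [.is 1, .is 1])) hr.eq ?_
    fun p => ?_
  · simp [hx.type_eq, hy.type_eq, eE, NElt.ofIS]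
  · rw [isValue_cons_iff hx.eq, isValue_cons_iff hy.eq, isValue_nil_iff]
    refine ⟨fun ⟨h1, h2, _⟩ => ?_, fun h => ?_⟩
    · exact Prod.ext h1 (Prod.ext h2 rfl)
    · subst h
      exact ⟨rfl, rfl, trivial⟩

instance Means.mem3 (r x y z : ℕ) (R : IS lam mu 2 → IS lam mu 2 → IS lam mu 2 → Prop)
    (X : IS lam mu 2) (Y : IS lam mu 2) (Z : IS lam mu 2) [hr : Has w b r (eR3 R)]
    [hx : Has w b x (eE X)]
    [hy : Has w b y (eE Y)]
    [hz : Has w b z (eE Z)] : Means w b (mem3 r x y z) (R X Y Z) := by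
  refine Means.mem (p := ((X, Y, Z, PUnit.unit) : NTuple κ lam mu [.is 1, .is 1, .is 1])) hr.eq ?_
    fun p => ?_
  · simp [hx.type_eq, hy.type_eq, hz.type_eq, eE, NElt.ofIS]
  · rw [isValue_cons_iff hx.eq, isValue_cons_iff hy.eq, isValue_cons_iff hz.eq, isValue_nil_iff]
    refine ⟨fun ⟨h1, h2, h3, _⟩ => ?_, fun h => ?_⟩
    · exact Prod.ext h1 (Prod.ext h2 (Prod.ext h3 rfl))
    · subst h
      exact ⟨rfl, rfl, rfl, trivial⟩

instance Means.mem5 (r x y z s t : ℕ) (R : IS lam mu 2 → IS lam mu 2 → IS lam mu 2 → IS lam mu 2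
    → IS lam mu 2 → Prop)
    (X : IS lam mu 2) (Y : IS lam mu 2) (Z : IS lam mu 2) (S : IS lam mu 2) (T : IS lam mu 2)
        [hr : Has w b r (eR5 R)]
    [hx : Has w b x (eE X)]
    [hy : Has w b y (eE Y)]
    [hz : Has w b z (eE Z)]
    [hs : Has w b s (eE S)]
    [ht : Has w b t (eE T)] : Means w b (mem5 r x y z s t) (R X Y Z S T) := by
  refine Means.mem (p := ((X, Y, Z, S, T, PUnit.unit) : NTuple κ lam mu [.is 1, .is 1, .is 1,
      .is 1, .is 1])) hr.eq ?_
    fun p => ?_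
  · simp [hx.type_eq, hy.type_eq, hz.type_eq, hs.type_eq, ht.type_eq, eE, NElt.ofIS]
  · rw [isValue_cons_iff hx.eq, isValue_cons_iff hy.eq, isValue_cons_iff hz.eq, isValue_cons_iff
      hs.eq, isValue_cons_iff ht.eq, isValue_nil_iff]
    refine ⟨fun ⟨h1, h2, h3, h4, h5, _⟩ => ?_, fun h => ?_⟩
    · exact Prod.ext h1 (Prod.ext h2 (Prod.ext h3 (Prod.ext h4 (Prod.ext h5 rfl))))
    · subst h
      exact ⟨rfl, rfl, rfl, rfl, rfl, trivial⟩

instance Means.memF (n : ℕ) (r x y z s : ℕ) (R : IS lam mu (n + 1) → IS lam mu 2 → IS lam mu 2 →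
    IS lam mu 2 → Prop)
    (X : IS lam mu (n + 1)) (Y : IS lam mu 2) (Z : IS lam mu 2) (S : IS lam mu 2) [hr : Has w b
        r (eF n R)]
    [hx : Has w b x (eI n X)]
    [hy : Has w b y (eE Y)]
    [hz : Has w b z (eE Z)]
    [hs : Has w b s (eE S)] : Means w b (memF n r x y z s) (R X Y Z S) := by
  refine Means.mem (p := ((X, Y, Z, S, PUnit.unit) : NTuple κ lam mu [.is n, .is 1, .is 1, .is
      1])) hr.eq ?_
    fun p => ?_
  · simp [hx.type_eq, hy.type_eq, hz.type_eq, hs.type_eq, eE, eI, NElt.ofIS]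
  · rw [isValue_cons_iff hx.eq, isValue_cons_iff hy.eq, isValue_cons_iff hz.eq, isValue_cons_iff
      hs.eq, isValue_nil_iff]
    refine ⟨fun ⟨h1, h2, h3, h4, _⟩ => ?_, fun h => ?_⟩
    · exact Prod.ext h1 (Prod.ext h2 (Prod.ext h3 (Prod.ext h4 rfl)))
    · subst h
      exact ⟨rfl, rfl, rfl, rfl, trivial⟩

instance Means.memRep (n : ℕ) (r x y : ℕ) (R : IS lam mu (n + 1) → IS lam mu 2 → Prop)
    (X : IS lam mu (n + 1)) (Y : IS lam mu 2) [hr : Has w b r (eRep n R)]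
    [hx : Has w b x (eI n X)]
    [hy : Has w b y (eE Y)] : Means w b (memRep n r x y) (R X Y) := by
  refine Means.mem (p := ((X, Y, PUnit.unit) : NTuple κ lam mu [.is n, .is 1])) hr.eq ?_
    fun p => ?_
  · simp [hx.type_eq, hy.type_eq, eE, eI, NElt.ofIS]
  · rw [isValue_cons_iff hx.eq, isValue_cons_iff hy.eq, isValue_nil_iff]
    refine ⟨fun ⟨h1, h2, _⟩ => ?_, fun h => ?_⟩
    · exact Prod.ext h1 (Prod.ext h2 rfl)
    · subst h
      exact ⟨rfl, rfl, trivial⟩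

def eqE (x y : ℕ) : NFormula := .eq (.is 1) x y

instance Means.eqE (x y : ℕ) (X Y : IS lam mu 2) [hx : Has w b x (eE X)] [hy : Has w b y (eE Y)] :
    Means w b (eqE x y) (X = Y) := by
  refine ⟨⟨hx.type_eq, hy.type_eq⟩, ?_⟩
  change (∃ z, _) ↔ _
  rw [hx.eq, hy.eq]
  constructor
  · rintro ⟨z, h1, h2⟩
    exact (eq_of_heq (Sigma.mk.inj (Option.some.inj h1)).2).trans
      (eq_of_heq (Sigma.mk.inj (Option.some.inj h2)).2).symm
  · rintro rfl
    exact ⟨_, rfl, rfl⟩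

instance Means.proj1 (n x y : ℕ) (X : IS lam mu (n + 2)) (Y : IS lam mu (n + 1))
    [hx : Has w b x (eI (n + 1) X)] [hy : Has w b y (eI n Y)] :
    Means w b (.proj1 n x y) (Proj1 X Y) := by
  refine ⟨⟨hx.type_eq, hy.type_eq⟩, ?_⟩
  change (∃ z z', _) ↔ _
  rw [hx.eq, hy.eq]
  constructor
  · rintro ⟨z, z', h1, h2, h⟩
    rw [show X = z from eq_of_heq (Sigma.mk.inj (Option.some.inj h1)).2,
      show Y = z' from eq_of_heq (Sigma.mk.inj (Option.some.inj h2)).2]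
    exact h
  · exact fun h => ⟨_, _, rfl, rfl, h⟩

/-! ## Sections of relations -/

/-- `f` holds for the section of the ternary relation `X` at `i`. -/
def secR (b X i : ℕ) (f : ℕ → ℕ → NFormula) : NFormula :=
  exN tR2 b fun r b => (allN tE b fun s b => allN tE b fun t _ =>
    (mem2 r s t).iff (mem3 X i s t)).and (f r b)

/-- `f` holds for the section of the quinary relation `g` at `(x, x')`. -/
def secG (b g x x' : ℕ) (f : ℕ → ℕ → NFormula) : NFormula :=
  exN tR3 b fun r b => (allN tE b fun i b => allN tE b fun s b => allN tE b fun t _ =>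
    (mem3 r i s t).iff (mem5 g x x' i s t)).and (f r b)

/-- `f` holds for the section of the family `Y` at `t`. -/
def secF (b n Y t : ℕ) (f : ℕ → ℕ → NFormula) : NFormula :=
  exN tR3 b fun r b => (allN tE b fun i b => allN tE b fun s b => allN tE b fun s' _ =>
    (mem3 r i s s').iff (memF n Y t i s s')).and (f r b)

/-- `f` holds for the reflexive form of the well-ordering below `(x, x')`. -/
def secSeg (b x x' : ℕ) (f : ℕ → ℕ → NFormula) : NFormula :=
  exN tR2 b fun r b => (allN tE b fun s b => allN tE b fun t _ =>
    (mem2 r s t).iff ((mem2 1 t s).neg.and ((eqE x x').imp (mem2 1 t x)))).and (f r b)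

section
variable {f : ℕ → ℕ → NFormula}

/-- By extensionality there is just one relation equal to the section, so the existential quantifier
merely names it. -/
instance Means.secR (X i : ℕ) (X' : IS lam mu 2 → IS lam mu 2 → IS lam mu 2 → Prop)
    (i' : IS lam mu 2) [Has w b X (eR3 X')] [Has w b i (eE i')]
    (Q : (IS lam mu 2 → IS lam mu 2 → Prop) → Prop)
    [∀ R, Means (Function.update w b (some (eR2 R))) (b + 1) (f b (b + 1)) (Q R)] :
    Means w b (secR b X i f) (Q (X' i')) := by
  have : Means w b (QuotSym.secR b X i f) (∃ R, (∀ s t, R s t ↔ X' i' s t) ∧ Q R) := by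
    unfold QuotSym.secR; infer_instance
  refine ⟨this.1, this.2.trans ⟨?_, fun h => ⟨_, fun _ _ => Iff.rfl, h⟩⟩⟩
  rintro ⟨R, h, hQ⟩
  rwa [show X' i' = R from funext fun s => funext fun t => propext (h s t).symm]

instance Means.secG (g x x' : ℕ)
    (G : IS lam mu 2 → IS lam mu 2 → IS lam mu 2 → IS lam mu 2 → IS lam mu 2 → Prop)
    (y y' : IS lam mu 2) [Has w b g (eR5 G)] [Has w b x (eE y)] [Has w b x' (eE y')]
    (Q : (IS lam mu 2 → IS lam mu 2 → IS lam mu 2 → Prop) → Prop)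
    [∀ R, Means (Function.update w b (some (eR3 R))) (b + 1) (f b (b + 1)) (Q R)] :
    Means w b (secG b g x x' f) (Q (G y y')) := by
  have : Means w b (QuotSym.secG b g x x' f) (∃ R, (∀ i s t, R i s t ↔ G y y' i s t) ∧ Q R) := by
    unfold QuotSym.secG; infer_instance
  refine ⟨this.1, this.2.trans ⟨?_, fun h => ⟨_, fun _ _ _ => Iff.rfl, h⟩⟩⟩
  rintro ⟨R, h, hQ⟩
  rwa [show G y y' = R from funext fun i => funext fun s => funext fun t => propext (h i s t).symm]

instance Means.secF (n Y t : ℕ)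
    (Y' : IS lam mu (n + 1) → IS lam mu 2 → IS lam mu 2 → IS lam mu 2 → Prop)
    (t' : IS lam mu (n + 1)) [Has w b Y (eF n Y')] [Has w b t (eI n t')]
    (Q : (IS lam mu 2 → IS lam mu 2 → IS lam mu 2 → Prop) → Prop)
    [∀ R, Means (Function.update w b (some (eR3 R))) (b + 1) (f b (b + 1)) (Q R)] :
    Means w b (secF b n Y t f) (Q (Y' t')) := by
  have : Means w b (QuotSym.secF b n Y t f) (∃ R, (∀ i s s', R i s s' ↔ Y' t' i s s') ∧ Q R) := by
    unfold QuotSym.secF; infer_instance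
  refine ⟨this.1, this.2.trans ⟨?_, fun h => ⟨_, fun _ _ _ => Iff.rfl, h⟩⟩⟩
  rintro ⟨R, h, hQ⟩
  rwa [show Y' t' = R from funext fun i => funext fun s => funext fun t => propext (h i s t).symm]

instance Means.secSeg (x x' : ℕ) (lt : IS lam mu 2 → IS lam mu 2 → Prop)
    (y y' : IS lam mu 2) [Has w b 1 (eR2 lt)] [Has w b x (eE y)] [Has w b x' (eE y')]
    (Q : (IS lam mu 2 → IS lam mu 2 → Prop) → Prop)
    [∀ R, Means (Function.update w b (some (eR2 R))) (b + 1) (f b (b + 1)) (Q R)] :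
    Means w b (secSeg b x x' f) (Q (segRel lt y y')) := by
  have : Means w b (QuotSym.secSeg b x x' f)
      (∃ R, (∀ s t, R s t ↔ ¬ lt t s ∧ (y = y' → lt t y)) ∧ Q R) := by
    unfold QuotSym.secSeg; infer_instance
  refine ⟨this.1, this.2.trans ⟨?_, fun h => ⟨_, fun _ _ => Iff.rfl, h⟩⟩⟩
  rintro ⟨R, h, hQ⟩
  rwa [show segRel lt y y' = R from funext fun s => funext fun t => propext (h s t).symm]

end
end

/-! ## The formulae defining the coded structure

The variables `0`, `1`, `q`, `q + 1` stand for `A`, `<*`, the last digit place and the codes of the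
block tops. -/

/-- The order type of the reflexive well-ordering `r` is at most that of `r'`. -/
def fLE (r r' b : ℕ) : NFormula :=
  exN tR2 b fun f b =>
    (allN tE b fun s b => (mem2 r s s).imp (exN tE b fun t _ => (mem2 r' t t).and (mem2 f s t))).and
    (allN tE b fun s b => allN tE b fun s' b => allN tE b fun t b => allN tE b fun t' _ =>
      (((mem2 f s t).and (mem2 f s' t')).and ((mem2 r s s').and (eqE s s').neg)).imp
        ((mem2 r' t t').and (eqE t t').neg))

/-- The reflexive well-orderings `r` and `r'` have the same order type. -/
def fEqv (r r' b : ℕ) : NFormula := (fLE r r' b).and (fLE r' r b)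

/-- `r` is a reflexive well-ordering. -/
def fWO (r b : ℕ) : NFormula :=
  (allN tE b fun s b => allN tE b fun t _ => (mem2 r s t).imp ((mem2 r s s).and (mem2 r t t))).and
  (allN tR1 b fun S b => (exN tE b fun s _ => (mem1 S s).and (mem2 r s s)).imp
    (exN tE b fun m b => ((mem1 S m).and (mem2 r m m)).and
      (allN tE b fun s _ => ((mem1 S s).and (mem2 r s s)).imp
        ((mem2 r m s).and ((mem2 r s m).imp (eqE s m))))))

/-- The ordinal coded by `X` is less than the one coded by `Y`. -/
def fLess (X Y b : ℕ) : NFormula :=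
  exN tE b fun i b =>
    (secR b Y i fun r b => secR b X i fun r' b => (fLE r r' b).neg).and
    (allN tE b fun i' b => (mem2 1 i i').imp
      (secR b X i' fun r b => secR b Y i' fun r' b => fEqv r r' b))

/-- The digits coded by `X` are well-orderings, and they vanish beyond the place `q`. -/
def fSCode (q X b : ℕ) : NFormula :=
  allN tE b fun i b => (secR b X i fun r b => fWO r b).and
    ((mem2 1 q i).imp (allN tE b fun s _ => (mem3 X i s s).neg))

/-- `X` codes an ordinal in one of the blocks. -/
def fInc (q X b : ℕ) : NFormula :=
  (fSCode q X b).and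
    (exN tE b fun x b => exN tE b fun x' b => ((eqE x x').imp (mem1 0 x)).and
      ((secR b X q fun r b => secG b (q + 1) x x' fun Z b => secR b Z q fun r' b => fEqv r r' b).and
        (secG b (q + 1) x x' fun Z b => fLess X Z b)))

/-- `X` codes an ordinal which is not the greatest one. -/
def fCard (q X b : ℕ) : NFormula :=
  (fInc q X b).and (exN tR3 b fun Y b => (fInc q Y b).and (fLess X Y b))

/-- `X` codes the greatest ordinal in the block of `a`. -/
def fLast (q a X b : ℕ) : NFormula :=
  (fInc q X b).and ((secG b (q + 1) a a fun Z b => fLess X Z b).and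
    (allN tR3 b fun Y b => (fInc q Y b).imp
      ((secG b (q + 1) a a fun Z b => fLess Y Z b).imp (fLess X Y b).neg)))

/-- `lam = mu⁺`. -/
def fFlag (b : ℕ) : NFormula :=
  allN tE b fun t b => exN (.elt (.is 0)) b fun s _ => .proj1 0 t s

/-- The ordinal coded by `X` is an upper bound of the function coded by `Y`. -/
def fUB (n X Y b : ℕ) : NFormula :=
  allN (.elt (.is n)) b fun t b => secF b n Y t fun Z b => (fLess X Z b).neg

/-- `Y` codes the image of an element of `F_{n+1}`. -/
def fFun (q n Y b : ℕ) : NFormula :=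
  (allN (.elt (.is n)) b fun t b => secF b n Y t fun X b => fCard q X b).and
  ((exN tR3 b fun X b => (fCard q X b).and (fUB n X Y b)).and
  ((fFlag b).imp (allN tR3 b fun X b => allN tR3 b fun X' b => (fCard q X b).imp
    ((fCard q X' b).imp ((fUB n X Y b).imp (fLess X X' b).neg)))))

section
variable {κ lam mu : Cardinal.{u}} {w : ℕ → Option (NElt κ lam mu)} {b : ℕ}

/-- The semantic predicates have the same shape as the formulae, so the meaning is assembled from
the connectives and quantifiers by instance search; likewise for the formulae below. -/
instance Means.fLE (r r' : ℕ) (R R' : IS lam mu 2 → IS lam mu 2 → Prop) [Has w b r (eR2 R)]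
    [Has w b r' (eR2 R')] : Means w b (fLE r r' b) (RLE R R') := by
  unfold QuotSym.fLE RLE; infer_instance

instance Means.fEqv (r r' : ℕ) (R R' : IS lam mu 2 → IS lam mu 2 → Prop) [Has w b r (eR2 R)]
    [Has w b r' (eR2 R')] : Means w b (fEqv r r' b) (RLE R R' ∧ RLE R' R) := by
  unfold QuotSym.fEqv; infer_instance

instance Means.fWO (r : ℕ) (R : IS lam mu 2 → IS lam mu 2 → Prop) [Has w b r (eR2 R)] :
    Means w b (fWO r b) (IsWO R) := by
  unfold QuotSym.fWO IsWO; infer_instance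

instance Means.fFlag :
    Means w b (fFlag b) (∀ t : IS lam mu 2, ∃ s : IS lam mu 1, Proj1 t s) := by
  -- `Proj¹` expects its first argument in the indexed form `eI 1`, which agrees with `eE` by
  -- definition.
  have : ∀ (w : ℕ → Option (NElt κ lam mu)) (b i : ℕ) (x : IS lam mu 2) [Has w b i (eE x)],
    Has w b i (eI (0 + 1) x) := fun _ _ _ _ h => h
  unfold QuotSym.fFlag; infer_instance

variable {lt : IS lam mu 2 → IS lam mu 2 → Prop} [Has w b 1 (eR2 lt)]

instance Means.fLess (X Y : ℕ) (X' Y' : IS lam mu 2 → IS lam mu 2 → IS lam mu 2 → Prop)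
    [Has w b X (eR3 X')] [Has w b Y (eR3 Y')] : Means w b (fLess X Y b) (SLess lt X' Y') := by
  unfold QuotSym.fLess SLess; infer_instance

instance Means.fSCode (q X : ℕ) (p : IS lam mu 2) (X' : IS lam mu 2 → IS lam mu 2 → IS lam mu 2
    → Prop)
    [Has w b q (eE p)] [Has w b X (eR3 X')] : Means w b (fSCode q X b) (SCode lt p X') := by
  unfold QuotSym.fSCode SCode; infer_instance

instance Means.fUB (n X Y : ℕ) (X' : IS lam mu 2 → IS lam mu 2 → IS lam mu 2 → Prop)
    (Y' : IS lam mu (n + 1) → IS lam mu 2 → IS lam mu 2 → IS lam mu 2 → Prop)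
    [Has w b X (eR3 X')] [Has w b Y (eF n Y')] :
    Means w b (fUB n X Y b) (∀ t, ¬ SLess lt X' (Y' t)) := by
  unfold QuotSym.fUB; infer_instance

variable {A : Set (IS lam mu 2)} {q : ℕ} {p : IS lam mu 2}
  {g : IS lam mu 2 → IS lam mu 2 → IS lam mu 2 → IS lam mu 2 → IS lam mu 2 → Prop}
  [Has w b 0 (eR1 (· ∈ A))] [Has w b q (eE p)] [Has w b (q + 1) (eR5 g)]

instance Means.fInc (X : ℕ) (X' : IS lam mu 2 → IS lam mu 2 → IS lam mu 2 → Prop)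
    [Has w b X (eR3 X')] : Means w b (fInc q X b) (SInc lt A p g X') := by
  unfold QuotSym.fInc SInc; infer_instance

instance Means.fCard (X : ℕ) (X' : IS lam mu 2 → IS lam mu 2 → IS lam mu 2 → Prop)
    [Has w b X (eR3 X')] : Means w b (fCard q X b) (SCard lt A p g X') := by
  unfold QuotSym.fCard SCard; infer_instance

instance Means.fLast (a X : ℕ) (a' : IS lam mu 2)
    (X' : IS lam mu 2 → IS lam mu 2 → IS lam mu 2 → Prop) [Has w b a (eE a')]
    [Has w b X (eR3 X')] : Means w b (fLast q a X b) (SLast lt A p g a' X') := by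
  unfold QuotSym.fLast SLast; infer_instance

instance Means.fFun (n Y : ℕ)
    (Y' : IS lam mu (n + 1) → IS lam mu 2 → IS lam mu 2 → IS lam mu 2 → Prop)
    [Has w b Y (eF n Y')] : Means w b (fFun q n Y b)
      (SFun lt A p g (∀ t : IS lam mu 2, ∃ s : IS lam mu 1, Proj1 t s) Y') := by
  unfold QuotSym.fFun SFun; infer_instance

end

/-! ## Iterated conjunctions and quantifiers -/

/-- The conjunction of `ψ` and of `f j` for `j < m`. -/
def conjRange (f : ℕ → NFormula) (ψ : NFormula) : ℕ → NFormula
  | 0 => ψ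
  | m + 1 => (f m).and (conjRange f ψ m)

/-- The quantifiers `∃ x_s, …, ∃ x_{s + m - 1}`. -/
def exRange (s : ℕ) (τ : ℕ → NType) : ℕ → NFormula → NFormula
  | 0, ψ => ψ
  | m + 1, ψ => exRange s τ m (.ex (s + m) (τ m) ψ)

section
variable {κ lam mu : Cardinal.{u}} {w : ℕ → Option (NElt κ lam mu)} {b : ℕ}

theorem Means.conjRange {f : ℕ → NFormula} {ψ : NFormula} {P : ℕ → Prop} {P₀ : Prop}
    (h₀ : Means w b ψ P₀) {m : ℕ} (h : ∀ j < m, Means w b (f j) (P j)) :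
    Means w b (conjRange f ψ m) (P₀ ∧ ∀ j < m, P j) := by
  induction m with
  | zero => exact ⟨h₀.1, h₀.2.trans (by simp)⟩
  | succ m ih =>
    have := Means.and _ _ (h := h m m.lt_succ_self) (h' := ih fun j hj => h j (hj.trans
        m.lt_succ_self))
    refine ⟨this.1, this.2.trans ?_⟩
    rw [Nat.forall_lt_succ_right]
    tauto

/-- The extension of `w` by the values `d` of the variables `s, …, s + m - 1`. -/
def ext (w : ℕ → Option (NElt κ lam mu)) (s m : ℕ) (d : ℕ → NElt κ lam mu) :
    ℕ → Option (NElt κ lam mu) :=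
  fun i => if s ≤ i ∧ i < s + m then some (d (i - s)) else w i

theorem ext_of_lt {s m i : ℕ} {d : ℕ → NElt κ lam mu} (h : i < s) : ext w s m d i = w i :=
  if_neg fun h' => h.not_ge h'.1

theorem ext_add {s m j : ℕ} {d : ℕ → NElt κ lam mu} (h : j < m) :
    ext w s m d (s + j) = some (d j) := by
  rw [ext, if_pos ⟨by omega, by omega⟩, Nat.add_sub_cancel_left]

theorem ext_succ (w : ℕ → Option (NElt κ lam mu)) (s m : ℕ) (d : ℕ → NElt κ lam mu) (x) :
    ext w s (m + 1) (Function.update d m x) =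
      Function.update (ext w s m d) (s + m) (some x) := by
  funext i
  by_cases hi : i = s + m
  · subst hi
    rw [ext_add m.lt_succ_self, Function.update_self, Function.update_self]
  · rw [Function.update_of_ne hi]
    unfold ext
    by_cases h : s ≤ i ∧ i < s + m
    · rw [if_pos h, if_pos ⟨h.1, by omega⟩, Function.update_of_ne (by omega)]
    · rw [if_neg h, if_neg fun h' => h ⟨h'.1, by omega⟩]

theorem Means.exRange {s m : ℕ} {τ : ℕ → NType} {ψ : NFormula}
    [hne : ∀ j, Nonempty (NCarrier κ lam mu (τ j))] {P : (∀ j, NCarrier κ lam mu (τ j)) → Prop}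
    (h : ∀ d, Means (ext w s m fun j => ⟨τ j, d j⟩) b ψ (P d)) {b' : ℕ} :
    Means w b' (exRange s τ m ψ) (∃ d, P d) := by
  induction m generalizing ψ P b with
  | zero =>
    have e : ∀ d : ∀ j, NCarrier κ lam mu (τ j), ext w s 0 (fun j => ⟨τ j, d j⟩) = w := by
      intro d
      funext i
      exact if_neg (by omega)
    simp only [e] at h
    have d₀ : ∀ j, NCarrier κ lam mu (τ j) := fun j => (hne j).some
    exact ⟨(h d₀).1, ⟨fun hs => ⟨d₀, (h d₀).2.1 hs⟩, fun ⟨d, hd⟩ => (h d).2.2 hd⟩⟩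
  | succ m ih =>
    have key := ih (ψ := .ex (s + m) (τ m) ψ) (b := b)
      (P := fun d => ∃ x, P (Function.update d m x)) fun d =>
        Means.ex (b := b) (b' := b) (fun x => x) Function.surjective_id fun x => by
          have := h (Function.update d m x)
          rw [show (fun j => (⟨τ j, Function.update d m x j⟩ : NElt κ lam mu)) =
            Function.update (fun j => ⟨τ j, d j⟩) m ⟨τ m, x⟩ from ?_, ext_succ] at this
          · exact this
          · funext j
            by_cases hj : j = m
            · subst hj; simp
            · simp [hj]
    refine ⟨key.1, key.2.trans ⟨fun ⟨d, x, hx⟩ => ⟨_, hx⟩, fun ⟨d, hd⟩ => ⟨d, d m, ?_⟩⟩⟩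
    rwa [Function.update_eq_self]

/-- The variables `s, …, s + m - 1` have the values `e`. -/
class HasElts (w : ℕ → Option (NElt κ lam mu)) (b s m : ℕ) (e : outParam (ℕ → IS lam mu 2)) :
    Prop where
  has : ∀ j < m, Has w b (s + j) (eE (e j))

/-- The variables `s, …, s + m - 1` have the values `g`. -/
class HasRels (w : ℕ → Option (NElt κ lam mu)) (b s m : ℕ)
    (g : outParam (ℕ → IS lam mu 2 → IS lam mu 2 → IS lam mu 2 → Prop)) : Prop where
  has : ∀ j < m, Has w b (s + j) (eR3 (g j))

instance HasElts.update (s m : ℕ) (e : ℕ → IS lam mu 2) (y : NElt κ lam mu)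
    [h : HasElts w b s m e] : HasElts (Function.update w b (some y)) (b + 1) s m e :=
  ⟨fun j hj => have := h.has j hj; inferInstance⟩

instance HasRels.update (s m : ℕ) (g : ℕ → IS lam mu 2 → IS lam mu 2 → IS lam mu 2 → Prop)
    (y : NElt κ lam mu) [h : HasRels w b s m g] :
    HasRels (Function.update w b (some y)) (b + 1) s m g :=
  ⟨fun j hj => have := h.has j hj; inferInstance⟩

end

/-! ## The formulae defining the codes of the block tops -/

/-- The digit `Z i` has the order type of `<*` below the label `(x, x')`. -/
def fSegEqv (Z i x x' b : ℕ) : NFormula :=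
  secR b Z i fun r b => secSeg b x x' fun r' b => fEqv r r' b

/-- The digit of `Z` at the place `K` is given by the tag of the label `(x, x')`. -/
def fTagDigit (K e x x' Z b : ℕ) : NFormula :=
  -- From the variable `2` on come `g_0, …, g_{K-1}, g^0, …, g^{K-1}`, so the relation read here is
  -- `g^{K-1}`. The three cases are those of `tagWitness`: the positions `0` and `1` are exchanged
  -- and all others are kept.
  allN tE b fun y b => (mem3 (2 + (K + (K - 1))) x x' y).imp
    (((eqE y e).imp (fSegEqv Z (e + K) (e + 1) (e + 1) b)).and
    (((eqE y (e + 1)).imp (fSegEqv Z (e + K) e e b)).and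
    ((eqE y e).neg.imp ((eqE y (e + 1)).neg.imp (fSegEqv Z (e + K) y y b)))))

/-- The digit of `Z` at the place `j` is given by `g_j` at the label `(x, x')`. -/
def fDigit (e x x' Z b j : ℕ) : NFormula :=
  allN tE b fun y b => (mem3 (2 + j) x x' y).imp (fSegEqv Z (e + j) y y b)

/-- `Z` codes the number following that of the greatest element of the block of `(x, x')`. -/
def fBlockTop (K e x x' Z b : ℕ) : NFormula :=
  conjRange (fDigit e x x' Z b)
    ((fSCode (e + (K + 1)) Z b).and ((fTagDigit K e x x' Z b).and
      (fSegEqv Z (e + (K + 1)) x x' b))) K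

/-- The quinary relation `x_{e + K + 2}` codes the block tops. -/
def fBlockTops (K e b : ℕ) : NFormula :=
  allN tE b fun x b => allN tE b fun x' b => ((eqE x x').imp (mem1 0 x)).imp
    (secG b (e + (K + 1) + 1) x x' fun Z b => fBlockTop K e x x' Z b)

/-- `x_{e + j + 1}` is the successor of `x_{e + j}`. -/
def fSucc (e b j : ℕ) : NFormula :=
  (mem2 1 (e + j) (e + (j + 1))).and
    (allN tE b fun y _ => (mem2 1 y (e + (j + 1))).imp (mem2 1 (e + j) y).neg)

/-- `x_e, …, x_{e + K + 1}` are the first elements of `<*`. -/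
def fChain (K e b : ℕ) : NFormula :=
  conjRange (fSucc e b) (allN tE b fun y _ => (mem2 1 y e).neg) (K + 1)

section
variable {W : Type v} (lt : W → W → Prop)

/-- `e 0, …, e m` are the first elements of `lt`. -/
def IsChain0 (m : ℕ) (e : ℕ → W) : Prop :=
  (∀ y, ¬ lt y (e 0)) ∧ ∀ j < m, lt (e j) (e (j + 1)) ∧ ∀ y, lt y (e (j + 1)) → ¬ lt (e j) y

/-- `R` and `R'` embed into each other. -/
def REqv (R R' : W → W → Prop) : Prop := RLE R R' ∧ RLE R' R

/-- `Z` codes the number following that of the greatest element of the block of `(x, x')`. -/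
def IsBlockTop (K : ℕ) (e : ℕ → W) (g : ℕ → W → W → W → Prop) (x x' : W) (Z : W → W → W → Prop) :
    Prop :=
  (SCode lt (e (K + 1)) Z ∧ (∀ y, g (K + (K - 1)) x x' y →
      ((y = e 0 → REqv (Z (e K)) (segRel lt (e 1) (e 1))) ∧
      (y = e 1 → REqv (Z (e K)) (segRel lt (e 0) (e 0))) ∧
      (¬ y = e 0 → ¬ y = e 1 → REqv (Z (e K)) (segRel lt y y)))) ∧
    REqv (Z (e (K + 1))) (segRel lt x x')) ∧
  ∀ j < K, ∀ y, g j x x' y → REqv (Z (e j)) (segRel lt y y)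

end

section
variable {κ lam mu : Cardinal.{u}} {w : ℕ → Option (NElt κ lam mu)} {b : ℕ}
  {lt : IS lam mu 2 → IS lam mu 2 → Prop} [Has w b 1 (eR2 lt)]

instance Means.fSegEqv (Z i x x' : ℕ) (Z' : IS lam mu 2 → IS lam mu 2 → IS lam mu 2 → Prop)
    (i' y y' : IS lam mu 2) [Has w b Z (eR3 Z')] [Has w b i (eE i')] [Has w b x (eE y)]
    [Has w b x' (eE y')] : Means w b (fSegEqv Z i x x' b) (REqv (Z' i') (segRel lt y y')) := by
  unfold QuotSym.fSegEqv REqv; infer_instance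

theorem Means.fChain {K s : ℕ} {e : ℕ → IS lam mu 2} [he : HasElts w b s (K + 2) e] :
    Means w b (fChain K s b) (IsChain0 lt (K + 1) e) := by
  have := he.has 0 (by omega)
  rw [Nat.add_zero] at this
  refine Means.conjRange inferInstance fun j hj => ?_
  have := he.has j (by omega)
  have := he.has (j + 1) (by omega)
  unfold fSucc
  infer_instance

instance Means.fBlockTop (K s x x' Z : ℕ) (e : ℕ → IS lam mu 2)
    (g : ℕ → IS lam mu 2 → IS lam mu 2 → IS lam mu 2 → Prop) (y y' : IS lam mu 2)
    (Z' : IS lam mu 2 → IS lam mu 2 → IS lam mu 2 → Prop) [hK : NeZero K]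
    [he : HasElts w b s (K + 2) e] [hg : HasRels w b 2 (K + K) g] [Has w b x (eE y)]
    [Has w b x' (eE y')] [Has w b Z (eR3 Z')] :
    Means w b (fBlockTop K s x x' Z b) (IsBlockTop lt K e g y y' Z') := by
  have hK := Nat.pos_of_ne_zero (NeZero.ne K)
  refine Means.conjRange ?_ fun j hj => ?_
  · have := he.has 0 (by omega)
    rw [Nat.add_zero] at this
    have := he.has 1 (by omega)
    have := he.has K (by omega)
    have := he.has (K + 1) (by omega)
    have := hg.has (K + (K - 1)) (by omega)
    unfold fTagDigit
    infer_instance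
  · have := he.has j (by omega)
    have := hg.has j (by omega)
    unfold fDigit
    infer_instance

theorem Means.fBlockTops {K s : ℕ} {e : ℕ → IS lam mu 2}
    {g : ℕ → IS lam mu 2 → IS lam mu 2 → IS lam mu 2 → Prop} {A : Set (IS lam mu 2)}
    {G : IS lam mu 2 → IS lam mu 2 → IS lam mu 2 → IS lam mu 2 → IS lam mu 2 → Prop} [NeZero K]
    [Has w b 0 (eR1 (· ∈ A))] [HasElts w b s (K + 2) e] [HasRels w b 2 (K + K) g]
    [Has w b (s + (K + 1) + 1) (eR5 G)] :
    Means w b (fBlockTops K s b) (∀ x x', (x = x' → x ∈ A) → IsBlockTop lt K e g x x' (G x x'))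
        := by
  unfold QuotSym.fBlockTops
  infer_instance

end

section
variable {W : Type v} {lt : W → W → Prop} [IsWellOrder W lt]

/-- Nothing precedes `e 0` and nothing lies between `e j` and `e (j + 1)`, so positions increase by
one. This makes the finite places definable. -/
theorem isChain0_iff {m : ℕ} {e : ℕ → W} :
    IsChain0 lt m e ↔ ∀ j ≤ m, typein lt (e j) = j := by
  constructor
  · rintro ⟨h0, h⟩ j hj
    induction j with
    | zero =>
      rw [Nat.cast_zero, ← nonpos_iff_eq_zero]
      refine le_of_forall_lt fun c hc => ?_
      obtain ⟨y, rfl⟩ := typein_surj lt (hc.trans (typein_lt_type lt _))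
      exact absurd ((typein_lt_typein lt).1 hc) (h0 y)
    | succ j ih =>
      obtain ⟨h1, h2⟩ := h j hj
      rw [Nat.cast_succ, ← ih (by omega)]
      refine le_antisymm ?_ (Order.add_one_le_iff.2 ((typein_lt_typein lt).2 h1))
      refine le_of_forall_lt fun c hc => ?_
      obtain ⟨y, rfl⟩ := typein_surj lt (hc.trans (typein_lt_type lt _))
      rw [Order.lt_add_one_iff, ← not_lt, typein_lt_typein]
      exact h2 y ((typein_lt_typein lt).1 hc)
  · intro h
    refine ⟨fun y hy => ?_, fun j hj => ⟨?_, fun y hy => ?_⟩⟩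
    · rw [← typein_lt_typein lt, h 0 (Nat.zero_le _)] at hy
      simp at hy
    · rw [← typein_lt_typein lt, h j hj.le, h (j + 1) hj]
      exact_mod_cast j.lt_succ_self
    · rw [← typein_lt_typein lt, h (j + 1) hj, Nat.cast_succ, Order.lt_add_one_iff] at hy
      rw [← typein_lt_typein lt, h j hj.le, not_lt]
      exact hy

theorem coeffLow_ext {N : ℕ} {ρ ρ' : Ordinal.{v}} (h : ρ < Om ^ N) (h' : ρ' < Om ^ N)
    (he : ∀ n < N, coeffLow ρ n = coeffLow ρ' n) : ρ = ρ' := by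
  refine le_antisymm (not_lt.1 fun hlt => ?_) (not_lt.1 fun hlt => ?_)
  · obtain ⟨n, hn, h1, -⟩ := (lt_iff_exists_coeffLow h' h).1 hlt
    exact h1.ne' (he n hn)
  · obtain ⟨n, hn, h1, -⟩ := (lt_iff_exists_coeffLow h h').1 hlt
    exact h1.ne (he n hn)

/-- Below `Ω ^ (N + 1)` an ordinal is determined by its digits up to the place `N`, and `SCode`
takes care of all further places. -/
theorem codes_iff_digits (hW : #W = 𝔠) {N : ℕ} {e : ℕ → W} (he : ∀ j ≤ N, typein lt (e j) = j)
    {X : W → W → W → Prop} {ρ : Ordinal.{v}} (hρ : ρ < Om ^ (N + 1)) :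
    Codes lt X ρ ↔ SCode lt (e N) X ∧ ∀ n ≤ N, otp (X (e n)) = coeffLow ρ n := by
  rw [sCode_iff hW (he N le_rfl)]
  constructor
  · exact fun h => ⟨⟨ρ, hρ, h⟩, fun n hn => (h (e n)).2.1 n (he n hn)⟩
  · rintro ⟨⟨ρ', hρ', hX⟩, h⟩
    rwa [coeffLow_ext hρ hρ' fun n hn => ?_]
    rw [← h n (by omega), (hX (e n)).2.1 n (he n (by omega))]

namespace Blocks
variable {k : ℕ} {A : Set W} {O : Option A → Ordinal.{v}} (H : Blocks lt k O)
include H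

omit [IsWellOrder W lt] H in
-- A block has the canonical length of its gap, so after adding `1` to both, without carry, the
-- digits below `k + 1` agree. The digit at `k + 1` is the witness of the cofinality tag, which is
-- unaffected by the `1`.
theorem coeffLow_blockLen (l : Option A) :
    (∀ j < k + 1, coeffLow (blockLen k O l + 1) j = coeffLow (gap (range O) (O l) + 1) j) ∧
    coeffLow (blockLen k O l + 1) (k + 1) =
      tagWitness (coeffUp (gap (range O) (O l) + 1) k) := by
  set γ := gap (range O) (O l) with hγ
  obtain ⟨h1, h2⟩ := Om_pow_add_one_mod k γ
  have hr : (γ + 1) % Om ^ (k + 1) < Om ^ (k + 1) := mod_lt _ (Om_pow_ne_zero _)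
  have ht : tagWitness (coeffUp γ k) < Om := by
    rw [coeffUp_eq]; exact tagWitness_lt (cofTag_lt_Om _)
  have e : blockLen k O l + 1 = Om ^ (k + 1) * tagWitness (coeffUp γ k) + (γ + 1) % Om ^ (k + 1)
      := by
    rw [blockLen, ← hγ, canonicalGap, h1, add_assoc]
  constructor
  · intro j hj
    rw [e, coeffLow_mul_add hj, coeffLow_mod hj]
  · rw [e, coeffLow_mul_add_self ht hr, coeffUp_eq (γ + 1), h2, ← coeffUp_eq]

/-- The data of a representation are exactly the digits of the block tops: `g_0, …, g_k` give the
places up to `k`, `g^k` gives the place `k + 1` through `tagWitness`, and the label gives the place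
`k + 2`. -/
theorem isBlockTop_iff {e : ℕ → W} {g : ℕ → W → W → W → Prop} {γ : ℕ → Option A → W}
    (he : ∀ j ≤ k + 2, typein lt (e j) = j)
    (hg : ∀ j < (k + 1) + (k + 1), ∀ x x' l, IsLabel x x' l → ∀ y, g j x x' y ↔ y = γ j l)
    (hlow : ∀ j < k + 1, ∀ l, typein lt (γ j l) = coeffLow (gap (range O) (O l) + 1) j)
    (hup : ∀ l, typein lt (γ (k + 1 + k) l) = coeffUp (gap (range O) (O l) + 1) k)
    {x x' : W} {l : Option A} (hl : IsLabel x x' l) {Z : W → W → W → Prop} :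
    IsBlockTop lt (k + 1) e g x x' Z ↔ Codes lt Z (blockNum lt k l (blockLen k O l + 1)) := by
  have hlen := (isSuccLimit_Om_pow _).add_one_lt (Blocks.blockLen_lt (k := k) (O := O) l)
  rw [codes_iff_digits H.mk_eq he (H.blockNum_lt l hlen), IsBlockTop, and_assoc]
  refine and_congr_right fun hZ => ?_
  have hwo : ∀ i, IsWO (Z i) := fun i => (hZ i).1
  have hseg : ∀ i y, REqv (Z i) (segRel lt y y) ↔ otp (Z i) = typein lt y := by
    intro i y
    obtain ⟨h1, h2⟩ := isWO_segRel_self lt y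
    rw [REqv, ← otp_eq_iff (hwo i) h1, h2]
  have htop : REqv (Z (e (k + 1 + 1))) (segRel lt x x') ↔
      otp (Z (e (k + 1 + 1))) = labelPos lt l := by
    obtain ⟨h1, h2⟩ := isLabel_segRel (lt := lt) hl
    rw [REqv, ← otp_eq_iff (hwo _) h1, h2]
  obtain ⟨c1, c2⟩ := coeffLow_blockLen (k := k) (O := O) l
  have d1 : ∀ j < k + 1, coeffLow (blockNum lt k l (blockLen k O l + 1)) j =
      typein lt (γ j l) := fun j hj => by
    rw [blockNum, coeffLow_mul_add (by omega), c1 j hj, hlow j hj]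
  have d2 : coeffLow (blockNum lt k l (blockLen k O l + 1)) (k + 1) =
      tagWitness (typein lt (γ (k + 1 + k) l)) := by
    rw [blockNum, coeffLow_mul_add (by omega), c2, hup]
  have d3 : coeffLow (blockNum lt k l (blockLen k O l + 1)) (k + 1 + 1) = labelPos lt l := by
    rw [blockNum, coeffLow_mul_add_self (H.labelPos_lt l) hlen]
  have hE : ∀ y n, n ≤ k + 2 → (y = e n ↔ typein lt y = n) := fun y n hn => by
    rw [← he n hn, (typein_injective lt).eq_iff]
  have tag : ∀ y, ((y = e 0 → REqv (Z (e (k + 1))) (segRel lt (e 1) (e 1))) ∧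
      (y = e 1 → REqv (Z (e (k + 1))) (segRel lt (e 0) (e 0))) ∧
      (¬ y = e 0 → ¬ y = e 1 → REqv (Z (e (k + 1))) (segRel lt y y))) ↔
      otp (Z (e (k + 1))) = tagWitness (typein lt y) := by
    intro y
    rw [hseg, hseg, hseg, hE y 0 (by omega), hE y 1 (by omega), he 0 (by omega), he 1 (by omega),
      tagWitness]
    by_cases h0 : typein lt y = 0
    · simp [h0]
    · by_cases h1 : typein lt y = 1
      · simp [h1]
      · simp [h0, h1]
  -- At a label each relation `g j` has a single value, so the universal quantifier over `y` can be
  -- instantiated.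
  simp only [Nat.add_sub_cancel, hg _ (show k + 1 + k < _ by omega) x x' l hl, forall_eq, htop]
  rw [tag]
  simp only [hseg]
  constructor
  · rintro ⟨⟨h1, h2⟩, h3⟩ n hn
    rcases Nat.lt_or_ge n (k + 1) with h | h
    · rw [d1 n h]
      exact h3 n h _ ((hg n (by omega) x x' l hl _).2 rfl)
    · obtain rfl | rfl : n = k + 1 ∨ n = k + 1 + 1 := by omega
      · rw [d2, h1]
      · rw [d3, h2]
  · intro h
    refine ⟨⟨by rw [h _ (by omega), d2], by rw [h _ (by omega), d3]⟩, fun j hj y hy => ?_⟩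
    rw [(hg j (by omega) x x' l hl y).1 hy, h j (by omega), d1 j hj]

end Blocks
end

/-! ## The collapsed structure of a representation -/

section
variable {κ lam mu : Cardinal.{u}} {K : ℕ}

/-- `θ` as a function to `Card⁻ ∪ {lam}`. -/
def RepBase.point (B : RepBase κ lam mu K) (l : Option B.A) : ↥(insert lam (cardMinus κ lam)) :=
  l.elim ⟨lam, Or.inl rfl⟩ fun a => ⟨B.θ a, Or.inr (B.θ a).2⟩

/-- The ranks of the values of `θ`. -/
noncomputable def RepBase.rank (B : RepBase κ lam mu K) (l : Option B.A) : Ordinal.{u + 1} :=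
  cardRank κ lam (B.point l)

theorem RepBase.coe_point (B : RepBase κ lam mu K) (l : Option B.A) :
    (B.point l : Cardinal.{u}) = l.elim lam fun a => (B.θ a : Cardinal.{u}) := by
  cases l <;> rfl

/-- The map `θ` is strictly increasing on a well-ordered set, hence reflects the order too; the
label `∞` has the greatest position, just as `lam` exceeds all of `Card⁻`. -/
theorem RepBase.blocks (B : RepBase κ lam mu K) (k : ℕ) :
    letI := B.isWellOrder
    Blocks B.lt k B.rank := by
  let := B.isWellOrder
  refine ⟨mk_IS_two lam mu, ?_⟩
  have hlt : ∀ a : B.A, B.point (some a) < B.point none := fun a => (B.θ a).2.1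
  rintro (_ | a) (_ | b) <;> unfold RepBase.rank <;> rw [cardRank_lt_cardRank]
  · exact iff_of_false (lt_irrefl _) (lt_irrefl _)
  · exact iff_of_false (hlt b).not_gt (typein_lt_type _ _).not_gt
  · exact iff_of_true (hlt a) (typein_lt_type _ _)
  · change B.θ a < B.θ b ↔ typein B.lt a.1 < typein B.lt b.1
    rw [typein_lt_typein]
    refine ⟨fun h => ?_, B.θ_lt a b⟩
    rcases trichotomous_of B.lt a.1 b.1 with h' | h' | h'
    · exact h'
    · rw [Subtype.ext h'] at h
      exact absurd h (lt_irrefl _)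
    · exact absurd (B.θ_lt _ _ h') h.not_gt

/-- The point `lam` is never strictly below a value of `θ` or `lam`, so adding it to the range of
`θ` changes no gap. -/
theorem RepBase.gamma_eq (B : RepBase κ lam mu K) (l : Option B.A) :
    gamma κ lam (l.elim lam fun a => (B.θ a : Cardinal.{u}))
      (Set.range fun a => (B.θ a : Cardinal.{u})) = gap (range B.rank) (B.rank l) + 1 := by
  rw [← B.coe_point, QuotSym.gamma_eq (S' := range B.point) (B.point l)]
  · rw [← range_comp]; rfl
  · rintro _ ⟨a, rfl⟩
    exact (B.θ a).2
  · intro y hy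
    constructor
    · rintro ⟨_ | a, rfl⟩
      · refine absurd hy (not_lt.2 ?_)
        cases l with
        | none => exact le_rfl
        | some a => exact le_of_lt (B.θ a).2.1
      · exact ⟨a, rfl⟩
    · rintro ⟨a, ha⟩
      exact ⟨some a, Subtype.ext ha⟩

end

/-! ## The translation -/

/-- The kind of the codes of the elements of a sort of `M*`. -/
def MSort.codeType : MSort → NType
  | .is n => .elt (.is n)
  | .card => tR3
  | .f n => tF n

/-- The index of a variable. -/
def MTerm.index : MTerm → ℕ
  | .var i => i
  | .app n i j => Nat.pair n (Nat.pair i j)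

/-- A mere renaming of `X` to a fresh variable, so that variables and values `App(x_i, x_j)` are
treated alike in `fTerm`. -/
def secV (b X : ℕ) (f : ℕ → ℕ → NFormula) : NFormula :=
  exN tR3 b fun r b => (allN tE b fun i b => allN tE b fun s b => allN tE b fun t _ =>
    (mem3 r i s t).iff (mem3 X i s t)).and (f r b)

/-- `f` holds for the code of the value of a term of the sort `Card⁻`. -/
def fTerm (q b : ℕ) (f : ℕ → ℕ → NFormula) : MTerm → NFormula
  | .var i => secV b (q + 2 + i) f
  | .app n i j => secF b n (q + 2 + i) (q + 2 + j) f

/-- `X` and `Y` code the same ordinal. -/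
def fSame (X Y b : ℕ) : NFormula := (fLess X Y b).neg.and (fLess Y X b).neg

/-- The translation of the equation `T = T'` between terms of a given sort. -/
def fEq (q b : ℕ) (T T' : MTerm) : MSort → NFormula
  | .is n => .eq (.is n) (q + 2 + T.index) (q + 2 + T'.index)
  | .card => fTerm q b (fun X b => fTerm q b (fun Y b => fSame X Y b) T') T
  | .f n => allN (.elt (.is n)) b fun t b => secF b n (q + 2 + T.index) t fun X b =>
      secF b n (q + 2 + T'.index) t fun Y b => fSame X Y b

/-- The quantifier over the codes of the elements of a given sort of `M*`. -/
def fEx (q b i : ℕ) (ψ : NFormula) : MSort → NFormula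
  | .is n => .ex (q + 2 + i) (.elt (.is n)) ψ
  | .card => .ex (q + 2 + i) tR3 ((fCard q (q + 2 + i) b).and ψ)
  | .f n => .ex (q + 2 + i) (tF n) ((fFun q n (q + 2 + i) b).and ψ)

/-- The translation of a formula; the value of `x_i` is coded by the value of `x_{q + 2 + i}`, and
the variables from `x_b` on are fresh. -/
def MFormula.tr (q b : ℕ) : MFormula → NFormula
  | .eq s T T' => fEq q b T T' s
  | .lt T T' => fTerm q b (fun X b => fTerm q b (fun Y b => fLess X Y b) T') T
  | .eq1 i => .eq1 (q + 2 + i)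
  | .prod1 i => .prod1 (q + 2 + i)
  | .proj1 n i j => .proj1 n (q + 2 + i) (q + 2 + j)
  | .neg φ => (φ.tr q b).neg
  | .and φ φ' => (φ.tr q b).and (φ'.tr q b)
  | .ex i s φ => fEx q b i (φ.tr q b) s

section
variable {κ lam mu : Cardinal.{u}} {w : ℕ → Option (NElt κ lam mu)} {b : ℕ}
  {f : ℕ → ℕ → NFormula}

theorem Has.mono {i b' : ℕ} {x : NElt κ lam mu} (h : Has w b i x) (hb : b ≤ b') : Has w b' i x :=
  ⟨h.lt.trans_le hb, h.eq⟩

theorem Has.update_of_ne {i j : ℕ} {x y : NElt κ lam mu} (h : Has w b i x) (hij : i ≠ j) :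
    Has (Function.update w j (some y)) b i x :=
  ⟨h.lt, by rw [Function.update_of_ne hij, h.eq]⟩

theorem Has.update_self {j : ℕ} {y : NElt κ lam mu} (h : j < b) :
    Has (Function.update w j (some y)) b j y :=
  ⟨h, Function.update_self _ _ _⟩

instance Means.secV (X : ℕ) (X' : IS lam mu 2 → IS lam mu 2 → IS lam mu 2 → Prop)
    [Has w b X (eR3 X')] (Q : (IS lam mu 2 → IS lam mu 2 → IS lam mu 2 → Prop) → Prop)
    [∀ R, Means (Function.update w b (some (eR3 R))) (b + 1) (f b (b + 1)) (Q R)] :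
    Means w b (secV b X f) (Q X') := by
  have : Means w b (QuotSym.secV b X f) (∃ R, (∀ i s t, R i s t ↔ X' i s t) ∧ Q R) := by
    unfold QuotSym.secV; infer_instance
  refine ⟨this.1, this.2.trans ⟨?_, fun h => ⟨_, fun _ _ _ => Iff.rfl, h⟩⟩⟩
  rintro ⟨R, h, hQ⟩
  rwa [show X' = R from funext fun i => funext fun s => funext fun t => propext (h i s t).symm]

/-- The value of the term `T` is coded by `X`. -/
def IsTermValue (w : ℕ → Option (NElt κ lam mu)) (q b : ℕ)
    (X : IS lam mu 2 → IS lam mu 2 → IS lam mu 2 → Prop) : MTerm → Prop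
  | .var i => Has w b (q + 2 + i) (eR3 X)
  | .app n i j => ∃ Y t, Has w b (q + 2 + i) (eF n Y) ∧ Has w b (q + 2 + j) (eI n t) ∧ X = Y t

/-- The value of the term `T` is coded by `X`, as a type class. -/
class HasTerm (w : ℕ → Option (NElt κ lam mu)) (q b : ℕ) (T : MTerm)
    (X : outParam (IS lam mu 2 → IS lam mu 2 → IS lam mu 2 → Prop)) : Prop where
  isTermValue : IsTermValue w q b X T

instance HasTerm.update (q : ℕ) (T : MTerm) (X : IS lam mu 2 → IS lam mu 2 → IS lam mu 2 → Prop)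
    (y : NElt κ lam mu) [h : HasTerm w q b T X] :
    HasTerm (Function.update w b (some y)) q (b + 1) T X := by
  obtain ⟨h⟩ := h
  constructor
  cases T with
  | var i =>
    have : Has w b (q + 2 + i) (eR3 X) := h
    exact Has.update _ _ _ _ _
  | app n i j =>
    obtain ⟨Y, t, h1, h2, rfl⟩ := h
    exact ⟨Y, t, inferInstance, inferInstance, rfl⟩

instance Means.fTerm (q : ℕ) (T : MTerm) (X : IS lam mu 2 → IS lam mu 2 → IS lam mu 2 → Prop)
    [h : HasTerm w q b T X] (Q : (IS lam mu 2 → IS lam mu 2 → IS lam mu 2 → Prop) → Prop)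
    [∀ R, Means (Function.update w b (some (eR3 R))) (b + 1) (f b (b + 1)) (Q R)] :
    Means w b (fTerm q b f T) (Q X) := by
  obtain ⟨h⟩ := h
  cases T with
  | var i =>
    have : Has w b (q + 2 + i) (eR3 X) := h
    exact Means.secV _ _ _
  | app n i j =>
    obtain ⟨Y, t, h1, h2, rfl⟩ := h
    exact Means.secF n _ _ Y t Q

variable {lt : IS lam mu 2 → IS lam mu 2 → Prop} [Has w b 1 (eR2 lt)]

instance Means.fSame (X Y : ℕ) (X' Y' : IS lam mu 2 → IS lam mu 2 → IS lam mu 2 → Prop)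
    [Has w b X (eR3 X')] [Has w b Y (eR3 Y')] :
    Means w b (fSame X Y b) (¬ SLess lt X' Y' ∧ ¬ SLess lt Y' X') := by
  unfold QuotSym.fSame; infer_instance

/-- Equality cannot be translated by equality of codes: isomorphic digits may be different
relations. Hence two codes count as equal when neither is less. -/
theorem Means.fEq_card {q : ℕ} {T T' : MTerm}
    {X X' : IS lam mu 2 → IS lam mu 2 → IS lam mu 2 → Prop} [HasTerm w q b T X]
    [HasTerm w q b T' X'] : Means w b (fEq q b T T' .card) (¬ SLess lt X X' ∧ ¬ SLess lt X' X) := by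
  unfold fEq; infer_instance

theorem Means.fEq_f {q n i j : ℕ}
    {Y Y' : IS lam mu (n + 1) → IS lam mu 2 → IS lam mu 2 → IS lam mu 2 → Prop}
    [Has w b (q + 2 + i) (eF n Y)] [Has w b (q + 2 + j) (eF n Y')] :
    Means w b (fEq q b (.var i) (.var j) (.f n))
      (∀ t, ¬ SLess lt (Y t) (Y' t) ∧ ¬ SLess lt (Y' t) (Y t)) := by
  unfold fEq MTerm.index; infer_instance

theorem Means.tr_lt {q : ℕ} {T T' : MTerm}
    {X X' : IS lam mu 2 → IS lam mu 2 → IS lam mu 2 → Prop} [HasTerm w q b T X]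
    [HasTerm w q b T' X'] : Means w b ((MFormula.lt T T').tr q b) (SLess lt X X') := by
  unfold MFormula.tr; infer_instance

end

section
variable {κ lam mu : Cardinal.{u}}

/-- The values of the variables `0`, `1`, `q`, `q + 1`. -/
structure Frame (q : ℕ) (A : Set (IS lam mu 2)) (lt : IS lam mu 2 → IS lam mu 2 → Prop)
    (p : IS lam mu 2)
    (g : IS lam mu 2 → IS lam mu 2 → IS lam mu 2 → IS lam mu 2 → IS lam mu 2 → Prop)
    (w : ℕ → Option (NElt κ lam mu)) : Prop where
  has_A : Has w (q + 2) 0 (eR1 (· ∈ A))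
  has_lt : Has w (q + 2) 1 (eR2 lt)
  has_p : Has w (q + 2) q (eE p)
  has_g : Has w (q + 2) (q + 1) (eR5 g)

variable {q M : ℕ} {A : Set (IS lam mu 2)} {lt : IS lam mu 2 → IS lam mu 2 → Prop}
  {p : IS lam mu 2} {g : IS lam mu 2 → IS lam mu 2 → IS lam mu 2 → IS lam mu 2 → IS lam mu 2 → Prop}
  {w : ℕ → Option (NElt κ lam mu)}

theorem Frame.update (h : Frame q A lt p g w) (i : ℕ) (y : NElt κ lam mu) :
    Frame q A lt p g (Function.update w (q + 2 + i) (some y)) := by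
  obtain ⟨h1, h2, h3, h4⟩ := h
  exact ⟨h1.update_of_ne (by have := h1.lt; omega), h2.update_of_ne (by have := h2.lt; omega),
    h3.update_of_ne (by omega), h4.update_of_ne (by omega)⟩

theorem exists_eq_eI {n : ℕ} (y : NElt κ lam mu) (h : y.1 = .elt (.is n)) : ∃ t, y = eI n t := by
  obtain ⟨τ, y⟩ := y
  subst h
  exact ⟨y, rfl⟩

theorem exists_eq_eR3 (y : NElt κ lam mu) (h : y.1 = tR3) : ∃ X, y = eR3 X := by
  obtain ⟨τ, y⟩ := y
  subst h
  obtain ⟨X, rfl⟩ := surj_R3 y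
  exact ⟨X, rfl⟩

theorem exists_eq_eF {n : ℕ} (y : NElt κ lam mu) (h : y.1 = tF n) : ∃ Y, y = eF n Y := by
  obtain ⟨τ, y⟩ := y
  subst h
  obtain ⟨X, rfl⟩ := surj_F n y
  exact ⟨X, rfl⟩

theorem exists_hasTerm {b : ℕ} {Γ : ℕ → Option MSort} {T : MTerm} (hT : T.HasSort Γ .card)
    (hΓ : ∀ i s, Γ i = some s → ∃ y, Has w b (q + 2 + i) y ∧ y.1 = s.codeType) :
    ∃ X, HasTerm w q b T X := by
  cases T with
  | var i =>
    obtain ⟨y, hy, ht⟩ := hΓ i _ hT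
    obtain ⟨X, rfl⟩ := exists_eq_eR3 y ht
    exact ⟨X, ⟨hy⟩⟩
  | app n i j =>
    obtain ⟨hi, hj, -⟩ := hT
    obtain ⟨y, hy, ht⟩ := hΓ i _ hi
    obtain ⟨Y, rfl⟩ := exists_eq_eF y ht
    obtain ⟨z, hz, ht⟩ := hΓ j _ hj
    obtain ⟨t, rfl⟩ := exists_eq_eI z ht
    exact ⟨_, ⟨Y, t, hy, hz, rfl⟩⟩

theorem left_lt_of_pair_lt {a b M : ℕ} (h : Nat.pair a b < M) : a < M :=
  (Nat.left_le_pair a b).trans_lt h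

theorem right_lt_of_pair_lt {a b M : ℕ} (h : Nat.pair a b < M) : b < M :=
  (Nat.right_le_pair a b).trans_lt h

/-- Well-sortedness depends only on the kinds of the values, so it is read off from `Means` at
assignments with arbitrary values of those kinds. -/
theorem MFormula.wellSorted_tr {φ : MFormula} {Γ : ℕ → Option MSort} (hφ : φ.WellSorted Γ)
    (hc : φ.code < M) (hF : Frame q A lt p g w)
    (hΓ : ∀ i s, Γ i = some s → ∃ y, Has w (q + 2 + M) (q + 2 + i) y ∧ y.1 = s.codeType) :
    (φ.tr q (q + 2 + M)).WellSorted (typesOf w) := by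
  induction φ generalizing Γ w with
  | eq s T T' =>
    have := hF.has_lt.mono (Nat.le_add_right _ M)
    cases s with
    | is n =>
      obtain ⟨h1, h2⟩ := hφ
      cases T with
      | app => cases h1.2.2
      | var i =>
        cases T' with
        | app => cases h2.2.2
        | var j =>
          obtain ⟨y, hy, ht⟩ := hΓ i _ h1
          obtain ⟨z, hz, ht'⟩ := hΓ j _ h2
          exact ⟨hy.type_eq.trans (congrArg some ht), hz.type_eq.trans (congrArg some ht')⟩
    | card =>
      obtain ⟨X, hX⟩ := exists_hasTerm hφ.1 hΓ
      obtain ⟨X', hX'⟩ := exists_hasTerm hφ.2 hΓ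
      exact Means.fEq_card.1
    | f n =>
      obtain ⟨h1, h2⟩ := hφ
      cases T with
      | app => cases h1.2.2
      | var i =>
        cases T' with
        | app => cases h2.2.2
        | var j =>
          obtain ⟨y, hy, ht⟩ := hΓ i _ h1
          obtain ⟨z, hz, ht'⟩ := hΓ j _ h2
          obtain ⟨Y, rfl⟩ := exists_eq_eF y ht
          obtain ⟨Z, rfl⟩ := exists_eq_eF z ht'
          exact Means.fEq_f.1
  | lt T T' =>
    have := hF.has_lt.mono (Nat.le_add_right _ M)
    obtain ⟨X, hX⟩ := exists_hasTerm hφ.1 hΓ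
    obtain ⟨X', hX'⟩ := exists_hasTerm hφ.2 hΓ
    exact Means.tr_lt.1
  | eq1 i =>
    obtain ⟨y, hy, ht⟩ := hΓ i _ hφ
    exact hy.type_eq.trans (congrArg some ht)
  | prod1 i =>
    obtain ⟨y, hy, ht⟩ := hΓ i _ hφ
    exact hy.type_eq.trans (congrArg some ht)
  | proj1 n i j =>
    obtain ⟨y, hy, ht⟩ := hΓ i _ hφ.1
    obtain ⟨z, hz, ht'⟩ := hΓ j _ hφ.2
    exact ⟨hy.type_eq.trans (congrArg some ht), hz.type_eq.trans (congrArg some ht')⟩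
  | neg φ ih => exact ih hφ (right_lt_of_pair_lt hc) hF hΓ
  | and φ φ' ih ih' =>
    have hc := right_lt_of_pair_lt hc
    exact ⟨ih hφ.1 (left_lt_of_pair_lt hc) hF hΓ, ih' hφ.2 (right_lt_of_pair_lt hc) hF hΓ⟩
  | ex i s φ ih =>
    -- The index of a quantified variable is at most the Gödel number of the formula, so the
    -- variables from `q + 2 + M` on stay fresh.
    have hi : i < M := left_lt_of_pair_lt (right_lt_of_pair_lt hc)
    have hc' := right_lt_of_pair_lt (right_lt_of_pair_lt (right_lt_of_pair_lt hc))
    have hΓ' : ∀ z : NElt κ lam mu, z.1 = s.codeType → ∀ j s',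
        Function.update Γ i (some s) j = some s' →
        ∃ y, Has (Function.update w (q + 2 + i) (some z)) (q + 2 + M) (q + 2 + j) y ∧
          y.1 = s'.codeType := by
      intro z hz j s' h
      by_cases hj : j = i
      · subst hj
        rw [Function.update_self] at h
        cases h
        exact ⟨z, Has.update_self (by omega), hz⟩
      · rw [Function.update_of_ne hj] at h
        obtain ⟨y, hy, ht⟩ := hΓ j s' h
        exact ⟨y, hy.update_of_ne (by omega), ht⟩
    have key := fun z hz => ih (w := Function.update w (q + 2 + i) (some z)) hφ hc'
      (hF.update i z) (hΓ' z hz)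
    cases s with
    | is n =>
      have := key (eI n (Classical.arbitrary _)) rfl
      rwa [typesOf_update] at this
    | card =>
      have h1 := key (eR3 fun _ _ _ => True) rfl
      have hF' := hF.update i (eR3 fun _ _ _ => True)
      have := hF'.has_A.mono (Nat.le_add_right _ M)
      have := hF'.has_lt.mono (Nat.le_add_right _ M)
      have := hF'.has_p.mono (Nat.le_add_right _ M)
      have := hF'.has_g.mono (Nat.le_add_right _ M)
      have : Has (Function.update w (q + 2 + i) (some (eR3 fun _ _ _ => True))) (q + 2 + M)
        (q + 2 + i) (eR3 fun _ _ _ => True) := Has.update_self (by omega)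
      have h2 := (Means.fCard (w := Function.update w (q + 2 + i) (some (eR3 fun _ _ _ => True)))
        (b := q + 2 + M) (q := q) (q + 2 + i) fun _ _ _ => True).1
      rw [typesOf_update] at h1 h2
      exact ⟨h2, h1⟩
    | f n =>
      have h1 := key (eF n fun _ _ _ _ => True) rfl
      have hF' := hF.update i (eF n fun _ _ _ _ => True)
      have := hF'.has_A.mono (Nat.le_add_right _ M)
      have := hF'.has_lt.mono (Nat.le_add_right _ M)
      have := hF'.has_p.mono (Nat.le_add_right _ M)
      have := hF'.has_g.mono (Nat.le_add_right _ M)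
      have : Has (Function.update w (q + 2 + i) (some (eF n fun _ _ _ _ => True))) (q + 2 + M)
        (q + 2 + i) (eF n fun _ _ _ _ => True) := Has.update_self (by omega)
      have h2 := (Means.fFun (w := Function.update w (q + 2 + i) (some (eF n fun _ _ _ _ => True)))
        (b := q + 2 + M) (q := q) n (q + 2 + i) fun _ _ _ _ => True).1
      rw [typesOf_update] at h1 h2
      exact ⟨h2, h1⟩

end

/-! ## The translation preserves truth -/

theorem exists_of_typesOf {ι : Type*} {C : ι → Type*} {w : ℕ → Option (Sigma C)} {i : ℕ} {s : ι}
    (h : typesOf w i = some s) : ∃ x : C s, w i = some ⟨s, x⟩ := by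
  obtain ⟨⟨s', x⟩, hx, rfl⟩ := Option.map_eq_some_iff.1 h
  exact ⟨x, hx⟩

/-- Twice the quantifier rank. -/
def MFormula.rank : MFormula → ℕ
  | .eq _ _ _ | .lt _ _ | .eq1 _ | .prod1 _ | .proj1 _ _ _ => 0
  | .neg φ => φ.rank
  | .and φ φ' => max φ.rank φ'.rank
  | .ex _ _ φ => φ.rank + 2

theorem MFormula.rank_le_code (φ : MFormula) : φ.rank ≤ φ.code := by
  induction φ with
  | neg φ ih => exact ih.trans (Nat.right_le_pair _ _)
  | and φ φ' ih ih' =>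
    exact (max_le (ih.trans (Nat.left_le_pair _ _)) (ih'.trans (Nat.right_le_pair _ _))).trans
      (Nat.right_le_pair _ _)
  | ex i s φ ih =>
    -- The tag `7` pays for the `2` which a quantifier adds to the rank.
    have h1 := Nat.add_le_pair 7 (Nat.pair i (Nat.pair s.code φ.code))
    have h2 := Nat.right_le_pair i (Nat.pair s.code φ.code)
    have h3 := Nat.right_le_pair s.code φ.code
    simp only [MFormula.rank, MFormula.code]
    omega
  | _ => exact Nat.zero_le _

section
variable {κ lam mu : Cardinal.{u}} {lt : IS lam mu 2 → IS lam mu 2 → Prop}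
  [IsWellOrder (IS lam mu 2) lt] {k : ℕ} {A : Set (IS lam mu 2)} {O : Option A → Ordinal.{u + 1}}

/-- The rank of an element of `Card⁻`. -/
noncomputable def rk (β : cardMinus κ lam) : Ordinal.{u + 1} := cardRank κ lam ⟨β, Or.inr β.2⟩

theorem rk_lt_rk {β β' : cardMinus κ lam} : rk β < rk β' ↔ β < β' := cardRank_lt_cardRank

theorem rk_inj {β β' : cardMinus κ lam} : rk β = rk β' ↔ β = β' := by
  rw [le_antisymm_iff, le_antisymm_iff, ← not_lt, ← not_lt, rk_lt_rk, rk_lt_rk, not_lt, not_lt]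

theorem rk_le_rk {β β' : cardMinus κ lam} : rk β ≤ rk β' ↔ β ≤ β' := by
  rw [← not_lt, rk_lt_rk, not_lt]

theorem rk_lt (β : cardMinus κ lam) : rk β < cardRank κ lam ⟨lam, Or.inl rfl⟩ :=
  cardRank_lt_cardRank.2 β.2.1

theorem exists_rk_eq {ξ : Ordinal.{u + 1}} (h : ξ < cardRank κ lam ⟨lam, Or.inl rfl⟩) :
    ∃ β : cardMinus κ lam, rk β = ξ := by
  obtain ⟨⟨y, hy⟩, rfl⟩ := exists_cardRank_eq h.le
  rcases hy with rfl | hy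
  · exact absurd h (lt_irrefl _)
  · exact ⟨⟨y, hy⟩, rfl⟩

/-- In terms of ranks, with `lam = mu⁺` replaced by its definable equivalent, membership becomes the
condition which partial isomorphisms transfer. -/
theorem mem_FSet_iff_isBoundedFamily (hκ : 𝔠 < κ) (hκlam : κ < lam) (hlm : lam ≤ Order.succ mu)
    {n : ℕ} {h : IS lam mu n → cardMinus κ lam} :
    h ∈ FSet κ lam mu n ↔ IsBoundedFamily (∀ t : IS lam mu 2, ∃ s : IS lam mu 1, Proj1 t s)
      (cardRank κ lam ⟨lam, Or.inl rfl⟩) fun t => rk (h t) := by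
  rw [mem_FSet_iff hκ hκlam, eq_succ_iff_forall_exists_proj1 hlm, IsBoundedFamily]
  have hle : ∀ β, (∀ t, rk (h t) ≤ rk β) ↔ ∀ t, h t ≤ β := fun β =>
    forall_congr' fun t => rk_le_rk
  constructor
  · rintro ⟨⟨β, hβ⟩, h2⟩
    refine ⟨⟨rk β, rk_lt β, (hle β).2 hβ⟩, fun hf ξ hξ hb ξ' hξ' => ?_⟩
    obtain ⟨β, rfl⟩ := exists_rk_eq hξ
    obtain ⟨β', rfl⟩ := exists_rk_eq hξ'
    rw [rk_lt_rk]
    exact h2 hf β ((hle β).1 hb) β'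
  · rintro ⟨⟨ξ, hξ, hb⟩, h2⟩
    obtain ⟨β, rfl⟩ := exists_rk_eq hξ
    refine ⟨⟨β, (hle β).1 hb⟩, fun hf β hb β' => ?_⟩
    rw [← rk_lt_rk]
    exact h2 hf _ (rk_lt β) ((hle β).2 hb) _ (rk_lt β')

theorem mk_range_IS_le {n : ℕ} (f : IS lam mu n → Ordinal.{u + 1}) : #(range f) ≤ 𝔠 := by
  have := mk_range_le_lift (f := f)
  rw [← Cardinal.lift_le.{u + 1}, lift_continuum]
  exact this.trans ((Cardinal.lift_le.2 (mk_IS_le lam mu n)).trans_eq lift_continuum)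

variable (lt k O) in
/-- The element `y` of `N²` codes the image of the element `x` of `M*`. -/
def Matches (P : Set (Ordinal.{u + 1} × Ordinal.{u + 1})) : MElt κ lam mu → NElt κ lam mu → Prop
  | ⟨.is n, t⟩, y => y = eI n t
  | ⟨.card, β⟩, y => ∃ X η, y = eR3 X ∧ Cod lt k O X η ∧ (rk β, η) ∈ P
  | ⟨.f n, h⟩, y => ∃ Y, ∃ η : IS lam mu (n + 1) → Ordinal.{u + 1}, y = eF n Y ∧
      ∀ t, Cod lt k O (Y t) (η t) ∧ (rk (h.1 t), η t) ∈ P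

theorem Matches.mono {P P' : Set (Ordinal.{u + 1} × Ordinal.{u + 1})} (h : P ⊆ P')
    {x : MElt κ lam mu} {y : NElt κ lam mu} (hx : Matches lt k O P x y) :
    Matches lt k O P' x y := by
  obtain ⟨s, x⟩ := x
  cases s with
  | is n => exact hx
  | card =>
    obtain ⟨X, η, rfl, h1, h2⟩ := hx
    exact ⟨X, η, rfl, h1, h h2⟩
  | f n =>
    obtain ⟨Y, η, rfl, h1⟩ := hx
    exact ⟨Y, η, rfl, fun t => ⟨(h1 t).1, h (h1 t).2⟩⟩

variable (lt k O) in
/-- `w` codes the image of `v` under a partial isomorphism. -/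
structure Corr (q M r : ℕ) (P : Set (Ordinal.{u + 1} × Ordinal.{u + 1}))
    (v : ℕ → Option (MElt κ lam mu)) (w : ℕ → Option (NElt κ lam mu)) : Prop where
  iso : PartialIso r P
  top_mem : (O none, collapse k (range O) (O none)) ∈ P
  le_top : ∀ p ∈ P, p.1 ≤ O none
  matches_of_eq : ∀ i x, v i = some x →
    i < M ∧ ∃ y, w (q + 2 + i) = some y ∧ Matches lt k O P x y

variable {q M r : ℕ} {P : Set (Ordinal.{u + 1} × Ordinal.{u + 1})}
  {v : ℕ → Option (MElt κ lam mu)} {w : ℕ → Option (NElt κ lam mu)}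

theorem Corr.has (h : Corr lt k O q M r P v w) {i : ℕ} {x : MElt κ lam mu} (hx : v i = some x) :
    ∃ y, Has w (q + 2 + M) (q + 2 + i) y ∧ Matches lt k O P x y := by
  obtain ⟨hi, y, hy, hm⟩ := h.matches_of_eq i x hx
  exact ⟨y, ⟨by omega, hy⟩, hm⟩

theorem Corr.update (h : Corr lt k O q M r P v w) {r' : ℕ}
    {P' : Set (Ordinal.{u + 1} × Ordinal.{u + 1})} (hP : P ⊆ P') (hiso : PartialIso r' P')
    (hle : ∀ p ∈ P', ∃ q ∈ P, p.1 ≤ q.1) {i : ℕ} (hi : i < M) {x : MElt κ lam mu}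
    {y : NElt κ lam mu} (hm : Matches lt k O P' x y) :
    Corr lt k O q M r' P' (Function.update v i (some x))
      (Function.update w (q + 2 + i) (some y)) := by
  refine ⟨hiso, hP h.top_mem, fun p hp => ?_, fun j x' hx' => ?_⟩
  · obtain ⟨p', hp', hpp⟩ := hle p hp
    exact hpp.trans (h.le_top p' hp')
  · by_cases hj : j = i
    · subst hj
      rw [Function.update_self] at hx'
      cases hx'
      exact ⟨hi, y, Function.update_self _ _ _, hm⟩
    · rw [Function.update_of_ne hj] at hx'
      obtain ⟨h1, y', h2, h3⟩ := h.matches_of_eq j x' hx'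
      exact ⟨h1, y', by rw [Function.update_of_ne (by omega), h2], h3.mono hP⟩

theorem Corr.exists_term (h : Corr lt k O q M r P v w) {T : MTerm}
    (hT : T.HasSort (typesOf v) .card) :
    ∃ β X η, (∀ x, T.Denotes v x ↔ x = .ofCard β) ∧ HasTerm w q (q + 2 + M) T X ∧
      Cod lt k O X η ∧ (rk β, η) ∈ P := by
  cases T with
  | var i =>
    obtain ⟨β, hβ⟩ := exists_of_typesOf hT
    obtain ⟨_, hy, X, η, rfl, hX, hP⟩ := h.has hβ
    refine ⟨β, X, η, fun x => ?_, ⟨hy⟩, hX, hP⟩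
    rw [MTerm.Denotes, hβ, Option.some_inj]
    exact eq_comm
  | app n i j =>
    obtain ⟨hi, hj, -⟩ := hT
    obtain ⟨f, hf⟩ := exists_of_typesOf hi
    obtain ⟨t, ht⟩ := exists_of_typesOf hj
    obtain ⟨_, hy, Y, η, rfl, hY⟩ := h.has hf
    obtain ⟨_, hz, rfl⟩ := h.has ht
    refine ⟨f.1 t, Y t, η t, fun x => ⟨?_, ?_⟩, ⟨Y, t, hy, hz, rfl⟩, hY t⟩
    · rintro ⟨f', t', h1, h2, rfl⟩
      rw [hf] at h1
      rw [ht] at h2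
      obtain rfl := eq_of_heq (Sigma.mk.inj (Option.some.inj h1)).2
      obtain rfl := eq_of_heq (Sigma.mk.inj (Option.some.inj h2)).2
      rfl
    · rintro rfl
      exact ⟨f, t, hf, ht, rfl⟩

theorem MElt.ofCard_inj {β β' : cardMinus κ lam} :
    (MElt.ofCard β : MElt κ lam mu) = .ofCard β' ↔ β = β' :=
  ⟨fun h => eq_of_heq (Sigma.mk.inj h).2, fun h => by rw [h]⟩

section
variable {p : IS lam mu 2}
  {g : IS lam mu 2 → IS lam mu 2 → IS lam mu 2 → IS lam mu 2 → IS lam mu 2 → Prop}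
  (H : Blocks lt k O) (hp : typein lt p = (k + 2 : ℕ))
  (hg : ∀ x x' (l : Option A), IsLabel x x' l →
    Codes lt (g x x') (blockNum lt k l (blockLen k O l + 1)))
  (hO : O none = cardRank κ lam ⟨lam, Or.inl rfl⟩)
include H

theorem Corr.same_iff (h : Corr lt k O q M r P v w) {β β' : cardMinus κ lam}
    {X X' : IS lam mu 2 → IS lam mu 2 → IS lam mu 2 → Prop} {η η' : Ordinal.{u + 1}}
    (hX : Cod lt k O X η) (hX' : Cod lt k O X' η') (hP : (rk β, η) ∈ P) (hP' : (rk β', η') ∈ P) :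
    (¬ SLess lt X X' ∧ ¬ SLess lt X' X) ↔ β = β' := by
  rw [H.sLess_iff hX hX', H.sLess_iff hX' hX, not_lt, not_lt, and_comm, ← le_antisymm_iff,
    ← rk_inj]
  exact (eq_iff_of_lt_iff h.iso.lt_iff hP hP').symm

theorem Corr.lt_iff (h : Corr lt k O q M r P v w) {β β' : cardMinus κ lam}
    {X X' : IS lam mu 2 → IS lam mu 2 → IS lam mu 2 → Prop} {η η' : Ordinal.{u + 1}}
    (hX : Cod lt k O X η) (hX' : Cod lt k O X' η') (hP : (rk β, η) ∈ P) (hP' : (rk β', η') ∈ P) :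
    SLess lt X X' ↔ β < β' := by
  rw [H.sLess_iff hX hX', ← rk_lt_rk]
  exact (h.iso.lt_iff _ hP _ hP').symm

include hp hg hO

/-- Induction on `φ` along the back-and-forth system. Partial isomorphisms settle the atomic
formulae about `Card⁻`, the sorts `IS_n` are common to both sides, and a quantifier over `Card⁻` or
`F_n` is answered by a move forth or back. -/
theorem MFormula.sat_tr_iff (hκ : 𝔠 < κ) (hκlam : κ < lam) (hlm : lam ≤ Order.succ mu)
    {φ : MFormula} (hφ : φ.WellSorted (typesOf v)) (hc : φ.code < M) (hr : φ.rank ≤ r)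
    (hF : Frame q A lt p g w) (h : Corr lt k O q M r P v w) :
    φ.Sat v ↔ (φ.tr q (q + 2 + M)).Sat w := by
  induction φ generalizing r P v w with
  | eq s T T' =>
    have := hF.has_lt.mono (Nat.le_add_right _ M)
    cases s with
    | is n =>
      obtain ⟨h1, h2⟩ := hφ
      cases T with
      | app => cases h1.2.2
      | var i =>
        cases T' with
        | app => cases h2.2.2
        | var j =>
          obtain ⟨x, hx⟩ := exists_of_typesOf h1
          obtain ⟨x', hx'⟩ := exists_of_typesOf h2
          obtain ⟨_, hy, rfl⟩ := h.has hx
          obtain ⟨_, hy', rfl⟩ := h.has hx'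
          change (∃ z, v i = _ ∧ v j = _) ↔ ∃ z, w (q + 2 + i) = _ ∧ w (q + 2 + j) = _
          rw [hx, hx', hy.eq, hy'.eq]
          refine exists_congr fun z => ?_
          simp only [Option.some_inj]
          constructor
          · rintro ⟨h1, h2⟩
            obtain rfl := eq_of_heq (Sigma.mk.inj h1).2
            obtain rfl := eq_of_heq (Sigma.mk.inj h2).2
            exact ⟨rfl, rfl⟩
          · rintro ⟨h1, h2⟩
            obtain rfl : x = z := eq_of_heq (Sigma.mk.inj h1).2
            obtain rfl : x' = x := eq_of_heq (Sigma.mk.inj h2).2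
            exact ⟨rfl, rfl⟩
    | card =>
      obtain ⟨β, X, η, hβ, hX, hXη, hP⟩ := h.exists_term hφ.1
      obtain ⟨β', X', η', hβ', hX', hXη', hP'⟩ := h.exists_term hφ.2
      rw [MFormula.tr, Means.fEq_card.2, h.same_iff H hXη hXη' hP hP']
      change (∃ z : cardMinus κ lam, T.Denotes v (.ofCard z) ∧ T'.Denotes v (.ofCard z)) ↔ _
      simp only [hβ, hβ', MElt.ofCard_inj, exists_eq_left]
    | f n =>
      obtain ⟨h1, h2⟩ := hφ
      cases T with
      | app => cases h1.2.2
      | var i =>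
        cases T' with
        | app => cases h2.2.2
        | var j =>
          obtain ⟨x, hx⟩ := exists_of_typesOf h1
          obtain ⟨x', hx'⟩ := exists_of_typesOf h2
          obtain ⟨_, hy, Y, η, rfl, hY⟩ := h.has hx
          obtain ⟨_, hy', Y', η', rfl, hY'⟩ := h.has hx'
          rw [MFormula.tr, Means.fEq_f.2]
          change (∃ z, v i = _ ∧ v j = _) ↔ _
          rw [hx, hx']
          have e : (∀ t, ¬ SLess lt (Y t) (Y' t) ∧ ¬ SLess lt (Y' t) (Y t)) ↔ x.1 = x'.1 := by
            rw [funext_iff]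
            exact forall_congr' fun t =>
              h.same_iff H (hY t).1 (hY' t).1 (hY t).2 (hY' t).2
          rw [e]
          simp only [Option.some_inj]
          constructor
          · rintro ⟨z, h1, h2⟩
            obtain rfl := eq_of_heq (Sigma.mk.inj h1).2
            obtain rfl := eq_of_heq (Sigma.mk.inj h2).2
            rfl
          · intro he
            obtain rfl : x = x' := Subtype.ext he
            exact ⟨x, rfl, rfl⟩
  | lt T T' =>
    have := hF.has_lt.mono (Nat.le_add_right _ M)
    obtain ⟨β, X, η, hβ, hX, hXη, hP⟩ := h.exists_term hφ.1
    obtain ⟨β', X', η', hβ', hX', hXη', hP'⟩ := h.exists_term hφ.2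
    rw [Means.tr_lt.2, h.lt_iff H hXη hXη' hP hP']
    simp only [MFormula.Sat, hβ, hβ', MElt.ofCard_inj]
    constructor
    · rintro ⟨_, _, rfl, rfl, h⟩
      exact h
    · exact fun h => ⟨_, _, rfl, rfl, h⟩
  | eq1 i =>
    obtain ⟨x, hx⟩ := exists_of_typesOf hφ
    obtain ⟨_, hy, rfl⟩ := h.has hx
    simp only [MFormula.Sat, MFormula.tr, NFormula.Sat, hx, hy.eq, Option.some_inj]
    refine exists_congr fun t => and_congr_left' ⟨fun h => ?_, fun h => ?_⟩
    · obtain rfl : x = t := eq_of_heq (Sigma.mk.inj h).2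
      rfl
    · obtain rfl : x = t := eq_of_heq (Sigma.mk.inj h).2
      rfl
  | prod1 i =>
    obtain ⟨x, hx⟩ := exists_of_typesOf hφ
    obtain ⟨_, hy, rfl⟩ := h.has hx
    simp only [MFormula.Sat, MFormula.tr, NFormula.Sat, hx, hy.eq, Option.some_inj]
    refine exists_congr fun t => and_congr_left' ⟨fun h => ?_, fun h => ?_⟩
    · obtain rfl : x = t := eq_of_heq (Sigma.mk.inj h).2
      rfl
    · obtain rfl : x = t := eq_of_heq (Sigma.mk.inj h).2
      rfl
  | proj1 n i j =>
    obtain ⟨x, hx⟩ := exists_of_typesOf hφ.1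
    obtain ⟨x', hx'⟩ := exists_of_typesOf hφ.2
    obtain ⟨_, hy, rfl⟩ := h.has hx
    obtain ⟨_, hy', rfl⟩ := h.has hx'
    simp only [MFormula.Sat, MFormula.tr, NFormula.Sat, hx, hy.eq, hx', hy'.eq, Option.some_inj]
    refine exists_congr fun t => exists_congr fun t' => ?_
    rw [← and_assoc, ← and_assoc]
    refine and_congr_left' ⟨fun h => ?_, fun h => ?_⟩
    · obtain rfl : x = t := eq_of_heq (Sigma.mk.inj h.1).2
      obtain rfl : x' = t' := eq_of_heq (Sigma.mk.inj h.2).2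
      exact ⟨rfl, rfl⟩
    · obtain rfl : x = t := eq_of_heq (Sigma.mk.inj h.1).2
      obtain rfl : x' = t' := eq_of_heq (Sigma.mk.inj h.2).2
      exact ⟨rfl, rfl⟩
  | neg φ ih => exact not_congr (ih hφ (right_lt_of_pair_lt hc) hr hF h)
  | and φ φ' ih ih' =>
    have hc := right_lt_of_pair_lt hc
    exact and_congr (ih hφ.1 (left_lt_of_pair_lt hc) ((le_max_left _ _).trans hr) hF h)
      (ih' hφ.2 (right_lt_of_pair_lt hc) ((le_max_right _ _).trans hr) hF h)
  | ex i s φ ih =>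
    have hi : i < M := left_lt_of_pair_lt (right_lt_of_pair_lt hc)
    have hc' := right_lt_of_pair_lt (right_lt_of_pair_lt (right_lt_of_pair_lt hc))
    -- Two levels are available for each quantifier: one for the extension, and one for
    -- `PartialIso.isBoundedFamily_iff`, which needs a positive level after the extension.
    obtain ⟨r, rfl⟩ : ∃ r', r = r' + 2 := ⟨r - 2, by simp only [MFormula.rank] at hr; omega⟩
    have hr' : φ.rank ≤ r := by simpa [MFormula.rank] using hr
    have hiso : PartialIso (r + 1 + 1) P := h.iso
    have key : ∀ (x : MCarrier κ lam mu s) (y : NElt κ lam mu) {r' P'}, r ≤ r' → P ⊆ P' →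
        PartialIso r' P' → (∀ p ∈ P', ∃ q ∈ P, p.1 ≤ q.1) → Matches lt k O P' ⟨s, x⟩ y →
        (φ.Sat (Function.update v i (some ⟨s, x⟩)) ↔
          (φ.tr q (q + 2 + M)).Sat (Function.update w (q + 2 + i) (some y))) := by
      intro x y r' P' hrr hP hiso hle hm
      refine ih ?_ hc' (hr'.trans hrr) (hF.update i y) (h.update hP hiso hle hi hm)
      rw [typesOf_update]
      exact hφ
    have hle_top : ∀ P' : Set (Ordinal.{u + 1} × Ordinal.{u + 1}),
        (∀ p ∈ P', ∃ q ∈ P, p.1 ≤ q.1) → ∀ p ∈ P', p.1 ≤ O none := by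
      intro P' hle p hp
      obtain ⟨p', hp', hpp⟩ := hle p hp
      exact hpp.trans (h.le_top p' hp')
    cases s with
    | is n =>
      exact exists_congr fun x =>
        key x (eI n x) (Nat.le_add_right r 2) Subset.rfl h.iso (fun p hp => ⟨p, hp, le_rfl⟩) rfl
    | card =>
      have hm : ∀ X : IS lam mu 2 → IS lam mu 2 → IS lam mu 2 → Prop,
          Means (Function.update w (q + 2 + i) (some (eR3 X))) (q + 2 + M)
            (fCard q (q + 2 + i) (q + 2 + M)) (SCard lt A p g X) := by
        intro X
        have hF' := hF.update i (eR3 X)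
        have := hF'.has_A.mono (Nat.le_add_right _ M)
        have := hF'.has_lt.mono (Nat.le_add_right _ M)
        have := hF'.has_p.mono (Nat.le_add_right _ M)
        have := hF'.has_g.mono (Nat.le_add_right _ M)
        have : Has (Function.update w (q + 2 + i) (some (eR3 X))) (q + 2 + M)
          (q + 2 + i) (eR3 X) := Has.update_self (by omega)
        exact Means.fCard _ _
      constructor
      · rintro ⟨β, hβ⟩
        obtain ⟨P', hP, hiso', hT, hle⟩ := hiso.forth (T := {rk β})
          ((mk_singleton _).le.trans (one_le_aleph0.trans aleph0_le_continuum)) (by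
            rintro _ rfl
            exact ⟨_, h.top_mem, by rw [hO]; exact (rk_lt β).le⟩)
        obtain ⟨⟨ξ, η⟩, hη, rfl⟩ := hT rfl
        have hηt : η < collapse k (range O) (O none) := by
          refine (hiso'.lt_iff _ hη _ (hP h.top_mem)).1 ?_
          rw [hO]
          exact rk_lt β
        obtain ⟨X, hX⟩ := H.exists_cod hηt.le
        refine ⟨(eR3 X).2, ?_, ?_⟩
        · exact (hm X).2.2 ((H.sCard_iff hp hg).2 ⟨η, hηt, hX⟩)
        · exact (key β (eR3 X) (Nat.le_succ r) hP hiso' hle ⟨X, η, rfl, hX, hη⟩).1 hβ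
      · rintro ⟨y, h1, h2⟩
        obtain ⟨X, rfl⟩ := surj_R3 y
        obtain ⟨η, hηt, hX⟩ := (H.sCard_iff hp hg).1 ((hm X).2.1 h1)
        obtain ⟨P', hP, hiso', hT, hle⟩ := hiso.back (T := {η})
          ((mk_singleton _).le.trans (one_le_aleph0.trans aleph0_le_continuum)) (by
            rintro _ rfl
            exact ⟨_, h.top_mem, hηt.le⟩)
        obtain ⟨⟨ξ, η⟩, hη, rfl⟩ := hT rfl
        have hξ : ξ < O none := (hiso'.lt_iff _ hη _ (hP h.top_mem)).2 hηt
        rw [hO] at hξ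
        obtain ⟨β, rfl⟩ := exists_rk_eq hξ
        exact ⟨β, (key β (eR3 X) (Nat.le_succ r) hP hiso' hle ⟨X, η, rfl, hX, hη⟩).2 h2⟩
    | f n =>
      have hm : ∀ Y : IS lam mu (n + 1) → IS lam mu 2 → IS lam mu 2 → IS lam mu 2 → Prop,
          Means (Function.update w (q + 2 + i) (some (eF n Y))) (q + 2 + M)
            (fFun q n (q + 2 + i) (q + 2 + M))
            (SFun lt A p g (∀ t : IS lam mu 2, ∃ s : IS lam mu 1, Proj1 t s) Y) := by
        intro Y
        have hF' := hF.update i (eF n Y)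
        have := hF'.has_A.mono (Nat.le_add_right _ M)
        have := hF'.has_lt.mono (Nat.le_add_right _ M)
        have := hF'.has_p.mono (Nat.le_add_right _ M)
        have := hF'.has_g.mono (Nat.le_add_right _ M)
        have : Has (Function.update w (q + 2 + i) (some (eF n Y))) (q + 2 + M)
          (q + 2 + i) (eF n Y) := Has.update_self (by omega)
        exact Means.fFun n _ _
      constructor
      · rintro ⟨f, hf⟩
        -- All the values of `f` are carried over in one move, as there are at most `𝔠` of them.
        obtain ⟨P', hP, hiso', hT, hle⟩ := hiso.forth (T := range fun t => rk (f.1 t))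
          (mk_range_IS_le _) (by
            rintro _ ⟨t, rfl⟩
            exact ⟨_, h.top_mem, by rw [hO]; exact (rk_lt _).le⟩)
        have : ∀ t, ∃ η, (rk (f.1 t), η) ∈ P' := by
          intro t
          obtain ⟨⟨ξ, η⟩, hη, rfl⟩ := hT (mem_range_self t)
          exact ⟨η, hη⟩
        choose η hη using this
        have hηt : ∀ t, η t < collapse k (range O) (O none) := by
          intro t
          refine (hiso'.lt_iff _ (hη t) _ (hP h.top_mem)).1 ?_
          rw [hO]
          exact rk_lt _
        choose Y hY using fun t => H.exists_cod (hηt t).le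
        refine ⟨(eF n Y).2, ?_, ?_⟩
        · refine (hm Y).2.2 ((H.sFun_iff hp hg hY hηt).2 ?_)
          rw [← hiso'.isBoundedFamily_iff (hP h.top_mem) hη, hO]
          exact (mem_FSet_iff_isBoundedFamily hκ hκlam hlm).1 f.2
        · exact (key f (eF n Y) (Nat.le_succ r) hP hiso' hle ⟨Y, η, rfl, fun t => ⟨hY t, hη
            t⟩⟩).1 hf
      · rintro ⟨y, h1, h2⟩
        obtain ⟨Y, rfl⟩ := surj_F n y
        have hS := (hm Y).2.1 h1
        choose η hηt hY using fun t => (H.sCard_iff hp hg).1 (hS.1 t)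
        obtain ⟨P', hP, hiso', hT, hle⟩ := hiso.back (T := range η)
          (mk_range_IS_le _) (by
            rintro _ ⟨t, rfl⟩
            exact ⟨_, h.top_mem, (hηt t).le⟩)
        have : ∀ t, ∃ β : cardMinus κ lam, (rk β, η t) ∈ P' := by
          intro t
          obtain ⟨⟨ξ, η'⟩, hη, he⟩ := hT (mem_range_self t)
          have he : η' = η t := he
          subst he
          have hξ : ξ < O none := (hiso'.lt_iff _ hη _ (hP h.top_mem)).2 (hηt t)
          rw [hO] at hξ
          obtain ⟨β, rfl⟩ := exists_rk_eq hξ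
          exact ⟨β, hη⟩
        choose f hf using this
        -- The bound on the coded function is pulled back through the partial isomorphism, so the
        -- preimages form a member of `F_{n+1}`.
        have hfF : f ∈ FSet κ lam mu (n + 1) := by
          rw [mem_FSet_iff_isBoundedFamily hκ hκlam hlm, ← hO,
            hiso'.isBoundedFamily_iff (hP h.top_mem) hf]
          exact (H.sFun_iff hp hg hY hηt).1 hS
        exact ⟨⟨f, hfF⟩, (key ⟨f, hfF⟩ (eF n Y) (Nat.le_succ r) hP hiso' hle
          ⟨Y, η, rfl, fun t => ⟨hY t, hf t⟩⟩).2 h2⟩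

end
end

/-! ## The translation of a formula about represented tuples -/

/-- The value of the variable `y` codes the element represented by the value of `c`. -/
def fLink (q c y b : ℕ) : MSort → NFormula
  | .is n => .eq (.is n) c y
  | .card => fLast q c y b
  | .f n => allN (.elt (.is n)) b fun t b => allN tE b fun a b => (memRep n c t a).imp
      (secF b n y t fun X b => fLast q a X b)

/-- The matrix of the translation of `φ`. -/
def fBody (Γ : List MSort) (φ : MFormula) (K e q b : ℕ) : NFormula :=
  (fChain K e b).and ((fBlockTops K e b).and
    (conjRange (fun i => fLink q (2 + (K + K) + i) (q + 2 + i) b (Γ.getD i .card)) (φ.tr q b)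
      Γ.length))

/-- The quantifier prefix of the translation. -/
def fPrefix (Γ : List MSort) (K e q : ℕ) (ψ : NFormula) : NFormula :=
  exRange e (fun _ => tE) (K + 2) (.ex (q + 1) tR5
    (exRange (q + 2) (fun i => (Γ.getD i .card).codeType) Γ.length ψ))

/-- The formula about `K`-representations which corresponds to `φ`. -/
def MFormula.translate (Γ : List MSort) (φ : MFormula) (K : ℕ) : NFormula :=
  fPrefix Γ K (2 + (K + K) + Γ.length) (2 + (K + K) + Γ.length + (K + 1))
    (fBody Γ φ K (2 + (K + K) + Γ.length) (2 + (K + K) + Γ.length + (K + 1))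
      (2 + (K + K) + Γ.length + (K + 1) + 2 + (φ.code + 1 + Γ.length)))

section
variable {κ lam mu : Cardinal.{u}} {w : ℕ → Option (NElt κ lam mu)} {b : ℕ}

theorem Means.of_wellSorted {ψ : NFormula} (h : ψ.WellSorted (typesOf w)) :
    Means w b ψ (ψ.Sat w) := ⟨h, Iff.rfl⟩

theorem Has.ext_add {s m j : ℕ} (h : j < m) (hb : s + m ≤ b) (d : ℕ → NElt κ lam mu) :
    Has (QuotSym.ext w s m d) b (s + j) (d j) := ⟨by omega, QuotSym.ext_add h⟩

theorem eR3_inj {X Y : IS lam mu 2 → IS lam mu 2 → IS lam mu 2 → Prop}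
    (h : (eR3 X : NElt κ lam mu) = eR3 Y) : X = Y := by
  funext i s t
  exact propext (Set.ext_iff.1 (eq_of_heq (Sigma.mk.inj h).2)
    ((i, s, t, PUnit.unit) : NTuple κ lam mu [.is 1, .is 1, .is 1]))

theorem eF_inj {n : ℕ} {X Y : IS lam mu (n + 1) → IS lam mu 2 → IS lam mu 2 → IS lam mu 2 → Prop}
    (h : (eF n X : NElt κ lam mu) = eF n Y) : X = Y := by
  funext a i s t
  exact propext (Set.ext_iff.1 (eq_of_heq (Sigma.mk.inj h).2)
    ((a, i, s, t, PUnit.unit) : NTuple κ lam mu [.is n, .is 1, .is 1, .is 1]))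

variable {lt : IS lam mu 2 → IS lam mu 2 → Prop} {A : Set (IS lam mu 2)} {q : ℕ} {p : IS lam mu 2}
  {g : IS lam mu 2 → IS lam mu 2 → IS lam mu 2 → IS lam mu 2 → IS lam mu 2 → Prop}

theorem Means.fLink_f [Has w b 1 (eR2 lt)] [Has w b 0 (eR1 (· ∈ A))] [Has w b q (eE p)]
    [Has w b (q + 1) (eR5 g)] {n c y : ℕ} {R : IS lam mu (n + 1) → IS lam mu 2 → Prop}
    {Y : IS lam mu (n + 1) → IS lam mu 2 → IS lam mu 2 → IS lam mu 2 → Prop}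
    [Has w b c (eRep n R)] [Has w b y (eF n Y)] :
    Means w b (fLink q c y b (.f n)) (∀ t a, R t a → SLast lt A p g a (Y t)) := by
  unfold fLink; infer_instance

theorem exists_eq_eRep {n : ℕ} (y : NElt κ lam mu) (h : y.1 = tRep n) : ∃ R, y = eRep n R := by
  obtain ⟨τ, y⟩ := y
  subst h
  exact ⟨fun t a => (t, a, PUnit.unit) ∈ (show Set (NTuple κ lam mu [.is n, .is 1]) from y), rfl⟩

theorem Means.fLink (hF : Frame q A lt p g w) (hb : q + 2 ≤ b) {s : MSort} {i j : ℕ}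
    {c y : NElt κ lam mu} (hc : Has w b i c) (hy : Has w b j y) (hct : c.1 = s.repType)
    (hyt : y.1 = s.codeType) : Means w b (fLink q i j b s) ((fLink q i j b s).Sat w) := by
  have := hF.has_A.mono hb
  have := hF.has_lt.mono hb
  have := hF.has_p.mono hb
  have := hF.has_g.mono hb
  refine Means.of_wellSorted ?_
  cases s with
  | is n => exact ⟨hc.type_eq.trans (congrArg some hct), hy.type_eq.trans (congrArg some hyt)⟩
  | card =>
    obtain ⟨a, rfl⟩ : ∃ a, c = eE a := exists_eq_eI c hct
    obtain ⟨X, rfl⟩ := exists_eq_eR3 y hyt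
    exact (Means.fLast (b := b) (q := q) i j a X).1
  | f n =>
    obtain ⟨R, rfl⟩ := exists_eq_eRep c hct
    obtain ⟨Y, rfl⟩ := exists_eq_eF y hyt
    exact Means.fLink_f.1

instance (s : MSort) : Nonempty (NCarrier κ lam mu s.codeType) := by
  cases s with
  | is n => exact (inferInstance : Nonempty (IS lam mu (n + 1)))
  | card => exact ⟨(eR3 fun _ _ _ => True).2⟩
  | f n => exact ⟨(eF n fun _ _ _ _ => True).2⟩

instance : Nonempty (NCarrier κ lam mu tE) := (inferInstance : Nonempty (IS lam mu (1 + 1)))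

/-- The assignment for the matrix of the translation. -/
def fullEnv (w : ℕ → Option (NElt κ lam mu)) (Γ : List MSort) (K e : ℕ) (d : ℕ → IS lam mu 2)
    (g : IS lam mu 2 → IS lam mu 2 → IS lam mu 2 → IS lam mu 2 → IS lam mu 2 → Prop)
    (y : ∀ i, NCarrier κ lam mu (Γ.getD i .card).codeType) : ℕ → Option (NElt κ lam mu) :=
  ext (Function.update (ext w e (K + 2) fun j => eE (d j)) (e + (K + 1) + 1) (some (eR5 g)))
    (e + (K + 1) + 2) Γ.length fun i => ⟨_, y i⟩

variable {Γ : List MSort} {φ : MFormula} {K e M : ℕ} {d : ℕ → IS lam mu 2}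
  {y : ∀ i, NCarrier κ lam mu (Γ.getD i .card).codeType}

theorem Has.fullEnv {i : ℕ} {x : NElt κ lam mu} (h : Has w e i x) :
    Has (fullEnv w Γ K e d g y) e i x := by
  have h1 := h.lt
  refine ⟨h1, ?_⟩
  rw [QuotSym.fullEnv, ext_of_lt (by omega), Function.update_of_ne (by omega), ext_of_lt h1, h.eq]

theorem hasElts_fullEnv : HasElts (fullEnv w Γ K e d g y) (e + (K + 1) + 2) e (K + 2) d := by
  refine ⟨fun j hj => ⟨by omega, ?_⟩⟩
  rw [fullEnv, ext_of_lt (by omega), Function.update_of_ne (by omega), QuotSym.ext_add hj]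

theorem frame_fullEnv (h0 : Has w e 0 (eR1 (· ∈ A))) (h1 : Has w e 1 (eR2 lt)) :
    Frame (e + (K + 1)) A lt (d (K + 1)) g (fullEnv w Γ K e d g y) :=
  ⟨h0.fullEnv.mono (by omega), h1.fullEnv.mono (by omega), hasElts_fullEnv.has (K + 1) (by omega),
    ⟨by omega, by rw [fullEnv, ext_of_lt (by omega), Function.update_self]⟩⟩

theorem has_fullEnv {i : ℕ} (hi : i < Γ.length) (hM : Γ.length ≤ M) :
    Has (fullEnv w Γ K e d g y) (e + (K + 1) + 2 + M) (e + (K + 1) + 2 + i) ⟨_, y i⟩ :=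
  Has.ext_add hi (by omega) _

/-- Only the kinds and names of the given values enter here; whether they form a representation is
immaterial. So the same lemma yields the well-sortedness of the translation and the shape of its
meaning. -/
theorem Means.translate {gl : ℕ → IS lam mu 2 → IS lam mu 2 → IS lam mu 2 → Prop}
    {c : ℕ → NElt κ lam mu} [hK : NeZero K] (hφ : φ.WellSorted fun i => Γ[i]?)
    (he : e = 2 + (K + K) + Γ.length) (h0 : Has w e 0 (eR1 (· ∈ A)))
    (h1 : Has w e 1 (eR2 lt)) (hg : HasRels w e 2 (K + K) gl)
    (hc : ∀ i < Γ.length, Has w e (2 + (K + K) + i) (c i) ∧ (c i).1 = (Γ.getD i .card).repType) :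
    Means w b (φ.translate Γ K) (∃ d g y, IsChain0 lt (K + 1) d ∧
      (∀ x x', (x = x' → x ∈ A) → IsBlockTop lt K d gl x x' (g x x')) ∧
      (φ.tr (e + (K + 1)) (e + (K + 1) + 2 + (φ.code + 1 + Γ.length))).Sat
        (fullEnv w Γ K e d g y) ∧
      ∀ i < Γ.length, (QuotSym.fLink (e + (K + 1)) (2 + (K + K) + i) (e + (K + 1) + 2 + i)
        (e + (K + 1) + 2 + (φ.code + 1 + Γ.length)) (Γ.getD i .card)).Sat
          (fullEnv w Γ K e d g y)) := by
  unfold MFormula.translate fPrefix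
  rw [← he]
  refine Means.exRange (b := b) (τ := fun _ => tE) fun (d : ℕ → IS lam mu 2) => Means.ex (b :=
      b) (b' := b) _ surj_R5
    fun g => Means.exRange (b := e + (K + 1) + 2 + (φ.code + 1 + Γ.length)) fun y => ?_
  change Means (fullEnv w Γ K e d g y) _ _ _
  have hF := frame_fullEnv (K := K) (d := d) (g := g) (y := y) h0 h1
  set M := φ.code + 1 + Γ.length with hM
  have hb : e + (K + 1) + 2 ≤ e + (K + 1) + 2 + M := Nat.le_add_right _ _
  have := hF.has_A.mono hb
  have := hF.has_lt.mono hb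
  have := hF.has_g.mono hb
  have : HasElts (fullEnv w Γ K e d g y) (e + (K + 1) + 2 + M) e (K + 2) d :=
    ⟨fun j hj => (hasElts_fullEnv.has j hj).mono hb⟩
  have : HasRels (fullEnv w Γ K e d g y) (e + (K + 1) + 2 + M) 2 (K + K) gl :=
    ⟨fun j hj => (hg.has j hj).fullEnv.mono (by omega)⟩
  refine Means.and _ _ (h := Means.fChain) (h' := Means.and _ _ (h := Means.fBlockTops)
    (h' := Means.conjRange (Means.of_wellSorted ?_) fun i hi => ?_))
  · refine MFormula.wellSorted_tr hφ (by omega) hF fun i s hi => ?_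
    have hlt : i < Γ.length := (List.getElem?_eq_some_iff.1 hi).1
    refine ⟨_, has_fullEnv hlt (by omega), ?_⟩
    change (Γ.getD i .card).codeType = _
    rw [List.getD_eq_getElem?_getD, hi]
    rfl
  · exact Means.fLink hF hb ((hc i hi).1.fullEnv.mono (by omega)) (has_fullEnv hi (by omega))
      (hc i hi).2 rfl

end

theorem MFormula.wellSorted_translate {Γ : List MSort} {φ : MFormula} {K : ℕ} [NeZero K]
    (hφ : φ.WellSorted fun i => Γ[i]?) :
    (φ.translate Γ K).WellSorted fun i => (repContext K Γ)[i]? := by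
  let dummy : MSort → NElt.{0} 0 0 0 := fun s => match s with
    | .is n => eI n (Classical.arbitrary _)
    | .card => eE (Classical.arbitrary _)
    | .f n => eRep n fun _ _ => True
  -- Well-sortedness is syntactic, so it may be tested at any values of the right kinds, here in the
  -- structure for `κ = lam = mu = 0`.
  let l : List (NElt.{0} 0 0 0) := eR1 (· ∈ (∅ : Set (IS 0 0 2))) :: eR2 (fun _ _ => True) ::
    (List.replicate (K + K) (eR3 fun _ _ _ => True) ++ Γ.map dummy)
  have ht : (fun i => (repContext K Γ)[i]?) = typesOf fun i => l[i]? := by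
    funext i
    rw [typesOf, ← List.getElem?_map]
    congr 1
    have e : Γ.map MSort.repType = Γ.map (Sigma.fst ∘ dummy) :=
      List.map_congr_left fun s _ => by cases s <;> rfl
    simp only [repContext, l, List.map_cons, List.map_append, List.map_replicate, List.map_map,
      two_mul, e]
    rfl
  rw [ht]
  refine (Means.translate (b := 0) (e := 2 + (K + K) + Γ.length) (A := ∅)
    (lt := fun _ _ => True) (gl := fun _ _ _ _ => True) (c := fun i => dummy (Γ.getD i .card))
    hφ rfl ⟨by omega, rfl⟩ ⟨by omega, rfl⟩ ⟨fun j hj => ⟨by omega, ?_⟩⟩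
    fun i hi => ⟨⟨by omega, ?_⟩, ?_⟩).1
  · rw [Nat.add_comm 2 j]
    simp [l, hj, List.getElem?_append]
  · rw [show 2 + (K + K) + i = (K + K + i) + 1 + 1 by ring]
    simp [l, hi]
  · cases Γ.getD i .card <;> rfl

/-! ## The translation is correct -/

section
variable {κ lam mu : Cardinal.{u}}

theorem RepBase.mk_range_rank_le {K : ℕ} (B : RepBase κ lam mu K) : #(range B.rank) ≤ 𝔠 := by
  classical
  have h := mk_range_IS_le (lam := lam) (mu := mu) (n := 2) fun t =>
    if h : t ∈ B.A then B.rank (some ⟨t, h⟩) else 0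
  refine (mk_le_mk_of_subset ?_).trans (mk_insert_le_continuum h (B.rank none))
  rintro _ ⟨_ | a, rfl⟩
  · exact mem_insert _ _
  · refine mem_insert_of_mem _ ⟨a.1, dif_pos a.2⟩

/-- The functions `g_0, …, g_{K-1}, g^0, …, g^{K-1}`. -/
noncomputable def RepBase.graph {K : ℕ} (B : RepBase κ lam mu K) (j : ℕ) (l : Option B.A) :
    IS lam mu 2 :=
  if h : j < K then B.gLow ⟨j, h⟩ l else
    if h : j - K < K then B.gUp ⟨j - K, h⟩ l else Classical.arbitrary (IS lam mu (1 + 1))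

/-- The graph of `g : Option A → IS_2` as a ternary relation. -/
def optionRel {A : Set (IS lam mu 2)} (g : Option A → IS lam mu 2) (x x' y : IS lam mu 2) : Prop :=
  (∃ ha : x ∈ A, x' = x ∧ y = g (some ⟨x, ha⟩)) ∨ (x ≠ x' ∧ y = g none)

theorem optionRel_iff {A : Set (IS lam mu 2)} (g : Option A → IS lam mu 2) {x x' : IS lam mu 2}
    {l : Option A} (hl : IsLabel x x' l) (y : IS lam mu 2) : optionRel g x x' y ↔ y = g l := by
  cases l with
  | none =>
    have hl : x ≠ x' := hl
    refine ⟨?_, fun h => Or.inr ⟨hl, h⟩⟩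
    rintro (⟨-, h, -⟩ | ⟨-, h⟩)
    exacts [absurd h.symm hl, h]
  | some a =>
    obtain ⟨rfl, rfl⟩ := hl
    refine ⟨?_, fun h => Or.inl ⟨a.2, rfl, h⟩⟩
    rintro (⟨_, -, h⟩ | ⟨h, -⟩)
    exacts [h, absurd rfl h]

theorem RepBase.length_head {K : ℕ} (B : RepBase κ lam mu K) :
    B.head.length = 2 + (K + K) := by
  simp only [RepBase.head, List.length_append, List.length_ofFn, List.length_cons, List.length_nil]
  omega

theorem RepBase.head_graph {K : ℕ} (B : RepBase κ lam mu K) {j : ℕ} (hj : j < K + K) :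
    B.head[2 + j]? = some (eR3 (optionRel (B.graph j))) := by
  have e : B.head = (.ofRel (l := [.is 1]) {p | p.1 ∈ B.A}) ::
      (.ofRel (l := [.is 1, .is 1]) {p | B.lt p.1 p.2.1}) ::
      ((List.ofFn fun j => optionGraph (B.gLow j)) ++ (List.ofFn fun j => optionGraph (B.gUp j))) :=
    rfl
  rw [e, Nat.add_comm 2 j, List.getElem?_cons_succ, List.getElem?_cons_succ]
  by_cases h : j < K
  · rw [List.getElem?_append_left (by simpa using h), List.getElem?_ofFn, dif_pos h]
    have : B.graph j = B.gLow ⟨j, h⟩ := by funext l; simp [RepBase.graph, h]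
    rw [this]
    rfl
  · have h' : j - K < K := by omega
    rw [List.getElem?_append_right (by simpa using h), List.length_ofFn, List.getElem?_ofFn,
      dif_pos h']
    have : B.graph j = B.gUp ⟨j - K, h'⟩ := by funext l; simp [RepBase.graph, h, h']
    rw [this]
    rfl

theorem RepBase.type_of_represents {K : ℕ} {B : RepBase κ lam mu K} {a : MElt κ lam mu}
    {c : NElt κ lam mu} (h : B.Represents a c) : c.1 = a.1.repType := by
  obtain ⟨s, a⟩ := a
  cases s with
  | is n => obtain rfl := h; rfl
  | card => obtain ⟨b, -, rfl⟩ := h; rfl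
  | f n => obtain ⟨H, -, rfl⟩ := h; rfl

variable {k : ℕ} (B : RepBase κ lam mu (k + 1))

/-- The partial isomorphism given by the collapse. -/
noncomputable def RepBase.collapseIso : Set (Ordinal.{u + 1} × Ordinal.{u + 1}) :=
  (fun x => (x, collapse k (range B.rank) x)) '' range B.rank

variable {B}

theorem RepBase.mem_collapseIso {a : B.A} {η : Ordinal.{u + 1}} :
    (rk (B.θ a), η) ∈ B.collapseIso ↔ η = collapse k (range B.rank) (B.rank (some a)) := by
  constructor
  · rintro ⟨_, ⟨l, rfl⟩, h⟩
    obtain ⟨h1, rfl⟩ := Prod.mk.inj h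
    rw [h1]
    rfl
  · rintro rfl
    exact ⟨_, mem_range_self (some a), rfl⟩

theorem RepBase.exists_matches {a : MElt κ lam mu} {c : NElt κ lam mu} (h : B.Represents a c) :
    letI := B.isWellOrder
    ∃ y : NCarrier κ lam mu a.1.codeType, Matches B.lt k B.rank B.collapseIso a ⟨_, y⟩ := by
  let := B.isWellOrder
  have H := B.blocks k
  have key : ∀ a : B.A, ∃ X η, Cod B.lt k B.rank X η ∧ (rk (B.θ a), η) ∈ B.collapseIso := by
    intro a
    obtain ⟨X, hX⟩ := H.exists_cod (η := collapse k (range B.rank) (B.rank (some a))) (by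
      rcases (H.le_top (some a)).lt_or_eq with h | h
      · exact (collapse_lt_collapse (mem_range_self _) h).le
      · rw [h])
    exact ⟨X, _, hX, B.mem_collapseIso.2 rfl⟩
  obtain ⟨s, a⟩ := a
  cases s with
  | is n => exact ⟨a, rfl⟩
  | card =>
    obtain ⟨b, rfl, -⟩ := h
    obtain ⟨X, η, h1, h2⟩ := key b
    exact ⟨(eR3 X).2, X, η, rfl, h1, h2⟩
  | f n =>
    obtain ⟨H, hH, -⟩ := h
    choose X η h1 h2 using fun t => key (H t)
    exact ⟨(eF n X).2, X, η, rfl, fun t => ⟨h1 t, by rw [← hH t]; exact h2 t⟩⟩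

/-- The collapse sends `θ a` to the last element of the block of `a`, which is what `fLast` singles
out. Hence the link says that the code matches under the collapse. -/
theorem RepBase.sat_fLink_iff {w : ℕ → Option (NElt κ lam mu)} {b q i j : ℕ} {p : IS lam mu 2}
    {g : IS lam mu 2 → IS lam mu 2 → IS lam mu 2 → IS lam mu 2 → IS lam mu 2 → Prop}
    (hF : Frame q B.A B.lt p g w) (hb : q + 2 ≤ b) {a : MElt κ lam mu} {c y : NElt κ lam mu}
    (h : B.Represents a c) (hc : Has w b i c) (hy : Has w b j y) (hyt : y.1 = a.1.codeType) :
    letI := B.isWellOrder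
    typein B.lt p = (k + 2 : ℕ) →
    (∀ x x' (l : Option B.A), IsLabel x x' l →
      Codes B.lt (g x x') (blockNum B.lt k l (blockLen k B.rank l + 1))) →
    ((fLink q i j b a.1).Sat w ↔ Matches B.lt k B.rank B.collapseIso a y) := by
  let := B.isWellOrder
  intro hp hg
  have H := B.blocks k
  have := hF.has_A.mono hb
  have := hF.has_lt.mono hb
  have := hF.has_p.mono hb
  have := hF.has_g.mono hb
  obtain ⟨s, a⟩ := a
  cases s with
  | is n =>
    obtain rfl : c = eI n a := h
    obtain ⟨t, rfl⟩ := exists_eq_eI y hyt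
    change (∃ z, w i = _ ∧ w j = _) ↔ eI n t = eI n a
    rw [hc.eq, hy.eq]
    constructor
    · rintro ⟨z, h1, h2⟩
      rw [Option.some.inj h1, Option.some.inj h2]
    · intro h
      rw [h]
      exact ⟨a, rfl, rfl⟩
  | card =>
    obtain ⟨b', rfl, rfl⟩ := h
    obtain ⟨X, rfl⟩ := exists_eq_eR3 y hyt
    have hc : Has w b i (eE b'.1) := hc
    refine (Means.fLast (b := b) (q := q) i j b'.1 X).2.trans ?_
    rw [H.sLast_iff hp hg]
    constructor
    · exact fun h => ⟨X, _, rfl, h, B.mem_collapseIso.2 rfl⟩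
    · rintro ⟨X', η, hX, h1, h2⟩
      rw [eR3_inj hX]
      rwa [B.mem_collapseIso.1 h2] at h1
  | f n =>
    obtain ⟨F, hf, rfl⟩ := h
    obtain ⟨Y, rfl⟩ := exists_eq_eF y hyt
    have hc : Has w b i (eRep n fun t y => (F t : IS lam mu 2) = y) := hc
    rw [Means.fLink_f.2]
    simp only [forall_eq']
    simp only [fun t X => H.sLast_iff hp hg (X := X) (F t)]
    constructor
    · exact fun h => ⟨Y, _, rfl, fun t => ⟨h t, by rw [← hf t]; exact B.mem_collapseIso.2 rfl⟩⟩
    · rintro ⟨Y', η, hY, h⟩ t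
      obtain ⟨h1, h2⟩ := h t
      rw [eF_inj hY]
      rw [← hf t] at h2
      rwa [B.mem_collapseIso.1 h2] at h1

end

/-- The collapse is a partial isomorphism of level `k`, and `k = φ.code` bounds the rank of `φ`, so
`MFormula.sat_tr_iff` applies once the chain, the block tops and the codes are correct. The
conditions in the matrix say just this. -/
theorem MFormula.models_translate_iff {κ lam mu : Cardinal.{u}} (hκ : 𝔠 < κ) (hκlam : κ < lam)
    (hlm : lam ≤ Order.succ mu) {φ : MFormula} {k : ℕ} (hk : φ.code = k)
    {a : List (MElt κ lam mu)} {c : List (NElt κ lam mu)} (hφ : φ.WellSorted fun i => (a.map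
        Sigma.fst)[i]?)
    (hr : IsRepresentation (k + 1) a c) :
    φ.Models a ↔ (φ.translate (a.map Sigma.fst) (k + 1)).Models c := by
  obtain ⟨B, d, rfl, hd⟩ := hr
  let := B.isWellOrder
  set Γ := a.map Sigma.fst with hΓ
  have H := B.blocks k
  set w : ℕ → Option (NElt κ lam mu) := fun i => (B.head ++ d)[i]? with hw
  have hlen : Γ.length = d.length := by rw [hΓ, List.length_map, hd.length_eq]
  set e := 2 + (k + 1 + (k + 1)) + Γ.length with he
  have hhead : ∀ i x, B.head[i]? = some x → Has w e i x := by
    intro i x hx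
    have hi := (List.getElem?_eq_some_iff.1 hx).1
    refine ⟨?_, ?_⟩
    · rw [B.length_head] at hi
      omega
    · rw [hw]
      exact (List.getElem?_append_left hi).trans hx
  have hrep : ∀ i < Γ.length, ∃ x y, a[i]? = some x ∧ B.Represents x y ∧
      Has w e (2 + (k + 1 + (k + 1)) + i) y := by
    intro i hi
    have hia : i < a.length := by rwa [hΓ, List.length_map] at hi
    have hid : i < d.length := hlen ▸ hi
    refine ⟨a[i], d[i], List.getElem?_eq_getElem hia, ?_, by omega, ?_⟩
    · exact (List.forall₂_iff_get.1 hd).2 i hia hid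
    · rw [hw]
      change (B.head ++ d)[_]? = _
      rw [List.getElem?_append_right (by rw [B.length_head]; omega), B.length_head,
        Nat.add_sub_cancel_left, List.getElem?_eq_getElem hid]
  have hsort : ∀ i x, a[i]? = some x → Γ.getD i .card = x.1 := by
    intro i x hx
    rw [List.getD_eq_getElem?_getD, hΓ, List.getElem?_map, hx]
    rfl
  have htypes : (fun i => Γ[i]?) = typesOf fun i => a[i]? := by
    funext i
    rw [hΓ, List.getElem?_map]
    rfl
  have h0 : Has w e 0 (eR1 (· ∈ B.A)) := hhead 0 _ rfl
  have h1 : Has w e 1 (eR2 B.lt) := hhead 1 _ rfl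
  have hg : HasRels w e 2 (k + 1 + (k + 1)) fun j => optionRel (B.graph j) :=
    ⟨fun j hj => hhead _ _ (B.head_graph hj)⟩
  have hc : ∃ c : ℕ → NElt κ lam mu, ∀ i < Γ.length, ∃ x, a[i]? = some x ∧ B.Represents x (c i) ∧
      Has w e (2 + (k + 1 + (k + 1)) + i) (c i) := by
    have : ∀ i, ∃ c : NElt κ lam mu, i < Γ.length → ∃ x, a[i]? = some x ∧ B.Represents x c ∧
        Has w e (2 + (k + 1 + (k + 1)) + i) c := by
      intro i
      by_cases hi : i < Γ.length
      · obtain ⟨x, c, h⟩ := hrep i hi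
        exact ⟨c, fun _ => ⟨x, h⟩⟩
      · exact ⟨eR1 fun _ => True, fun h => absurd h hi⟩
    exact ⟨fun i => (this i).choose, fun i => (this i).choose_spec⟩
  obtain ⟨c, hc⟩ := hc
  refine Iff.trans ?_ (Means.translate (b := e) (K := k + 1) hφ he h0 h1 hg (c := c)
    fun i hi => ?_).2.symm
  swap
  · obtain ⟨x, hx, hxc, hcw⟩ := hc i hi
    exact ⟨hcw, by rw [B.type_of_represents hxc, hsort i x hx]⟩
  -- Pairs `(x, x')` with `x = x' → x ∈ A` are the same as labels, the pairs with `x ≠ x'` all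
  -- standing for `∞`.
  have hblock : ∀ d, (∀ j ≤ k + 2, typein B.lt (d j) = j) →
      ∀ g : IS lam mu 2 → IS lam mu 2 → IS lam mu 2 → IS lam mu 2 → IS lam mu 2 → Prop,
      ((∀ x x', (x = x' → x ∈ B.A) →
        IsBlockTop B.lt (k + 1) d (fun j => optionRel (B.graph j)) x x' (g x x')) ↔
      ∀ x x' (l : Option B.A), IsLabel x x' l →
        Codes B.lt (g x x') (blockNum B.lt k l (blockLen k B.rank l + 1))) := by
    intro d hd g
    have key : ∀ x x' (l : Option B.A), IsLabel x x' l → ∀ Z,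
        (IsBlockTop B.lt (k + 1) d (fun j => optionRel (B.graph j)) x x' Z ↔
          Codes B.lt Z (blockNum B.lt k l (blockLen k B.rank l + 1))) := by
      intro x x' l hl Z
      refine H.isBlockTop_iff hd (γ := B.graph) (fun j _ x x' l hl y => optionRel_iff _ hl y)
        (fun j hj l => ?_) (fun l => ?_) hl
      · rw [RepBase.graph, dif_pos hj, B.gLow_spec, B.gamma_eq]
      · rw [RepBase.graph, dif_neg (by omega), dif_pos (by omega), B.gUp_spec, B.gamma_eq]
        simp
    constructor
    · exact fun h x x' l hl => (key x x' l hl _).1 (h x x' hl.mem)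
    · intro h x x' hx
      obtain ⟨l, hl⟩ := exists_isLabel hx
      exact (key x x' l hl _).2 (h x x' l hl)
  have main : ∀ d (g : IS lam mu 2 → IS lam mu 2 → IS lam mu 2 → IS lam mu 2 → IS lam mu 2 →
      Prop) y,
      (∀ j ≤ k + 2, typein B.lt (d j) = j) →
      (∀ x x' (l : Option B.A), IsLabel x x' l →
        Codes B.lt (g x x') (blockNum B.lt k l (blockLen k B.rank l + 1))) →
      (∀ i x, a[i]? = some x → Matches B.lt k B.rank B.collapseIso x ⟨_, y i⟩) →
      (φ.Models a ↔ (φ.tr (e + (k + 1 + 1)) (e + (k + 1 + 1) + 2 + (φ.code + 1 + Γ.length))).Sat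
        (fullEnv w Γ (k + 1) e d g y)) := by
    intro d g y hd hg hm
    refine MFormula.sat_tr_iff (r := k) (P := B.collapseIso) H (hd (k + 2) le_rfl) hg rfl hκ
      hκlam hlm (htypes ▸ hφ) (by omega) (φ.rank_le_code.trans hk.le) (frame_fullEnv h0 h1)
      ⟨partialIso_collapse k B.mk_range_rank_le, ⟨_, mem_range_self none, rfl⟩, ?_, ?_⟩
    · rintro _ ⟨_, ⟨l, rfl⟩, rfl⟩
      exact H.le_top l
    · intro i x hx
      have hi : i < Γ.length := by
        rw [hΓ, List.length_map]
        exact (List.getElem?_eq_some_iff.1 hx).1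
      exact ⟨by omega, _, (has_fullEnv (M := Γ.length) hi le_rfl).eq, hm i x hx⟩
  have hlink : ∀ d (g : IS lam mu 2 → IS lam mu 2 → IS lam mu 2 → IS lam mu 2 → IS lam mu 2 →
      Prop) y,
      (∀ j ≤ k + 2, typein B.lt (d j) = j) →
      (∀ x x' (l : Option B.A), IsLabel x x' l →
        Codes B.lt (g x x') (blockNum B.lt k l (blockLen k B.rank l + 1))) →
      ((∀ i < Γ.length, (fLink (e + (k + 1 + 1)) (2 + (k + 1 + (k + 1)) + i)
        (e + (k + 1 + 1) + 2 + i) (e + (k + 1 + 1) + 2 + (φ.code + 1 + Γ.length))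
        (Γ.getD i .card)).Sat (fullEnv w Γ (k + 1) e d g y)) ↔
      ∀ i x, a[i]? = some x → Matches B.lt k B.rank B.collapseIso x ⟨_, y i⟩) := by
    intro d g y hd hg
    have key : ∀ i < Γ.length, ∀ x, a[i]? = some x →
        ((fLink (e + (k + 1 + 1)) (2 + (k + 1 + (k + 1)) + i)
          (e + (k + 1 + 1) + 2 + i) (e + (k + 1 + 1) + 2 + (φ.code + 1 + Γ.length))
          (Γ.getD i .card)).Sat (fullEnv w Γ (k + 1) e d g y) ↔
        Matches B.lt k B.rank B.collapseIso x ⟨_, y i⟩) := by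
      intro i hi x hx
      obtain ⟨x', hx', hxc, hcw⟩ := hc i hi
      obtain rfl : x = x' := Option.some.inj (hx.symm.trans hx')
      have hs := hsort i x hx
      have := B.sat_fLink_iff (frame_fullEnv (K := k + 1) (d := d) (g := g) (y := y) h0 h1)
        (b := e + (k + 1 + 1) + 2 + (φ.code + 1 + Γ.length)) (by omega) hxc
        (hcw.fullEnv.mono (by omega)) (has_fullEnv (M := φ.code + 1 + Γ.length) hi (by omega))
        (congrArg MSort.codeType hs) (hd (k + 2) le_rfl) hg
      refine Iff.trans ?_ this
      rw [hs]
    constructor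
    · intro h i x hx
      have hi : i < Γ.length := by
        rw [hΓ, List.length_map]
        exact (List.getElem?_eq_some_iff.1 hx).1
      exact (key i hi x hx).1 (h i hi)
    · intro h i hi
      obtain ⟨x, hx, -⟩ := hc i hi
      exact (key i hi x hx).2 (h i x hx)
  -- Correct witnesses exist, which gives one direction; for the other, any witnesses satisfying the
  -- matrix are correct, and the truth value of the translation does not depend on them.
  constructor
  · intro hs
    obtain ⟨d, hd⟩ : ∃ d : ℕ → IS lam mu 2, ∀ j, typein B.lt (d j) = j :=
      ⟨fun j => (nat_lt_type (lt := B.lt) H.mk_eq.ge j).choose,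
        fun j => (nat_lt_type (lt := B.lt) H.mk_eq.ge j).choose_spec⟩
    have hd' : ∀ j ≤ k + 2, typein B.lt (d j) = j := fun j _ => hd j
    have hG : ∀ x x', ∃ Z : IS lam mu 2 → IS lam mu 2 → IS lam mu 2 → Prop,
        ∀ l : Option B.A, IsLabel x x' l →
          Codes B.lt Z (blockNum B.lt k l (blockLen k B.rank l + 1)) := by
      intro x x'
      by_cases hx : ∃ l : Option B.A, IsLabel x x' l
      · obtain ⟨l, hl⟩ := hx
        obtain ⟨Z, hZ⟩ := exists_codes (lt := B.lt) H.mk_eq.ge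
          (blockNum B.lt k l (blockLen k B.rank l + 1))
        exact ⟨Z, fun l' hl' => by rwa [← hl.unique hl']⟩
      -- A pair `(x, x)` with `x ∉ A` is no label, and its section is never used.
      · exact ⟨fun _ _ _ => True, fun l hl => absurd ⟨l, hl⟩ hx⟩
    choose G hG using hG
    have hy : ∀ i, ∃ y : NCarrier κ lam mu (Γ.getD i .card).codeType, ∀ x, a[i]? = some x →
        Matches B.lt k B.rank B.collapseIso x ⟨_, y⟩ := by
      intro i
      by_cases hi : i < Γ.length
      · obtain ⟨x, hx, hxc, -⟩ := hc i hi
        rw [hsort i x hx]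
        obtain ⟨y, hy⟩ := B.exists_matches hxc
        refine ⟨y, fun x' hx' => ?_⟩
        obtain rfl : x = x' := Option.some.inj (hx.symm.trans hx')
        exact hy
      · refine ⟨Classical.arbitrary _, fun x hx => absurd ?_ hi⟩
        rw [hΓ, List.length_map]
        exact (List.getElem?_eq_some_iff.1 hx).1
    choose y hy using hy
    exact ⟨d, G, y, isChain0_iff.2 hd', (hblock d hd' G).2 hG, (main d G y hd' hG hy).1 hs,
      (hlink d G y hd' hG).2 hy⟩
  · rintro ⟨d, G, y, hd, hG, hs, hl⟩
    have hd' := isChain0_iff.1 hd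
    have hG' := (hblock d hd' G).1 hG
    exact (main d G y hd' hG' ((hlink d G y hd' hG').1 hl)).2 hs

set_option synthInstance.maxHeartbeats 400000
set_option synthInstance.maxSize 4000

/-! ## Computability of the translation -/

section
variable {α : Type*} [Primcodable α]

/-- Primitive recursive families of numbers. -/
class PN (f : α → ℕ) : Prop where
  primrec : Primrec f

/-- Primitive recursive families of kinds of variables. -/
class PT (τ : α → NType) : Prop where
  primrec : Primrec fun a => (τ a).code

/-- Primitive recursive families of second-order formulae. -/
class PF (f : α → NFormula) : Prop where
  primrec : Primrec fun a => (f a).code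

theorem primrec_pair {f g : α → ℕ} (hf : Primrec f) (hg : Primrec g) :
    Primrec fun a => Nat.pair (f a) (g a) :=
  Primrec₂.natPair.comp hf hg

instance (priority := high) PN.const (n : ℕ) : PN fun _ : α => n := ⟨Primrec.const n⟩

instance PN.add (f g : α → ℕ) [hf : PN f] [hg : PN g] : PN fun a => f a + g a :=
  ⟨Primrec.nat_add.comp hf.1 hg.1⟩

instance PN.sub (f g : α → ℕ) [hf : PN f] [hg : PN g] : PN fun a => f a - g a :=
  ⟨Primrec.nat_sub.comp hf.1 hg.1⟩

instance (priority := high) PT.const (τ : NType) : PT fun _ : α => τ := ⟨Primrec.const _⟩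

instance PT.is (n : α → ℕ) [h : PN n] : PT fun a => .elt (.is (n a)) :=
  ⟨primrec_pair (Primrec.const 0) (primrec_pair (Primrec.const 0) h.1)⟩

instance PT.tF (n : α → ℕ) [h : PN n] : PT fun a => tF (n a) :=
  ⟨primrec_pair (Primrec.const 1) (Primrec.encode.comp
    (Primrec.list_cons.comp (primrec_pair (Primrec.const 0) h.1) (Primrec.const _)))⟩

variable {f g : α → NFormula}

/-- Gödel numbers are made by pairing with a constant tag, so every constructor preserves primitive
recursiveness; the formulae of the translation follow from the constructors. -/
instance PF.neg [h : PF f] : PF fun a => (f a).neg :=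
  ⟨primrec_pair (Primrec.const 7) h.1⟩

instance PF.and [h : PF f] [h' : PF g] : PF fun a => (f a).and (g a) :=
  ⟨primrec_pair (Primrec.const 8) (primrec_pair h.1 h'.1)⟩

instance PF.imp [PF f] [PF g] : PF fun a => (f a).imp (g a) := by
  unfold NFormula.imp; infer_instance

instance PF.iff [PF f] [PF g] : PF fun a => (f a).iff (g a) := by
  unfold NFormula.iff; infer_instance

instance PF.ex (i : α → ℕ) (τ : α → NType) [hi : PN i] [hτ : PT τ] [h : PF f] :
    PF fun a => .ex (i a) (τ a) (f a) :=
  ⟨primrec_pair (Primrec.const 9) (primrec_pair hi.1 (primrec_pair hτ.1 h.1))⟩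

instance PF.exN (b : α → ℕ) (τ : α → NType) (f : α → ℕ → ℕ → NFormula) [PN b] [PT τ]
    [PF fun a => f a (b a) (b a + 1)] : PF fun a => exN (τ a) (b a) (f a) := by
  unfold QuotSym.exN; infer_instance

instance PF.allN (b : α → ℕ) (τ : α → NType) (f : α → ℕ → ℕ → NFormula) [PN b] [PT τ]
    [PF fun a => f a (b a) (b a + 1)] : PF fun a => allN (τ a) (b a) (f a) := by
  unfold QuotSym.allN; infer_instance

instance PF.eq_is (n x y : α → ℕ) [hn : PN n] [hx : PN x] [hy : PN y] :
    PF fun a => .eq (.is (n a)) (x a) (y a) :=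
  ⟨primrec_pair (Primrec.const 0) (primrec_pair (primrec_pair (Primrec.const 0) hn.1)
    (primrec_pair hx.1 hy.1))⟩

instance PF.eqE (x y : α → ℕ) [hx : PN x] [hy : PN y] : PF fun a => eqE (x a) (y a) := by
  unfold QuotSym.eqE; infer_instance

instance PF.eq1 (x : α → ℕ) [hx : PN x] : PF fun a => .eq1 (x a) :=
  ⟨primrec_pair (Primrec.const 1) hx.1⟩

instance PF.prod1 (x : α → ℕ) [hx : PN x] : PF fun a => .prod1 (x a) :=
  ⟨primrec_pair (Primrec.const 2) hx.1⟩

instance PF.proj1 (n x y : α → ℕ) [hn : PN n] [hx : PN x] [hy : PN y] :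
    PF fun a => .proj1 (n a) (x a) (y a) :=
  ⟨primrec_pair (Primrec.const 3) (primrec_pair hn.1 (primrec_pair hx.1 hy.1))⟩

theorem PF.mem {l : α → List NSort} {r : α → ℕ} {is : α → List ℕ}
    (hl : Primrec fun a => (l a).map NSort.code) (hr : Primrec r) (his : Primrec is) :
    PF fun a => .mem (l a) (r a) (is a) :=
  ⟨primrec_pair (Primrec.const 6) (primrec_pair (Primrec.encode.comp hl)
    (primrec_pair hr (Primrec.encode.comp his)))⟩

instance PF.mem1 (r x : α → ℕ) [hr : PN r] [hx : PN x] : PF fun a => mem1 (r a) (x a) :=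
  PF.mem (l := fun _ => _) (Primrec.const _) hr.1 (Primrec.list_cons.comp hx.1 (Primrec.const _))

instance PF.mem2 (r x y : α → ℕ) [hr : PN r] [hx : PN x] [hy : PN y] :
    PF fun a => mem2 (r a) (x a) (y a) :=
  PF.mem (l := fun _ => _) (Primrec.const _) hr.1 (Primrec.list_cons.comp hx.1
    (Primrec.list_cons.comp hy.1 (Primrec.const _)))

instance PF.mem3 (r x y z : α → ℕ) [hr : PN r] [hx : PN x] [hy : PN y] [hz : PN z] :
    PF fun a => mem3 (r a) (x a) (y a) (z a) :=
  PF.mem (l := fun _ => _) (Primrec.const _) hr.1 (Primrec.list_cons.comp hx.1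
    (Primrec.list_cons.comp hy.1 (Primrec.list_cons.comp hz.1 (Primrec.const _))))

instance PF.mem5 (r x y z s t : α → ℕ) [hr : PN r] [hx : PN x] [hy : PN y] [hz : PN z]
    [hs : PN s] [ht : PN t] : PF fun a => mem5 (r a) (x a) (y a) (z a) (s a) (t a) :=
  PF.mem (l := fun _ => _) (Primrec.const _) hr.1 (Primrec.list_cons.comp hx.1
    (Primrec.list_cons.comp hy.1 (Primrec.list_cons.comp hz.1 (Primrec.list_cons.comp hs.1
      (Primrec.list_cons.comp ht.1 (Primrec.const _))))))

instance PF.memF (n r x y z s : α → ℕ) [hn : PN n] [hr : PN r] [hx : PN x] [hy : PN y] [hz : PN z]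
    [hs : PN s] : PF fun a => memF (n a) (r a) (x a) (y a) (z a) (s a) :=
  PF.mem (l := fun a => [.is (n a), _, _, _]) (Primrec.list_cons.comp
    (primrec_pair (Primrec.const 0) hn.1) (Primrec.const _)) hr.1 (Primrec.list_cons.comp hx.1
    (Primrec.list_cons.comp hy.1 (Primrec.list_cons.comp hz.1 (Primrec.list_cons.comp hs.1
      (Primrec.const _)))))

instance PF.memRep (n r x y : α → ℕ) [hn : PN n] [hr : PN r] [hx : PN x] [hy : PN y] :
    PF fun a => memRep (n a) (r a) (x a) (y a) :=
  PF.mem (l := fun a => [.is (n a), _]) (Primrec.list_cons.comp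
    (primrec_pair (Primrec.const 0) hn.1) (Primrec.const _)) hr.1 (Primrec.list_cons.comp hx.1
    (Primrec.list_cons.comp hy.1 (Primrec.const _)))

section
variable (b : α → ℕ) (F : α → ℕ → ℕ → NFormula) [PN b] [PF fun a => F a (b a) (b a + 1)]

instance PF.secR (X i : α → ℕ) [PN X] [PN i] : PF fun a => secR (b a) (X a) (i a) (F a) := by
  unfold QuotSym.secR; infer_instance

instance PF.secG (g x x' : α → ℕ) [PN g] [PN x] [PN x'] :
    PF fun a => secG (b a) (g a) (x a) (x' a) (F a) := by
  unfold QuotSym.secG; infer_instance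

instance PF.secF (n Y t : α → ℕ) [PN n] [PN Y] [PN t] :
    PF fun a => secF (b a) (n a) (Y a) (t a) (F a) := by
  unfold QuotSym.secF; infer_instance

instance PF.secSeg (x x' : α → ℕ) [PN x] [PN x'] :
    PF fun a => secSeg (b a) (x a) (x' a) (F a) := by
  unfold QuotSym.secSeg; infer_instance

instance PF.secV (X : α → ℕ) [PN X] : PF fun a => secV (b a) (X a) (F a) := by
  unfold QuotSym.secV; infer_instance

end

section
variable (b : α → ℕ) [PN b]

instance PF.fLE (r r' : α → ℕ) [PN r] [PN r'] : PF fun a => fLE (r a) (r' a) (b a) := by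
  unfold QuotSym.fLE; infer_instance

instance PF.fEqv (r r' : α → ℕ) [PN r] [PN r'] : PF fun a => fEqv (r a) (r' a) (b a) := by
  unfold QuotSym.fEqv; infer_instance

instance PF.fWO (r : α → ℕ) [PN r] : PF fun a => fWO (r a) (b a) := by
  unfold QuotSym.fWO; infer_instance

instance PF.fLess (X Y : α → ℕ) [PN X] [PN Y] : PF fun a => fLess (X a) (Y a) (b a) := by
  unfold QuotSym.fLess; infer_instance

instance PF.fSame (X Y : α → ℕ) [PN X] [PN Y] : PF fun a => fSame (X a) (Y a) (b a) := by
  unfold QuotSym.fSame; infer_instance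

instance PF.fFlag : PF fun a => fFlag (b a) := by
  unfold QuotSym.fFlag; infer_instance

instance PF.fUB (n X Y : α → ℕ) [PN n] [PN X] [PN Y] :
    PF fun a => fUB (n a) (X a) (Y a) (b a) := by
  unfold QuotSym.fUB; infer_instance

variable (q : α → ℕ) [PN q]

instance PF.fSCode (X : α → ℕ) [PN X] : PF fun a => fSCode (q a) (X a) (b a) := by
  unfold QuotSym.fSCode; infer_instance

instance PF.fInc (X : α → ℕ) [PN X] : PF fun a => fInc (q a) (X a) (b a) := by
  unfold QuotSym.fInc; infer_instance

instance PF.fCard (X : α → ℕ) [PN X] : PF fun a => fCard (q a) (X a) (b a) := by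
  unfold QuotSym.fCard; infer_instance

instance PF.fLast (x X : α → ℕ) [PN x] [PN X] : PF fun a => fLast (q a) (x a) (X a) (b a) := by
  unfold QuotSym.fLast; infer_instance

instance PF.fFun (n Y : α → ℕ) [PN n] [PN Y] : PF fun a => fFun (q a) (n a) (Y a) (b a) := by
  unfold QuotSym.fFun; infer_instance

instance PF.fSegEqv (Z i x x' : α → ℕ) [PN Z] [PN i] [PN x] [PN x'] :
    PF fun a => fSegEqv (Z a) (i a) (x a) (x' a) (b a) := by
  unfold QuotSym.fSegEqv; infer_instance

end
end

/-! ## Codes of the formulae of the translation -/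

section
variable {α : Type*} [Primcodable α]

theorem PN.comp {β : Type*} [Primcodable β] {x : α → ℕ} (hx : PN x) {h : β → α} (hh : Primrec h) :
    PN fun b => x (h b) :=
  ⟨hx.1.comp hh⟩

instance PN.unpair_fst (x : α → ℕ) [h : PN x] : PN fun a => (x a).unpair.1 :=
  ⟨Primrec.fst.comp (Primrec.unpair.comp h.1)⟩

instance PN.unpair_snd (x : α → ℕ) [h : PN x] : PN fun a => (x a).unpair.2 :=
  ⟨Primrec.snd.comp (Primrec.unpair.comp h.1)⟩

theorem primrec_ite_eq {n f g : α → ℕ} (hn : Primrec n) (m : ℕ) (hf : Primrec f) (hg : Primrec g) :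
    Primrec fun a => if n a = m then f a else g a :=
  Primrec.ite (Primrec.eq.comp hn (Primrec.const m)) hf hg

theorem PF.ite_eq {n : α → ℕ} {f g : α → NFormula} (hn : PN n) (m : ℕ) (hf : PF f) (hg : PF g) :
    PF fun a => if n a = m then f a else g a :=
  ⟨(primrec_ite_eq hn.1 m hf.1 hg.1).of_eq fun _ => (apply_ite _ _ _ _).symm⟩

/-- The code of `conjRange f ψ m`, given the code `c` of `ψ`. -/
def conjRangeCode (f : ℕ → NFormula) (c m : ℕ) : ℕ :=
  m.rec c fun j d => Nat.pair 8 (Nat.pair (f j).code d)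

theorem code_conjRange (f : ℕ → NFormula) (ψ : NFormula) (m : ℕ) :
    (conjRange f ψ m).code = conjRangeCode f ψ.code m := by
  induction m with
  | zero => rfl
  | succ m ih => simp only [conjRange, NFormula.code, ih]; rfl

theorem primrec_conjRangeCode {f : α → ℕ → NFormula} (hf : PF fun p : α × ℕ => f p.1 p.2)
    {c m : α → ℕ} (hc : Primrec c) (hm : Primrec m) :
    Primrec fun a => conjRangeCode (f a) (c a) (m a) :=
  Primrec.nat_rec' hm hc (h := fun a p => Nat.pair 8 (Nat.pair (f a p.1).code p.2))
    (primrec_pair (Primrec.const 8) (primrec_pair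
      (hf.1.comp (Primrec.fst.pair (Primrec.fst.comp Primrec.snd)))
      (Primrec.snd.comp Primrec.snd)))

theorem PF.conjRange {f : α → ℕ → NFormula} (hf : PF fun p : α × ℕ => f p.1 p.2)
    {ψ : α → NFormula} (hψ : PF ψ) {m : α → ℕ} (hm : PN m) :
    PF fun a => conjRange (f a) (ψ a) (m a) :=
  ⟨(primrec_conjRangeCode hf hψ.1 hm.1).of_eq fun _ => (code_conjRange _ _ _).symm⟩

/-- The code of `exRange s τ m ψ`, given the code `c` of `ψ`. -/
def exRangeCode (s : ℕ) (τ : ℕ → NType) (m c : ℕ) : ℕ :=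
  (List.range m).foldr (fun j d => Nat.pair 9 (Nat.pair (s + j) (Nat.pair (τ j).code d))) c

theorem code_exRange (s : ℕ) (τ : ℕ → NType) (m : ℕ) (ψ : NFormula) :
    (exRange s τ m ψ).code = exRangeCode s τ m ψ.code := by
  induction m generalizing ψ with
  | zero => rfl
  | succ m ih =>
    rw [exRange, ih, exRangeCode, exRangeCode, List.range_succ, List.foldr_append]
    rfl

theorem primrec_exRangeCode {s m c : α → ℕ} {τ : α → ℕ → NType} (hs : Primrec s)
    (hτ : PT fun p : α × ℕ => τ p.1 p.2) (hm : Primrec m) (hc : Primrec c) :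
    Primrec fun a => exRangeCode (s a) (τ a) (m a) (c a) :=
  Primrec.list_foldr (Primrec.list_range.comp hm) hc
    (h := fun a p => Nat.pair 9 (Nat.pair (s a + p.1) (Nat.pair (τ a p.1).code p.2)))
    (primrec_pair (Primrec.const 9) (primrec_pair
      (Primrec.nat_add.comp (hs.comp Primrec.fst) (Primrec.fst.comp Primrec.snd))
      (primrec_pair (hτ.1.comp (Primrec.fst.pair (Primrec.fst.comp Primrec.snd)))
        (Primrec.snd.comp Primrec.snd))))

section
variable (b e K : α → ℕ) [hb : PN b] [he : PN e] [hK : PN K]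

instance PF.fTagDigit (x x' Z : α → ℕ) [PN x] [PN x'] [PN Z] :
    PF fun a => fTagDigit (K a) (e a) (x a) (x' a) (Z a) (b a) := by
  unfold QuotSym.fTagDigit; infer_instance

instance PF.fDigit (j x x' Z : α → ℕ) [PN j] [PN x] [PN x'] [PN Z] :
    PF fun a => fDigit (e a) (x a) (x' a) (Z a) (b a) (j a) := by
  unfold QuotSym.fDigit; infer_instance

instance PF.fBlockTop (x x' Z : α → ℕ) [hx : PN x] [hx' : PN x'] [hZ : PN Z] :
    PF fun a => fBlockTop (K a) (e a) (x a) (x' a) (Z a) (b a) :=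
  have := hb.comp (Primrec.fst (α := α) (β := ℕ))
  have := he.comp (Primrec.fst (α := α) (β := ℕ))
  have := hx.comp (Primrec.fst (α := α) (β := ℕ))
  have := hx'.comp (Primrec.fst (α := α) (β := ℕ))
  have := hZ.comp (Primrec.fst (α := α) (β := ℕ))
  have : PN fun p : α × ℕ => p.2 := ⟨Primrec.snd⟩
  PF.conjRange (PF.fDigit (fun p : α × ℕ => b p.1) (fun p => e p.1) (fun p => p.2)
    (fun p => x p.1) (fun p => x' p.1) (fun p => Z p.1)) inferInstance hK

instance PF.fBlockTops : PF fun a => fBlockTops (K a) (e a) (b a) := by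
  unfold QuotSym.fBlockTops; infer_instance

instance PF.fSucc (j : α → ℕ) [PN j] : PF fun a => fSucc (e a) (b a) (j a) := by
  unfold QuotSym.fSucc; infer_instance

instance PF.fChain : PF fun a => fChain (K a) (e a) (b a) :=
  have := hb.comp (Primrec.fst (α := α) (β := ℕ))
  have := he.comp (Primrec.fst (α := α) (β := ℕ))
  have : PN fun p : α × ℕ => p.2 := ⟨Primrec.snd⟩
  PF.conjRange (PF.fSucc (fun p : α × ℕ => b p.1) (fun p => e p.1) (fun p => p.2)) inferInstance
    inferInstance

end

/-- A left inverse of `MSort.code`. -/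
def MSort.ofCode (n : ℕ) : MSort :=
  if n.unpair.1 = 0 then .is n.unpair.2 else if n.unpair.1 = 1 then .card else .f n.unpair.2

@[simp] theorem MSort.ofCode_code (s : MSort) : MSort.ofCode s.code = s := by
  cases s <;> simp [MSort.code, MSort.ofCode]

theorem MSort.apply_ofCode {β : Type*} (F : MSort → β) (n : ℕ) : F (MSort.ofCode n) =
    if n.unpair.1 = 0 then F (.is n.unpair.2) else
      if n.unpair.1 = 1 then F .card else F (.f n.unpair.2) := by
  rw [MSort.ofCode, apply_ite F, apply_ite F]

/-- Sorts enter through their codes, and a function of a decoded sort is a definition by cases on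
the tag. -/
theorem primrec_ofSort {F : α → MSort → ℕ} {n : α → ℕ} (hn : Primrec n)
    (h₀ : Primrec fun a => F a (.is (n a).unpair.2)) (h₁ : Primrec fun a => F a .card)
    (h₂ : Primrec fun a => F a (.f (n a).unpair.2)) : Primrec fun a => F a (MSort.ofCode (n a)) :=
  have h := Primrec.fst.comp (Primrec.unpair.comp hn)
  (primrec_ite_eq h 0 h₀ (primrec_ite_eq h 1 h₁ h₂)).of_eq fun _ =>
    (MSort.apply_ofCode _ _).symm

instance PT.codeType (n : α → ℕ) [hn : PN n] : PT fun a => (MSort.ofCode (n a)).codeType :=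
  ⟨primrec_ofSort (F := fun _ s => s.codeType.code) hn.1
    (PT.is fun a => (n a).unpair.2).1 (PT.const tR3).1 (PT.tF fun a => (n a).unpair.2).1⟩

/-- A left inverse of `MTerm.code`. -/
def MTerm.ofCode (n : ℕ) : MTerm :=
  if n.unpair.1 = 0 then .var n.unpair.2 else
    .app n.unpair.2.unpair.1 n.unpair.2.unpair.2.unpair.1 n.unpair.2.unpair.2.unpair.2

@[simp] theorem MTerm.ofCode_code (T : MTerm) : MTerm.ofCode T.code = T := by
  cases T <;> simp [MTerm.code, MTerm.ofCode]

theorem MTerm.index_ofCode (n : ℕ) : (MTerm.ofCode n).index = n.unpair.2 := by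
  unfold MTerm.ofCode
  split_ifs <;> simp [MTerm.index]

section
variable (q b : α → ℕ) [PN q] [PN b]

instance PF.fTerm (t : α → ℕ) [ht : PN t] (F : α → ℕ → ℕ → NFormula)
    [PF fun a => F a (b a) (b a + 1)] :
    PF fun a => fTerm (q a) (b a) (F a) (MTerm.ofCode (t a)) := by
  have h₀ : PF fun a => QuotSym.secV (b a) (q a + 2 + (t a).unpair.2) (F a) := inferInstance
  have h₁ : PF fun a => QuotSym.secF (b a) (t a).unpair.2.unpair.1
    (q a + 2 + (t a).unpair.2.unpair.2.unpair.1) (q a + 2 + (t a).unpair.2.unpair.2.unpair.2)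
    (F a) := inferInstance
  convert PF.ite_eq (PN.unpair_fst t) 0 h₀ h₁ using 2 with a
  rw [MTerm.ofCode, apply_ite (QuotSym.fTerm _ _ _)]
  rfl

theorem primrec_fEq (t t' n : α → ℕ) [PN t] [PN t'] [hn : PN n] : Primrec fun a =>
    (fEq (q a) (b a) (MTerm.ofCode (t a)) (MTerm.ofCode (t' a)) (MSort.ofCode (n a))).code := by
  refine primrec_ofSort (F := fun a s =>
    (fEq (q a) (b a) (MTerm.ofCode (t a)) (MTerm.ofCode (t' a)) s).code) hn.1 ?_ ?_ ?_
  · simp only [fEq, MTerm.index_ofCode]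
    exact PF.primrec (f := fun a => .eq (.is (n a).unpair.2) (q a + 2 + (t a).unpair.2)
      (q a + 2 + (t' a).unpair.2))
  · exact PF.primrec (f := fun a => fTerm (q a) (b a) (fun X b =>
      fTerm (q a) b (fun Y b => fSame X Y b) (MTerm.ofCode (t' a))) (MTerm.ofCode (t a)))
  · simp only [fEq, MTerm.index_ofCode]
    exact PF.primrec (f := fun a => allN (.elt (.is (n a).unpair.2)) (b a) fun t₀ b =>
      secF b (n a).unpair.2 (q a + 2 + (t a).unpair.2) t₀ fun X b =>
        secF b (n a).unpair.2 (q a + 2 + (t' a).unpair.2) t₀ fun Y b => fSame X Y b)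

theorem PF.fLink (c y n : α → ℕ) [PN c] [PN y] [hn : PN n] :
    PF fun a => fLink (q a) (c a) (y a) (b a) (MSort.ofCode (n a)) := by
  refine ⟨primrec_ofSort (F := fun a s => (QuotSym.fLink (q a) (c a) (y a) (b a) s).code) hn.1
    ?_ ?_ ?_⟩
  · exact PF.primrec (f := fun a => .eq (.is (n a).unpair.2) (c a) (y a))
  · exact PF.primrec (f := fun a => QuotSym.fLast (q a) (c a) (y a) (b a))
  · exact PF.primrec (f := fun a => QuotSym.allN (.elt (.is (n a).unpair.2)) (b a) fun t b =>
      QuotSym.allN tE b fun x b => (QuotSym.memRep (n a).unpair.2 (c a) t x).imp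
        (QuotSym.secF b (n a).unpair.2 (y a) t fun X b => QuotSym.fLast (q a) x X b))

/-- The code of `fEx q b i ψ s`, given the code `c` of `ψ`. -/
def exCode (q b i c : ℕ) : MSort → ℕ
  | .is n => Nat.pair 9 (Nat.pair (q + 2 + i) (Nat.pair (NType.elt (.is n)).code c))
  | .card => Nat.pair 9 (Nat.pair (q + 2 + i) (Nat.pair tR3.code
      (Nat.pair 8 (Nat.pair (fCard q (q + 2 + i) b).code c))))
  | .f n => Nat.pair 9 (Nat.pair (q + 2 + i) (Nat.pair (tF n).code
      (Nat.pair 8 (Nat.pair (fFun q n (q + 2 + i) b).code c))))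

theorem code_fEx (q b i : ℕ) (ψ : NFormula) (s : MSort) :
    (fEx q b i ψ s).code = exCode q b i ψ.code s := by
  cases s <;> rfl

theorem primrec_exCode (i c n : α → ℕ) [PN i] (hc : Primrec c) [hn : PN n] :
    Primrec fun a => exCode (q a) (b a) (i a) (c a) (MSort.ofCode (n a)) := by
  have hi : PN fun a => q a + 2 + i a := inferInstance
  refine primrec_ofSort (F := fun a s => exCode (q a) (b a) (i a) (c a) s) hn.1 ?_ ?_ ?_
  · exact primrec_pair (Primrec.const 9) (primrec_pair hi.1 (primrec_pair
      (PT.is fun a => (n a).unpair.2).1 hc))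
  · exact primrec_pair (Primrec.const 9) (primrec_pair hi.1 (primrec_pair
      (PT.const tR3).1 (primrec_pair (Primrec.const 8) (primrec_pair
        (PF.primrec (f := fun a => fCard (q a) (q a + 2 + i a) (b a))) hc))))
  · exact primrec_pair (Primrec.const 9) (primrec_pair hi.1 (primrec_pair
      (PT.tF fun a => (n a).unpair.2).1 (primrec_pair (Primrec.const 8) (primrec_pair
        (PF.primrec (f := fun a => fFun (q a) (n a).unpair.2 (q a + 2 + i a) (b a))) hc))))

end
end

/-! ## The translation is computable -/

/-- The code of the translation of the formula with code `l.length`, where `l` lists the codes of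
the translations of the formulae with smaller codes. -/
def trStep (q b : ℕ) (l : List ℕ) : ℕ :=
  let t := l.length.unpair.1
  let v := l.length.unpair.2
  if t = 0 then
    (fEq q b (MTerm.ofCode v.unpair.2.unpair.1) (MTerm.ofCode v.unpair.2.unpair.2)
      (MSort.ofCode v.unpair.1)).code
  else if t = 1 then
    (fTerm q b (fun X b => fTerm q b (fun Y b => fLess X Y b) (MTerm.ofCode v.unpair.2))
      (MTerm.ofCode v.unpair.1)).code
  else if t = 2 then (NFormula.eq1 (q + 2 + v)).code
  else if t = 3 then (NFormula.prod1 (q + 2 + v)).code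
  else if t = 4 then
    (NFormula.proj1 v.unpair.1 (q + 2 + v.unpair.2.unpair.1) (q + 2 + v.unpair.2.unpair.2)).code
  else if t = 5 then Nat.pair 7 (l.getD v 0)
  else if t = 6 then Nat.pair 8 (Nat.pair (l.getD v.unpair.1 0) (l.getD v.unpair.2 0))
  else exCode q b v.unpair.1 (l.getD v.unpair.2.unpair.2 0) (MSort.ofCode v.unpair.2.unpair.1)

/-- The codes of the translations of the formulae with codes below `n`. -/
def trCodes (q b : ℕ) (n : ℕ) : List ℕ :=
  n.rec [] fun _ l => l ++ [trStep q b l]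

/-- The code of `φ.tr q b`, as a function of the code of `φ`. -/
def trCode (q b n : ℕ) : ℕ := trStep q b (trCodes q b n)

/-- Course-of-values recursion becomes primitive recursion when the list of all earlier values is
carried along; its length is the argument of the next step. -/
theorem trCodes_eq (q b n : ℕ) : trCodes q b n = (List.range n).map (trCode q b) := by
  induction n with
  | zero => rfl
  | succ n ih =>
    rw [List.range_succ, List.map_append, ← ih]
    rfl

/-- A positive tag makes the code of a compound formula exceed those of its parts, so the default
`0` in `trStep` is never taken for them. -/
theorem lt_pair_of_le {a b c : ℕ} (ha : 0 < a) (h : b ≤ c) : b < Nat.pair a c := by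
  have := Nat.add_le_pair a c
  omega

theorem trCode_code (q b : ℕ) (φ : MFormula) : trCode q b φ.code = (φ.tr q b).code := by
  induction φ with
  | neg φ ih =>
    have h := lt_pair_of_le (b := φ.code) (Nat.succ_pos 4 : 0 < 5) le_rfl
    rw [trCode]
    simp [trStep, trCodes_eq, MFormula.code, MFormula.tr, NFormula.code, ih,
      List.getD_eq_getElem?_getD, h]
  | and φ φ' ih ih' =>
    have h := lt_pair_of_le (b := φ.code) (Nat.succ_pos 5 : 0 < 6) (Nat.left_le_pair φ.code φ'.code)
    have h' := lt_pair_of_le (b := φ'.code) (Nat.succ_pos 5 : 0 < 6) (Nat.right_le_pair φ.code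
        φ'.code)
    rw [trCode]
    simp [trStep, trCodes_eq, MFormula.code, MFormula.tr, NFormula.code, ih, ih',
      List.getD_eq_getElem?_getD, h, h']
  | ex i s φ ih =>
    have h := lt_pair_of_le (b := φ.code) (Nat.succ_pos 6 : 0 < 7)
      ((Nat.right_le_pair s.code φ.code).trans (Nat.right_le_pair i _))
    rw [trCode]
    simp [trStep, trCodes_eq, MFormula.code, MFormula.tr, code_fEx, ih,
      List.getD_eq_getElem?_getD, h]
  | _ => simp [trCode, trStep, trCodes_eq, MFormula.code, MFormula.tr]

theorem primrec_trStep :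
    Primrec fun a : (ℕ × ℕ) × List ℕ => trStep a.1.1 a.1.2 a.2 := by
  have h₀ : PN fun a : (ℕ × ℕ) × List ℕ => a.1.1 := ⟨Primrec.fst.comp Primrec.fst⟩
  have h₁ : PN fun a : (ℕ × ℕ) × List ℕ => a.1.2 := ⟨Primrec.snd.comp Primrec.fst⟩
  have h₂ : PN fun a : (ℕ × ℕ) × List ℕ => a.2.length := ⟨Primrec.list_length.comp Primrec.snd⟩
  have hg : ∀ x : (ℕ × ℕ) × List ℕ → ℕ, PN x → Primrec fun a : (ℕ × ℕ) × List ℕ => a.2.getD (x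
      a) 0 := fun x hx =>
    (Primrec.list_getD 0).comp Primrec.snd hx.1
  have ht := (PN.unpair_fst fun a : (ℕ × ℕ) × List ℕ => a.2.length).1
  refine primrec_ite_eq ht 0 (primrec_fEq _ _ _ _ _) ?_
  refine primrec_ite_eq ht 1 (PF.primrec (f := fun a : (ℕ × ℕ) × List ℕ =>
    fTerm a.1.1 a.1.2 (fun X b => fTerm a.1.1 b (fun Y b => fLess X Y b)
      (MTerm.ofCode a.2.length.unpair.2.unpair.2)) (MTerm.ofCode a.2.length.unpair.2.unpair.1))) ?_
  refine primrec_ite_eq ht 2 (PF.eq1 _).1 ?_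
  refine primrec_ite_eq ht 3 (PF.prod1 _).1 ?_
  refine primrec_ite_eq ht 4 (PF.proj1 _ _ _).1 ?_
  refine primrec_ite_eq ht 5 (primrec_pair (Primrec.const 7) (hg _ inferInstance)) ?_
  refine primrec_ite_eq ht 6 (primrec_pair (Primrec.const 8)
    (primrec_pair (hg _ inferInstance) (hg _ inferInstance))) ?_
  exact primrec_exCode _ _ _ _ _ (hg _ inferInstance)

theorem primrec_trCode : Primrec fun a : (ℕ × ℕ) × ℕ => trCode a.1.1 a.1.2 a.2 :=
  primrec_trStep.comp (Primrec.fst.pair (Primrec.nat_rec (f := fun _ => [])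
    (g := fun (p : ℕ × ℕ) (r : ℕ × List ℕ) => r.2 ++ [trStep p.1 p.2 r.2]) (Primrec.const [])
    (Primrec.list_concat.comp (Primrec.snd.comp Primrec.snd)
      (primrec_trStep.comp (Primrec.fst.pair (Primrec.snd.comp Primrec.snd))))))

/-- The code of `fBody Γ φ K e q b`. -/
def bodyCode (l : List ℕ) (c K e q b : ℕ) : ℕ :=
  Nat.pair 8 (Nat.pair (fChain K e b).code (Nat.pair 8 (Nat.pair (fBlockTops K e b).code
    (conjRangeCode (fun i => fLink q (2 + (K + K) + i) (q + 2 + i) b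
      (MSort.ofCode (l.getD i MSort.card.code))) (trCode q b c) l.length))))

/-- The code of `fPrefix Γ K e q ψ`, given the code `c` of `ψ`. -/
def prefixCode (l : List ℕ) (K e q c : ℕ) : ℕ :=
  exRangeCode e (fun _ => tE) (K + 2) (Nat.pair 9 (Nat.pair (q + 1) (Nat.pair tR5.code
    (exRangeCode (q + 2) (fun i => (MSort.ofCode (l.getD i MSort.card.code)).codeType) l.length
        c))))

/-- The code of `φ.translate Γ K`, as a function of the list `l` of the codes of the sorts in `Γ`
and the code `c` of `φ`. -/
def translateCode (l : List ℕ) (c K : ℕ) : ℕ :=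
  let e := 2 + (K + K) + l.length
  let q := e + (K + 1)
  prefixCode l K e q (bodyCode l c K e q (q + 2 + (c + 1 + l.length)))

theorem translateCode_eq (Γ : List MSort) (φ : MFormula) (K : ℕ) :
    translateCode (Γ.map MSort.code) φ.code K = (φ.translate Γ K).code := by
  -- Positions beyond the end of the list yield the sort `card` on both sides.
  have h : ∀ i, MSort.ofCode ((Γ.map MSort.code).getD i MSort.card.code) = Γ.getD i .card := by
    intro i
    rw [List.getD_map, MSort.ofCode_code]
  simp only [translateCode, prefixCode, bodyCode, MFormula.translate, fPrefix, fBody, code_exRange,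
    NFormula.code, code_conjRange, h, List.length_map, trCode_code]

section
variable {α : Type*} [Primcodable α] {l : α → List ℕ} (hl : Primrec l)
include hl

theorem pn_getD_fst : PN fun p : α × ℕ => (l p.1).getD p.2 MSort.card.code :=
  ⟨(Primrec.list_getD _).comp (hl.comp Primrec.fst) Primrec.snd⟩

theorem primrec_bodyCode {c K e q b : α → ℕ} (hc : Primrec c) (hK : PN K) (he : PN e) (hq : PN q)
    (hb : PN b) : Primrec fun a => bodyCode (l a) (c a) (K a) (e a) (q a) (b a) := by
  have := hK.comp (Primrec.fst (α := α) (β := ℕ))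
  have := hq.comp (Primrec.fst (α := α) (β := ℕ))
  have := hb.comp (Primrec.fst (α := α) (β := ℕ))
  have : PN fun p : α × ℕ => p.2 := ⟨Primrec.snd⟩
  have hs := pn_getD_fst hl
  have h : PF fun p : α × ℕ => fLink (q p.1) (2 + (K p.1 + K p.1) + p.2) (q p.1 + 2 + p.2) (b p.1)
      (MSort.ofCode ((l p.1).getD p.2 MSort.card.code)) :=
    PF.fLink (fun p : α × ℕ => q p.1) (fun p => b p.1) (fun p => 2 + (K p.1 + K p.1) + p.2)
      (fun p => q p.1 + 2 + p.2) (fun p => (l p.1).getD p.2 MSort.card.code)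
  have h₁ := primrec_trCode.comp ((hq.1.pair hb.1).pair hc)
  have h₂ : Primrec fun a => conjRangeCode (fun i => fLink (q a) (2 + (K a + K a) + i)
      (q a + 2 + i) (b a) (MSort.ofCode ((l a).getD i MSort.card.code))) (trCode (q a) (b a) (c a))
      (l a).length :=
    primrec_conjRangeCode (f := fun a i => fLink (q a) (2 + (K a + K a) + i)
      (q a + 2 + i) (b a) (MSort.ofCode ((l a).getD i MSort.card.code))) h h₁
      (Primrec.list_length.comp hl)
  exact primrec_pair (Primrec.const 8) (primrec_pair (PF.fChain b e K).1
    (primrec_pair (Primrec.const 8) (primrec_pair (PF.fBlockTops b e K).1 h₂)))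

theorem primrec_prefixCode {c K e q : α → ℕ} (hc : Primrec c) (hK : PN K) (he : PN e) (hq : PN q) :
    Primrec fun a => prefixCode (l a) (K a) (e a) (q a) (c a) := by
  have hs := pn_getD_fst hl
  have h₁ : PN fun a => q a + 1 := inferInstance
  have h₂ : PN fun a => q a + 2 := inferInstance
  have h₃ : PN fun a => K a + 2 := inferInstance
  exact primrec_exRangeCode he.1 (PT.const _) h₃.1 (primrec_pair (Primrec.const 9)
    (primrec_pair h₁.1 (primrec_pair (Primrec.const _) (primrec_exRangeCode h₂.1
      (PT.codeType fun p : α × ℕ => (l p.1).getD p.2 MSort.card.code)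
      (Primrec.list_length.comp hl) hc))))

theorem primrec_translateCode {c K : α → ℕ} (hc : PN c) (hK : PN K) :
    Primrec fun a => translateCode (l a) (c a) (K a) := by
  have : PN fun a => (l a).length := ⟨Primrec.list_length.comp hl⟩
  exact primrec_prefixCode hl (e := fun a => 2 + (K a + K a) + (l a).length)
    (q := fun a => 2 + (K a + K a) + (l a).length + (K a + 1))
    (primrec_bodyCode hl (e := fun a => 2 + (K a + K a) + (l a).length)
      (q := fun a => 2 + (K a + K a) + (l a).length + (K a + 1))
      (b := fun a => 2 + (K a + K a) + (l a).length + (K a + 1) + 2 + (c a + 1 + (l a).length))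
      hc.1 hK inferInstance inferInstance inferInstance) hK inferInstance inferInstance

end

/-- The input pairs the code of the list of sorts with that of the formula; a number which encodes
no list is read as the empty one. -/
theorem computable_translate : Computable fun n : ℕ => Nat.pair (n.unpair.2 + 1)
    (translateCode (((Encodable.decode n.unpair.1 : Option (List ℕ))).getD []) n.unpair.2
      (n.unpair.2 + 1)) := by
  have : PN fun n : ℕ => n := ⟨Primrec.id⟩
  have h : PN fun n : ℕ => n.unpair.2 + 1 := inferInstance
  exact (primrec_pair h.1 (primrec_translateCode (Primrec.option_getD.comp (Primrec.decode.comp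
    (PN.unpair_fst fun n => n).1) (Primrec.const [])) inferInstance h)).to_comp

end QuotSym

/-- `F` computes, from (the Gödel numbers of) the list `Γ` of the sorts of `x₀, …, x_{n-1}` and the
formula `φ(x₀, …, x_{n-1})`, the integer `k` and (the Gödel number of) the formula `ψ`; these serve
for all `κ, lam, mu`. -/
theorem theorem5p9 :
    ∃ F : ℕ → ℕ, Computable F ∧
      ∀ (Γ : List QuotSym.MSort) (φ : QuotSym.MFormula), φ.WellSorted (fun i => Γ[i]?) →
        ∃ (k : ℕ) (ψ : QuotSym.NFormula),
          F (Nat.pair (Encodable.encode (Γ.map QuotSym.MSort.code)) φ.code) =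
            Nat.pair k ψ.code ∧
          ψ.WellSorted (fun i => (QuotSym.repContext k Γ)[i]?) ∧
          ∀ κ lam mu : Cardinal.{u}, Cardinal.aleph0 ≤ κ → κ < lam → lam ≤ Order.succ mu →
            Cardinal.continuum < κ.ord.cof →
            ∀ (a : List (QuotSym.MElt κ lam mu)) (c : List (QuotSym.NElt κ lam mu)),
              a.map Sigma.fst = Γ → QuotSym.IsRepresentation k a c →
                (φ.Models a ↔ ψ.Models c) := by
  -- With `k = φ.code + 1` the collapse has level `φ.code`, because canonical gaps of level `m` need
  -- `g_0, …, g_m` and `g^m`.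
  refine ⟨_, QuotSym.computable_translate, fun Γ φ hφ => ⟨φ.code + 1, φ.translate Γ (φ.code + 1),
    ?_, φ.wellSorted_translate hφ, ?_⟩⟩
  · simp only [Nat.unpair_pair, Encodable.encodek, Option.getD_some, QuotSym.translateCode_eq]
  · rintro κ lam mu - hκlam hlm hcof a c rfl hr
    -- As `cf κ ≤ κ`, all nonzero members of `Card⁻` exceed `𝔠`; this is what reduces sums to
    -- suprema.
    have hκ : Cardinal.continuum < κ := hcof.trans_le (Ordinal.cof_ord_le κ)
    exact QuotSym.MFormula.models_translate_iff hκ hκlam hlm rfl hφ hr
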